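/- Terminology. Let $I=[a,b]$, $a<b$. A basic cusp map is a map $f:\bigcup_j I_j\to I$, where $(I_j)_j$ is a finite or countable family of pairwise disjoint open subintervals $I_j=(p_j,q_j)$ of $I$, such that $f$ is a $C^1$ diffeomorphism from each $I_j$ onto its image, and the limits $\lim_{x\to p_j^+}Df(x)$ and $\lim_{x\to q_j^-}Df(x)$ exist and equal $0$ or $\pm\infty$. It is a cusp map if there are constants $C,\epsilon>0$ such that for every $j$ and all $x,x'\in I_j$: $|Df(x)-Df(x')|\le C|x-x'|^\epsilon$ whenever $|Df(x)|,|Df(x')|\le 2$, and $\left|\frac1{Df(x)}-\frac1{Df(x')}\right|\le C|x-x'|^\epsilon$ whenever $|Df(x)|,|Df(x')|\ge\frac12$. A continuous map $g:I\to I$ is also called a cusp map if it is $C^1$ off a countable set $S$ and, with $\mathrm{Crit}$ the set of critical points of $g|_{I\setminus S}$, the restriction $g|_{I\setminus(S\cup\mathrm{Crit})}$ is a cusp map in the previous sense. Let $T:[0,1]\to[0,1]$ be the full tent map, $T(x)=2x$ for $x\le\frac12$ and $T(x)=2-2x$ for $x>\frac12$. Let $TC$ be the class of self-maps $f$ of compact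 intervals $[a,b]$ which are continuous cusp maps, or restrictions to $[a,b]$ of continuous cusp maps of a larger compact interval, and for which there is a homeomorphism $h:[a,b]\to[0,1]$ with $h\circ f=T\circ h$. Let $TC^\infty$ be the subclass of those $f$ for which $h$ is a $C^\infty$ diffeomorphism from $(a,b)$ onto $(0,1)$. For $f\in TC$ let $\mu_f$ be the pullback by $h$ of Lebesgue measure, $\mu_f(A)=\mathrm{Leb}(h(A))$. For an ergodic $f$-invariant probability measure $\mu$, the Lyapunov exponent is $\chi_\mu=\int\log|Df|\,d\mu\in[-\infty,+\infty]$ (natural logarithm), if this integral exists, that is, if the integrals of the positive and of the negative part are not both infinite. Proposition 43. For every $f\in TC$, $\mu_f$ is an ergodic $f$-invariant probability measure, and it is the measure of maximal entropy: it is the unique $f$-invariant Borel probability measure of maximal metric (Kolmogorov–Sinai) entropy. If $f\in TC^\infty$, then $\mu_f$ is also absolutely continuous with respect to Lebesgue measure. Moreover, there exist, with $[a,b]=[0,1]$: 1. $f\in TC^\infty$ with poles at both boundary points (that is, $|Df(x)|\to\infty$ as $x\to0^+$ and as $x\to1^-$, with $f$ of class $C^1$ near, but not at, these points) such that the Lyapunov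 exponent of $\mu_f$ is $\log 2$; 2. $f\in TC^\infty$ such that the Lyapunov exponent of $\mu_f$ does not exist; 3. $f\in TC^\infty$ with a smooth parabolic fixed point at the boundary (a boundary point $p$ with $f(p)=p$, $|Df(p)|=1$ and $f$ of class $C^\infty$ on a one-sided neighbourhood of $p$, including $p$) such that the Lyapunov exponent of $\mu_f$ is $\log 2$; 4. $f\in TC$ such that the Lyapunov exponent of $\mu_f$ is $+\infty$. -/

import Mathlib

noncomputable section

namespace CuspMaps

open Set Filter Topology MeasureTheory
open scoped ENNReal ContDiff

/-! ### Cusp maps -/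

/-- A one-sided limit of a derivative is allowed to be `0`, `+∞` or `-∞` only. -/
def TendstoZeroOrInfty (φ : ℝ → ℝ) (l : Filter ℝ) : Prop :=
  Tendsto φ l (𝓝 0) ∨ Tendsto φ l atTop ∨ Tendsto φ l atBot

/-- `f : ⋃ⱼ (pⱼ, qⱼ) → [a, b]` is a basic cusp map. The finite or countable collection of
open intervals is given by the set `J` of the pairs `(pⱼ, qⱼ)`; values of `f` outside of the
union of these intervals play no role. -/
structure IsBasicCuspMap (a b : ℝ) (J : Set (ℝ × ℝ)) (f : ℝ → ℝ) : Prop where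
  lt : a < b
  countable : J.Countable
  nonempty : ∀ j ∈ J, j.1 < j.2
  subset : ∀ j ∈ J, Ioo j.1 j.2 ⊆ Icc a b
  disjoint : J.PairwiseDisjoint fun j => Ioo j.1 j.2
  mapsTo : ∀ j ∈ J, MapsTo f (Ioo j.1 j.2) (Icc a b)
  contDiffOn : ∀ j ∈ J, ContDiffOn ℝ 1 f (Ioo j.1 j.2)
  injOn : ∀ j ∈ J, InjOn f (Ioo j.1 j.2)
  deriv_ne_zero : ∀ j ∈ J, ∀ x ∈ Ioo j.1 j.2, deriv f x ≠ 0
  left_limit : ∀ j ∈ J, TendstoZeroOrInfty (deriv f) (𝓝[>] j.1)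
  right_limit : ∀ j ∈ J, TendstoZeroOrInfty (deriv f) (𝓝[<] j.2)

/-- A cusp map defined on a union of open intervals: a basic cusp map such that, with common
constants `C, ε > 0`, on each of the intervals `Df` is Hölder where `|Df| ≤ 2` and `1 / Df` is
Hölder where `|Df| ≥ 1 / 2`. -/
def IsCuspMapOn (a b : ℝ) (J : Set (ℝ × ℝ)) (f : ℝ → ℝ) : Prop :=
  IsBasicCuspMap a b J f ∧
  ∃ C > (0 : ℝ), ∃ ε > (0 : ℝ), ∀ j ∈ J, ∀ x ∈ Ioo j.1 j.2, ∀ y ∈ Ioo j.1 j.2,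
    (|deriv f x| ≤ 2 → |deriv f y| ≤ 2 →
      |deriv f x - deriv f y| ≤ C * |x - y| ^ ε) ∧
    (2⁻¹ ≤ |deriv f x| → 2⁻¹ ≤ |deriv f y| →
      |(deriv f x)⁻¹ - (deriv f y)⁻¹| ≤ C * |x - y| ^ ε)

/-- The critical points of `g : [a, b] → ℝ` outside of the exceptional set `S`. -/
def crit (a b : ℝ) (S : Set ℝ) (g : ℝ → ℝ) : Set ℝ :=
  {x ∈ Icc a b \ S | derivWithin g (Icc a b) x = 0}

/-- A continuous map `g : [a, b] → [a, b]` is a cusp map if it is `C¹` off a countable set `S`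
and its restriction to `[a, b] \ (S ∪ Crit)` is a cusp map. Only the values of `g` on `[a, b]`
matter. -/
def IsCuspMap (a b : ℝ) (g : ℝ → ℝ) : Prop :=
  ContinuousOn g (Icc a b) ∧ MapsTo g (Icc a b) (Icc a b) ∧
  ∃ S ⊆ Icc a b, S.Countable ∧
    (∀ x ∈ Icc a b \ S, DifferentiableWithinAt ℝ g (Icc a b) x) ∧
    ContinuousOn (derivWithin g (Icc a b)) (Icc a b \ S) ∧
    ∃ J : Set (ℝ × ℝ), (⋃ j ∈ J, Ioo j.1 j.2) = Icc a b \ (S ∪ crit a b S g) ∧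
      IsCuspMapOn a b J g

/-- A self-map of `[a, b]` is a cusp map or a restriction of a cusp map `g` of a (possibly)
larger compact interval `[a', b']`. -/
def IsCuspMapOrRestriction {a b : ℝ} (f : Icc a b → Icc a b) : Prop :=
  ∃ a' b' : ℝ, ∃ g : ℝ → ℝ, a' ≤ a ∧ b ≤ b' ∧ IsCuspMap a' b' g ∧ ∀ x : Icc a b, g x = f x

/-! ### The full tent map and the classes of maps conjugate to it -/

/-- The full tent map of `[0, 1]`. -/
def tent (x : Icc (0 : ℝ) 1) : Icc (0 : ℝ) 1 :=
  ⟨if (x : ℝ) ≤ 1 / 2 then 2 * (x : ℝ) else 2 - 2 * (x : ℝ), by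
    have h0 := x.2.1
    have h1 := x.2.2
    split_ifs <;> constructor <;> linarith⟩

/-- Extension by zero of a function on a compact interval. -/
def ext {a b c d : ℝ} (f : Icc a b → Icc c d) : ℝ → ℝ :=
  Function.extend Subtype.val (fun x => (f x : ℝ)) 0

/-- The class `TC`, together with the conjugacy `h`: `f` is a cusp map or a restriction of a
cusp map and `h` is a homeomorphism with `h ∘ f = T ∘ h`. -/
structure TC {a b : ℝ} (f : Icc a b → Icc a b) (h : Icc a b ≃ₜ Icc (0 : ℝ) 1) : Prop where
  cusp : IsCuspMapOrRestriction f
  conj : Function.Semiconj h f tent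

/-- The class `TC^∞`: the conjugacy is a `C^∞` diffeomorphism from the interior of the interval
onto `(0, 1)`. -/
structure TCSmooth {a b : ℝ} (f : Icc a b → Icc a b) (h : Icc a b ≃ₜ Icc (0 : ℝ) 1) : Prop
    extends TC f h where
  smooth : ContDiffOn ℝ ∞ (ext h) (Ioo a b)
  smooth_symm : ContDiffOn ℝ ∞ (ext h.symm) (Ioo (0 : ℝ) 1)

/-- Lebesgue measure on the compact interval `[a, b]`. -/
def leb (a b : ℝ) : Measure (Icc a b) :=
  Measure.comap Subtype.val volume

/-- The measure `μ_f`: the pullback by the conjugacy `h` of Lebesgue measure on `[0, 1]`, that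
is, `μ_f A = Leb (h A)`. -/
def muOf {a b : ℝ} (h : Icc a b ≃ₜ Icc (0 : ℝ) 1) : Measure (Icc a b) :=
  Measure.map h.symm (leb 0 1)

/-! ### Metric entropy and measures of maximal entropy -/

section Entropy

variable {X : Type*} [MeasurableSpace X]

/-- The entropy `H_μ` of the finite partition of `X` into the fibres of `ξ`. -/
def partitionEntropy {ι : Type*} [Fintype ι] (μ : Measure X) (ξ : X → ι) : ℝ :=
  ∑ i, Real.negMulLog (μ.real (ξ ⁻¹' {i}))

/-- The join of the partitions `ξ, T⁻¹ ξ, …, T^{-(n-1)} ξ`. -/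
def itinerary (T : X → X) {k : ℕ} (ξ : X → Fin k) (n : ℕ) (x : X) : Fin n → Fin k :=
  fun i => ξ (T^[i] x)

/-- The entropy of `T` with respect to `μ` and to a finite partition. -/
def entropyOfPartition (T : X → X) (μ : Measure X) {k : ℕ} (ξ : X → Fin k) : ℝ≥0∞ :=
  limsup (fun n : ℕ => ENNReal.ofReal (partitionEntropy μ (itinerary T ξ n) / n)) atTop

/-- The metric (Kolmogorov–Sinai) entropy of `T` with respect to `μ`: the supremum over all
finite measurable partitions. -/
def metricEntropy (T : X → X) (μ : Measure X) : ℝ≥0∞ :=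
  ⨆ (k : ℕ) (ξ : X → Fin k) (_ : Measurable ξ), entropyOfPartition T μ ξ

/-- `μ` is an invariant probability measure for `T`. -/
def IsInvariantProbability (T : X → X) (μ : Measure X) : Prop :=
  IsProbabilityMeasure μ ∧ MeasurePreserving T μ μ

/-- `μ` is the (unique) measure of maximal entropy of `T`. -/
def IsTheMeasureOfMaximalEntropy (T : X → X) (μ : Measure X) : Prop :=
  IsInvariantProbability T μ ∧
  ∀ ν : Measure X, IsInvariantProbability T ν →
    metricEntropy T ν ≤ metricEntropy T μ ∧ (metricEntropy T ν = metricEntropy T μ → ν = μ)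

end Entropy

/-! ### Lyapunov exponents -/

section Lyapunov

variable {a b : ℝ}

/-- `log |Df|`, with `log 0 = -∞`. -/
def logAbsDeriv (f : Icc a b → Icc a b) (x : Icc a b) : EReal :=
  ENNReal.log (ENNReal.ofReal |derivWithin (ext f) (Icc a b) x|)

/-- The integral of the positive part of `log |Df|`. -/
def lyapunovPos (f : Icc a b → Icc a b) (μ : Measure (Icc a b)) : ℝ≥0∞ :=
  ∫⁻ x, (logAbsDeriv f x).toENNReal ∂μ

/-- The integral of the negative part of `log |Df|`. -/
def lyapunovNeg (f : Icc a b → Icc a b) (μ : Measure (Icc a b)) : ℝ≥0∞ :=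
  ∫⁻ x, (-logAbsDeriv f x).toENNReal ∂μ

/-- The Lyapunov exponent `∫ log |Df| dμ` exists, in `[-∞, +∞]`, and is equal to `χ`. It exists
unless the integrals of the positive and of the negative part are both infinite. -/
def HasLyapunovExponent (f : Icc a b → Icc a b) (μ : Measure (Icc a b)) (χ : EReal) : Prop :=
  (lyapunovPos f μ ≠ ⊤ ∨ lyapunovNeg f μ ≠ ⊤) ∧
    (lyapunovPos f μ : EReal) - (lyapunovNeg f μ : EReal) = χ

end Lyapunov

/-! ### Poles and parabolic points -/

section Boundary

variable {a b : ℝ}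

/-- `f` has poles at both boundary points of `[a, b]`: it is `C¹` on an open interval adjacent
to the boundary point and `|Df|` tends to infinity there. -/
def HasPolesAtBoundary (f : Icc a b → Icc a b) : Prop :=
  (∃ ε > (0 : ℝ), Ioo a (a + ε) ⊆ Icc a b ∧ ContDiffOn ℝ 1 (ext f) (Ioo a (a + ε)) ∧
    Tendsto (fun x => |deriv (ext f) x|) (𝓝[>] a) atTop) ∧
  (∃ ε > (0 : ℝ), Ioo (b - ε) b ⊆ Icc a b ∧ ContDiffOn ℝ 1 (ext f) (Ioo (b - ε) b) ∧
    Tendsto (fun x => |deriv (ext f) x|) (𝓝[<] b) atTop)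

/-- `p` is a smooth parabolic fixed point of `f`: `f` is `C^∞` on a (relative) neighbourhood of
`p` in `[a, b]`, `f p = p` and `|Df p| = 1`. -/
def IsSmoothParabolicFixedPoint (f : Icc a b → Icc a b) (p : Icc a b) : Prop :=
  f p = p ∧
  (∃ δ > (0 : ℝ), ContDiffOn ℝ ∞ (ext f) (Icc a b ∩ Ioo (p - δ) (p + δ))) ∧
  |derivWithin (ext f) (Icc a b) p| = 1

end Boundary

end CuspMaps

end

set_option linter.unusedSectionVars false

noncomputable section

namespace CuspMaps

open Set Filter Topology MeasureTheory
open scoped ENNReal ContDiff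

/-! ### Entropy inequalities for finite arrays of nonnegative numbers -/

section FiniteEntropy

variable {ι κ : Type*} [Fintype ι] [Fintype κ]

/-! Conjugation by `h` turns `(f, μ_f)` into the tent map with Lebesgue measure. Two facts about the
latter suffice. The coding by the two branches separates points, since distances double while codes
agree. Each branch halves measure: `μ (α ⁻¹' {i} ∩ T ⁻¹' B) = μ B / 2`. By induction a cylinder of
length `n` meets an invariant set `A` in measure `μ A / 2 ^ n`, so `A` is independent of a
generating π-system, hence of itself; this is ergodicity (`ergodic_of_half`). For any invariant `ν`,
the Kolmogorov–Sinai theorem (`metricEntropy_le`, by martingale convergence) bounds the entropy by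
`H_ν(αⁿ) / n ≤ log 2`. Equality forces all `2 ^ n` cylinders to have equal mass, hence `ν = μ`
(`isTheMeasureOfMaximalEntropy_of_half`). Absolute continuity holds because a differentiable `h`
sends null sets to null sets.

The examples are `f = H ∘ T ∘ H⁻¹`. If `H` has derivative `ρ`, then `|Df (H y)| = 2 ρ(T y) / ρ(y)`,
so `log |Df| ∘ H` is `log 2` plus the coboundary `log ρ ∘ T - log ρ`. When `log ρ` is integrable the
exponent is `log 2` (`hasLyapunovExponent_log_two`).

Examples 1 and 2 take `ρ` proportional to `exp (-w)`: with `w = 1 / √(y (1 - y))` the logarithm is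
integrable, while with `w = 1 / (y (1 - y))` the positive part of `log |Df|` diverges at `0` and the
negative part at `1 / 2`. Example 3 takes `H` to be a rational function of `ℓ = -log₂ y`. On the
left branch `T` is `ℓ ↦ ℓ - 1`, which in the coordinate `z = 1 / ℓ` is the parabolic map `z ↦ z / (1
- z)`; the rational formulas continue past `z = 0` and provide the larger interval `[-1 / 3, 1]`.
Example 4 prescribes the inverse branches `s(t) / 2` and `1 - s(t) / 2`, with `s` the smoothstep
polynomial, and obtains `H` from the contraction principle. There `3 H(y) ≤ (3 H(2 y))²`, so `-log
H` grows at least like a multiple of `1 / y` and is not integrable.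

The cusp conditions are checked on parametrizations `p z ↦ q z` of the branches. Both Hölder
conditions follow from one for `1 / (1 + |Df|)` (`abs_sub_le_of_inv_one_add`). -/

/-- Subadditivity of entropy for an unnormalized array. The total-mass term makes it homogeneous, so
that it applies to each slice of a joint distribution without dividing by the mass of the slice. -/
lemma sum_negMulLog_add_le (a : ι → κ → ℝ) (ha : ∀ i j, 0 ≤ a i j) :
    ∑ i, ∑ j, Real.negMulLog (a i j) + Real.negMulLog (∑ i, ∑ j, a i j) ≤
      ∑ i, Real.negMulLog (∑ j, a i j) + ∑ j, Real.negMulLog (∑ i, a i j) := by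
  set r : ι → ℝ := fun i => ∑ j, a i j with hr
  set c : κ → ℝ := fun j => ∑ i, a i j with hc
  set s : ℝ := ∑ i, ∑ j, a i j with hs
  have hr0 : ∀ i, 0 ≤ r i := fun i => Finset.sum_nonneg fun j _ => ha i j
  have hc0 : ∀ j, 0 ≤ c j := fun j => Finset.sum_nonneg fun i _ => ha i j
  have hs0 : 0 ≤ s := Finset.sum_nonneg fun i _ => hr0 i
  have har : ∀ i j, a i j ≤ r i := fun i j =>
    Finset.single_le_sum (f := fun j => a i j) (fun j _ => ha i j) (Finset.mem_univ j)
  have hac : ∀ i j, a i j ≤ c j := fun i j =>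
    Finset.single_le_sum (f := fun i => a i j) (fun i _ => ha i j) (Finset.mem_univ i)
  have hrs : ∀ i, r i ≤ s := fun i =>
    Finset.single_le_sum (f := r) (fun i _ => hr0 i) (Finset.mem_univ i)
  have hsc : ∑ j, c j = s := Finset.sum_comm
  rcases hs0.eq_or_lt with h0 | hpos
  · have hr' : ∀ i, r i = 0 := fun i => le_antisymm (h0 ▸ hrs i) (hr0 i)
    have ha' : ∀ i j, a i j = 0 := fun i j => le_antisymm (hr' i ▸ har i j) (ha i j)
    have hc' : ∀ j, c j = 0 := fun j => Finset.sum_eq_zero fun i _ => ha' i j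
    simp [ha', ← h0]
  -- This is `log x ≤ x - 1` at `x = r c / (s a)`, times `a`. The left sides sum to zero.
  have key : ∀ i j, a i j - r i * c j / s ≤
      a i j * Real.log (a i j) + a i j * Real.log s - a i j * Real.log (r i)
        - a i j * Real.log (c j) := by
    intro i j
    rcases (ha i j).eq_or_lt with h | h
    · rw [← h]
      have := div_nonneg (mul_nonneg (hr0 i) (hc0 j)) hs0
      simpa using this
    · have hri : 0 < r i := h.trans_le (har i j)
      have hcj : 0 < c j := h.trans_le (hac i j)
      have h1 := Real.log_le_sub_one_of_pos (x := r i * c j / (s * a i j)) (by positivity)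
      rw [Real.log_div (by positivity) (by positivity), Real.log_mul hri.ne' hcj.ne',
        Real.log_mul hpos.ne' h.ne'] at h1
      have h2 := mul_le_mul_of_nonneg_left h1 h.le
      have h3 : a i j * (r i * c j / (s * a i j) - 1) = r i * c j / s - a i j := by
        field_simp
      rw [h3] at h2
      linarith
  have hsum := Finset.sum_le_sum fun i (_ : i ∈ Finset.univ) =>
    Finset.sum_le_sum fun j (_ : j ∈ Finset.univ) => key i j
  simp only [Finset.sum_sub_distrib, Finset.sum_add_distrib] at hsum
  have e1 : ∑ i, ∑ j, r i * c j / s = s := by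
    have : ∀ i, ∑ j, r i * c j / s = r i := fun i => by
      rw [← Finset.sum_div, ← Finset.mul_sum, hsc, mul_div_assoc, div_self hpos.ne', mul_one]
    simp_rw [this]; rfl
  have e2 : ∑ i, ∑ j, a i j * Real.log s = s * Real.log s := by
    simp_rw [← Finset.sum_mul]; rfl
  have e3 : ∑ i, ∑ j, a i j * Real.log (r i) = ∑ i, r i * Real.log (r i) := by
    simp_rw [← Finset.sum_mul]; rfl
  have e4 : ∑ i, ∑ j, a i j * Real.log (c j) = ∑ j, c j * Real.log (c j) := by
    rw [Finset.sum_comm]; simp_rw [← Finset.sum_mul]; rfl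
  have e5 : ∑ i, ∑ j, a i j = s := rfl
  rw [e1, e2, e3, e4, e5] at hsum
  simp only [Real.negMulLog, neg_mul, Finset.sum_neg_distrib]
  linarith

lemma negMulLog_sum_le (a : ι → ℝ) (ha : ∀ i, 0 ≤ a i) :
    Real.negMulLog (∑ i, a i) ≤ ∑ i, Real.negMulLog (a i) := by
  simp only [Real.negMulLog, neg_mul, Finset.sum_neg_distrib, Finset.sum_mul]
  refine neg_le_neg (Finset.sum_le_sum fun i _ => ?_)
  rcases (ha i).eq_or_lt with h | h
  · simp [← h]
  · exact mul_le_mul_of_nonneg_left (Real.log_le_log h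
      (Finset.single_le_sum (fun i _ => ha i) (Finset.mem_univ i))) h.le

/-- The right side is the tangent line of the concave function `-p log p` at `p = 1 / n`. Summed
over `n` atoms it gives `log n`, and contact only at `1 / n` gives the equality case. -/
lemma negMulLog_le_add {p n : ℝ} (hp : 0 ≤ p) (hn : 0 < n) :
    Real.negMulLog p ≤ p * Real.log n + (1 / n - p) := by
  rcases hp.eq_or_lt with rfl | hp
  · simp [hn.le]
  · have h := Real.log_le_sub_one_of_pos (x := 1 / (n * p)) (by positivity)
    rw [one_div, Real.log_inv, Real.log_mul hn.ne' hp.ne'] at h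
    have h2 := mul_le_mul_of_nonneg_left h hp.le
    have h3 : p * ((n * p)⁻¹ - 1) = 1 / n - p := by field_simp
    rw [h3] at h2
    simp only [Real.negMulLog]
    linarith

lemma negMulLog_lt_add {p n : ℝ} (hp : 0 ≤ p) (hn : 0 < n) (hne : p ≠ 1 / n) :
    Real.negMulLog p < p * Real.log n + (1 / n - p) := by
  rcases hp.eq_or_lt with rfl | hp
  · simp [hn]
  · have h := Real.log_lt_sub_one_of_pos (x := 1 / (n * p)) (by positivity) (by
      intro h; apply hne; field_simp at h ⊢; linarith)
    rw [one_div, Real.log_inv, Real.log_mul hn.ne' hp.ne'] at h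
    have h2 := mul_lt_mul_of_pos_left h hp
    have h3 : p * ((n * p)⁻¹ - 1) = 1 / n - p := by field_simp
    rw [h3] at h2
    simp only [Real.negMulLog]
    linarith

end FiniteEntropy

/-! ### Entropy and conditional entropy of finite partitions -/

section PartitionEntropy

variable {X : Type*} [MeasurableSpace X] {μ : Measure X} [IsProbabilityMeasure μ]
  {ι κ τ : Type*} [Fintype ι] [Fintype κ] [Fintype τ]
  [MeasurableSpace ι] [MeasurableSpace κ] [MeasurableSpace τ]
  [MeasurableSingletonClass ι] [MeasurableSingletonClass κ] [MeasurableSingletonClass τ]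

lemma real_preimage_comp_eq_sum [DecidableEq κ] {ξ : X → ι} (hξ : Measurable ξ) (g : ι → κ)
    (j : κ) :
    μ.real (g ∘ ξ ⁻¹' {j}) = ∑ i with g i = j, μ.real (ξ ⁻¹' {i}) := by
  have : g ∘ ξ ⁻¹' {j} = ⋃ i ∈ Finset.univ.filter (fun i => g i = j), ξ ⁻¹' {i} := by
    ext x; simp
  rw [this, measureReal_biUnion_finset]
  · intro i _ i' _ hne
    exact Disjoint.preimage _ (by simpa using hne)
  · exact fun i _ => hξ (measurableSet_singleton i)

lemma sum_real_preimage {ξ : X → ι} (hξ : Measurable ξ) :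
    ∑ i, μ.real (ξ ⁻¹' {i}) = 1 := by
  classical
  have := real_preimage_comp_eq_sum (μ := μ) hξ (fun _ => ()) ()
  simp only [Finset.filter_true] at this
  rw [← this]
  have h : (fun _ : ι => ()) ∘ ξ ⁻¹' {()} = univ := by ext; simp
  rw [h]; simp

lemma real_preimage_fst {ξ : X → ι} {η : X → κ} (hξ : Measurable ξ) (hη : Measurable η) (i : ι) :
    μ.real (ξ ⁻¹' {i}) = ∑ j, μ.real ((fun x => (ξ x, η x)) ⁻¹' {(i, j)}) := by
  have : ξ ⁻¹' {i} = ⋃ j ∈ (Finset.univ : Finset κ), (fun x => (ξ x, η x)) ⁻¹' {(i, j)} := by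
    ext x; simp
  rw [this, measureReal_biUnion_finset]
  · intro j _ j' _ hne
    exact Disjoint.preimage _ (by simpa using hne)
  · exact fun j _ => (hξ.prodMk hη) (measurableSet_singleton _)

lemma partitionEntropy_comp_le {ξ : X → ι} (hξ : Measurable ξ) (g : ι → κ) :
    partitionEntropy μ (g ∘ ξ) ≤ partitionEntropy μ ξ := by
  classical
  unfold partitionEntropy
  rw [← Finset.sum_fiberwise (g := g) Finset.univ fun i => Real.negMulLog (μ.real (ξ ⁻¹' {i}))]
  refine Finset.sum_le_sum fun j _ => ?_
  rw [real_preimage_comp_eq_sum hξ, Finset.sum_filter, Finset.sum_filter]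
  refine (negMulLog_sum_le _ fun i => ?_).trans (Finset.sum_le_sum fun i _ => ?_)
  · split_ifs <;> simp
  · split_ifs <;> simp

lemma partitionEntropy_le_of_eq_comp {ξ : X → ι} {η : X → κ} (hξ : Measurable ξ) (g : ι → κ)
    (h : ∀ x, η x = g (ξ x)) : partitionEntropy μ η ≤ partitionEntropy μ ξ := by
  obtain rfl : η = g ∘ ξ := funext h
  exact partitionEntropy_comp_le hξ g

/-- The conditional entropy `H(ξ | η)`. -/
def condEntropy (μ : Measure X) (ξ : X → ι) (η : X → κ) : ℝ :=
  partitionEntropy μ (fun x => (ξ x, η x)) - partitionEntropy μ η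

/-- The array inequality is applied to the slice over each value of `ζ`, and the slices are summed.
-/
lemma partitionEntropy_submodular {ξ : X → ι} {η : X → κ} {ζ : X → τ}
    (hξ : Measurable ξ) (hη : Measurable η) (hζ : Measurable ζ) :
    partitionEntropy μ (fun x => (ξ x, η x, ζ x)) + partitionEntropy μ ζ ≤
      partitionEntropy μ (fun x => (ξ x, ζ x)) + partitionEntropy μ (fun x => (η x, ζ x)) := by
  set a : τ → ι → κ → ℝ := fun k i j => μ.real ((fun x => (ξ x, η x, ζ x)) ⁻¹' {(i, j, k)})
    with ha
  have e1 : ∀ i k, μ.real ((fun x => (ξ x, ζ x)) ⁻¹' {(i, k)}) = ∑ j, a k i j := by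
    intro i k
    rw [real_preimage_fst (hξ.prodMk hζ) hη]
    refine Finset.sum_congr rfl fun j _ => ?_
    congr 1; ext x; simp; tauto
  have e2 : ∀ j k, μ.real ((fun x => (η x, ζ x)) ⁻¹' {(j, k)}) = ∑ i, a k i j := by
    intro j k
    rw [real_preimage_fst (hη.prodMk hζ) hξ]
    refine Finset.sum_congr rfl fun j _ => ?_
    congr 1; ext x; simp; tauto
  have e3 : ∀ k, μ.real (ζ ⁻¹' {k}) = ∑ i, ∑ j, a k i j := by
    intro k
    rw [real_preimage_fst hζ hξ]
    refine Finset.sum_congr rfl fun i _ => ?_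
    rw [← e1]
    congr 1; ext x; simp; tauto
  unfold partitionEntropy
  simp only [Fintype.sum_prod_type, e1, e2, e3]
  have e4 : ∑ i, ∑ j, ∑ k, Real.negMulLog (a k i j) =
      ∑ k, ∑ i, ∑ j, Real.negMulLog (a k i j) :=
    (Finset.sum_congr rfl fun i _ => Finset.sum_comm).trans Finset.sum_comm
  have e5 : ∑ i, ∑ k, Real.negMulLog (∑ j, a k i j) =
      ∑ k, ∑ i, Real.negMulLog (∑ j, a k i j) := Finset.sum_comm
  have e6 : ∑ j, ∑ k, Real.negMulLog (∑ i, a k i j) =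
      ∑ k, ∑ j, Real.negMulLog (∑ i, a k i j) := Finset.sum_comm
  change ∑ i, ∑ j, ∑ k, Real.negMulLog (a k i j) + _ ≤ _
  rw [e4, e5, e6, ← Finset.sum_add_distrib, ← Finset.sum_add_distrib]
  exact Finset.sum_le_sum fun k _ => sum_negMulLog_add_le _ fun i j => measureReal_nonneg

lemma condEntropy_prod_le {ξ : X → ι} {η : X → κ} {ζ : X → τ}
    (hξ : Measurable ξ) (hη : Measurable η) (hζ : Measurable ζ) :
    condEntropy μ (fun x => (ξ x, η x)) ζ ≤ condEntropy μ ξ ζ + condEntropy μ η ζ := by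
  have h := partitionEntropy_submodular (μ := μ) hξ hη hζ
  have h2 : partitionEntropy μ (fun x => ((ξ x, η x), ζ x)) ≤
      partitionEntropy μ (fun x => (ξ x, η x, ζ x)) :=
    partitionEntropy_le_of_eq_comp (hξ.prodMk (hη.prodMk hζ))
      (fun p => ((p.1, p.2.1), p.2.2)) fun _ => rfl
  unfold condEntropy
  linarith

/-- Submodularity, where the join of `η` with `ζ` is no finer than `η` because `ζ` is a function of
`η`. -/
lemma condEntropy_le_of_eq_comp {ξ : X → ι} {η : X → κ} {ζ : X → τ}
    (hξ : Measurable ξ) (hη : Measurable η) (hζ : Measurable ζ) (g : κ → τ)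
    (h : ∀ x, ζ x = g (η x)) : condEntropy μ ξ η ≤ condEntropy μ ξ ζ := by
  have h1 := partitionEntropy_submodular (μ := μ) hξ hη hζ
  have h2 : partitionEntropy μ (fun x => (ξ x, η x)) ≤
      partitionEntropy μ (fun x => (ξ x, η x, ζ x)) :=
    partitionEntropy_le_of_eq_comp (hξ.prodMk (hη.prodMk hζ)) (fun p => (p.1, p.2.1)) fun _ => rfl
  have h3 : partitionEntropy μ (fun x => (η x, ζ x)) ≤ partitionEntropy μ η :=
    partitionEntropy_le_of_eq_comp hη (fun j => (j, g j)) fun x => by rw [h]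
  unfold condEntropy
  linarith

lemma partitionEntropy_prod_le {ξ : X → ι} {η : X → κ}
    (hξ : Measurable ξ) (hη : Measurable η) :
    partitionEntropy μ (fun x => (ξ x, η x)) ≤ partitionEntropy μ ξ + partitionEntropy μ η := by
  have h := partitionEntropy_submodular (μ := μ) hξ hη (measurable_const (a := ()))
  have h1 : partitionEntropy μ (fun x => (ξ x, η x)) ≤
      partitionEntropy μ (fun x => (ξ x, η x, ())) :=
    partitionEntropy_le_of_eq_comp (hξ.prodMk (hη.prodMk measurable_const))
      (fun p => (p.1, p.2.1)) fun _ => rfl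
  have h2 : partitionEntropy μ (fun x => (ξ x, ())) ≤ partitionEntropy μ ξ :=
    partitionEntropy_le_of_eq_comp hξ (fun i => (i, ())) fun _ => rfl
  have h3 : partitionEntropy μ (fun x => (η x, ())) ≤ partitionEntropy μ η :=
    partitionEntropy_le_of_eq_comp hη (fun i => (i, ())) fun _ => rfl
  have h4 : 0 ≤ partitionEntropy μ (fun _ : X => ()) :=
    Finset.sum_nonneg fun i _ => Real.negMulLog_nonneg measureReal_nonneg measureReal_le_one
  linarith

lemma partitionEntropy_nonneg (ξ : X → ι) : 0 ≤ partitionEntropy μ ξ :=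
  Finset.sum_nonneg fun _ _ => Real.negMulLog_nonneg measureReal_nonneg measureReal_le_one

lemma partitionEntropy_comp_measurePreserving {T : X → X} (hT : MeasurePreserving T μ μ)
    {ξ : X → ι} (hξ : Measurable ξ) :
    partitionEntropy μ (fun x => ξ (T x)) = partitionEntropy μ ξ := by
  unfold partitionEntropy
  refine Finset.sum_congr rfl fun i _ => ?_
  congr 1
  exact hT.measureReal_preimage (hξ (measurableSet_singleton i)).nullMeasurableSet

lemma partitionEntropy_le_log_card [Nonempty ι] {ξ : X → ι} (hξ : Measurable ξ) :
    partitionEntropy μ ξ ≤ Real.log (Fintype.card ι) := by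
  have hn : (0 : ℝ) < Fintype.card ι := by exact_mod_cast Fintype.card_pos
  calc partitionEntropy μ ξ
      ≤ ∑ i, (μ.real (ξ ⁻¹' {i}) * Real.log (Fintype.card ι) +
          (1 / (Fintype.card ι : ℝ) - μ.real (ξ ⁻¹' {i}))) :=
        Finset.sum_le_sum fun i _ => negMulLog_le_add measureReal_nonneg hn
    _ = Real.log (Fintype.card ι) := by
        rw [Finset.sum_add_distrib, Finset.sum_sub_distrib, ← Finset.sum_mul,
          sum_real_preimage hξ]
        simp [hn.ne']

lemma real_preimage_of_partitionEntropy_eq [Nonempty ι] {ξ : X → ι} (hξ : Measurable ξ)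
    (h : Real.log (Fintype.card ι) ≤ partitionEntropy μ ξ) (i : ι) :
    μ.real (ξ ⁻¹' {i}) = 1 / Fintype.card ι := by
  have hn : (0 : ℝ) < Fintype.card ι := by exact_mod_cast Fintype.card_pos
  by_contra hne
  have : partitionEntropy μ ξ < Real.log (Fintype.card ι) := by
    calc partitionEntropy μ ξ
        < ∑ i, (μ.real (ξ ⁻¹' {i}) * Real.log (Fintype.card ι) +
            (1 / (Fintype.card ι : ℝ) - μ.real (ξ ⁻¹' {i}))) :=
          Finset.sum_lt_sum (fun i _ => negMulLog_le_add measureReal_nonneg hn)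
            ⟨i, Finset.mem_univ i, negMulLog_lt_add measureReal_nonneg hn hne⟩
      _ = Real.log (Fintype.card ι) := by
          rw [Finset.sum_add_distrib, Finset.sum_sub_distrib, ← Finset.sum_mul,
            sum_real_preimage hξ]
          simp [hn.ne']
  linarith

end PartitionEntropy

/-! ### Continuity of entropy along partitions that converge almost everywhere -/

section EntropyLimits

variable {X : Type*} [MeasurableSpace X] {μ : Measure X} [IsProbabilityMeasure μ]
  {ι : Type*} [Fintype ι] [MeasurableSpace ι] [MeasurableSingletonClass ι]

/-- Almost everywhere convergence of the indicators of the atoms gives convergence of their masses,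
and `-p log p` is continuous. -/
lemma tendsto_partitionEntropy {ξ : X → ι} {ξn : ℕ → X → ι} (hξ : Measurable ξ)
    (hξn : ∀ n, Measurable (ξn n)) (h : ∀ᵐ x ∂μ, ∀ᶠ n in atTop, ξn n x = ξ x) :
    Tendsto (fun n => partitionEntropy μ (ξn n)) atTop (𝓝 (partitionEntropy μ ξ)) := by
  refine tendsto_finsetSum _ fun i _ => (Real.continuous_negMulLog.tendsto _).comp ?_
  refine (ENNReal.tendsto_toReal (measure_ne_top μ _)).comp ?_
  refine tendsto_measure_of_ae_tendsto_indicator_of_isFiniteMeasure _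
    (hξ (measurableSet_singleton i)) (fun n => hξn n (measurableSet_singleton i)) ?_
  filter_upwards [h] with x hx
  filter_upwards [hx] with n hn
  simp [hn]

lemma condEntropy_self {ξ : X → ι} (hξ : Measurable ξ) : condEntropy μ ξ ξ = 0 := by
  refine sub_eq_zero.2 (le_antisymm ?_ ?_)
  · exact partitionEntropy_le_of_eq_comp hξ (fun i => (i, i)) fun _ => rfl
  · exact partitionEntropy_le_of_eq_comp (hξ.prodMk hξ) Prod.fst fun _ => rfl

lemma tendsto_condEntropy {ξ : X → ι} {ξn : ℕ → X → ι} (hξ : Measurable ξ)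
    (hξn : ∀ n, Measurable (ξn n)) (h : ∀ᵐ x ∂μ, ∀ᶠ n in atTop, ξn n x = ξ x) :
    Tendsto (fun n => condEntropy μ ξ (ξn n)) atTop (𝓝 0) := by
  rw [← condEntropy_self (μ := μ) hξ]
  refine Tendsto.sub ?_ (tendsto_partitionEntropy hξ hξn h)
  refine tendsto_partitionEntropy (hξ.prodMk hξ) (fun n => hξ.prodMk (hξn n)) ?_
  filter_upwards [h] with x hx
  filter_upwards [hx] with n hn
  rw [hn]

end EntropyLimits

/-! ### Generators and the Kolmogorov–Sinai theorem -/

section Itinerary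

variable {X : Type*} [MeasurableSpace X] {T : X → X} {k l : ℕ}

lemma measurable_itinerary (hT : Measurable T) {ξ : X → Fin k} (hξ : Measurable ξ) (n : ℕ) :
    Measurable (itinerary T ξ n) :=
  measurable_pi_lambda _ fun i => hξ.comp (hT.iterate i)

/-- The infinite itinerary. -/
def fullItinerary (T : X → X) (ξ : X → Fin k) (x : X) : ℕ → Fin k := fun i => ξ (T^[i] x)

lemma measurable_fullItinerary (hT : Measurable T) {ξ : X → Fin k} (hξ : Measurable ξ) :
    Measurable (fullItinerary T ξ) :=
  measurable_pi_lambda _ fun i => hξ.comp (hT.iterate i)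

/-- The filtration by the partitions into cylinders. -/
def cylinderFiltration (hT : Measurable T) {ξ : X → Fin k} (hξ : Measurable ξ) :
    Filtration ℕ ‹MeasurableSpace X› where
  seq n := MeasurableSpace.comap (itinerary T ξ n) inferInstance
  mono' := by
    intro m n hmn
    have h : itinerary T ξ m = (fun w i => w (Fin.castLE hmn i)) ∘ itinerary T ξ n := rfl
    dsimp only
    rw [h, ← MeasurableSpace.comap_comp]
    exact MeasurableSpace.comap_mono (measurable_of_countable _).comap_le
  le' n := (measurable_itinerary hT hξ n).comap_le

/-- An injective measurable map between standard Borel spaces is a measurable embedding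
(Lusin–Souslin). Hence a coding that separates points generates the whole σ-algebra. -/
lemma iSup_cylinderFiltration [StandardBorelSpace X] (hT : Measurable T) {ξ : X → Fin k}
    (hξ : Measurable ξ) (hinj : Function.Injective (fullItinerary T ξ)) :
    ⨆ n, cylinderFiltration hT hξ n = ‹MeasurableSpace X› := by
  refine le_antisymm (iSup_le fun n => (cylinderFiltration hT hξ).le n) ?_
  have hemb := (measurable_fullItinerary hT hξ).measurableEmbedding hinj
  conv_lhs => rw [← hemb.comap_eq]
  rw [← measurable_iff_comap_le]
  refine @measurable_pi_lambda _ _ _ (_) _ _ fun i => ?_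
  have h1 : Measurable[cylinderFiltration hT hξ (i + 1)] fun x => ξ (T^[i] x) := by
    have : (fun x => ξ (T^[i] x)) = (fun w => w (Fin.last i)) ∘ itinerary T ξ (i + 1) := by
      ext x; simp [itinerary]
    rw [this]
    exact (measurable_of_countable _).comp (comap_measurable _)
  exact h1.mono (le_iSup (fun n => (cylinderFiltration hT hξ n : MeasurableSpace X)) (i + 1))
    le_rfl

/-- The element of `Fin k` at distance less than `1 / 2` from a real number. -/
def nearestFin (hk : 0 < k) (t : ℝ) : Fin k :=
  open Classical in
  if h : ∃ i : Fin k, |t - (i : ℕ)| < 1 / 2 then h.choose else ⟨0, hk⟩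

lemma nearestFin_eq (hk : 0 < k) {t : ℝ} {i : Fin k} (h : |t - (i : ℕ)| < 1 / 2) :
    nearestFin hk t = i := by
  have hex : ∃ i : Fin k, |t - (i : ℕ)| < 1 / 2 := ⟨i, h⟩
  rw [nearestFin, dif_pos hex]
  have h2 := hex.choose_spec
  set j := hex.choose
  have h3 : |((j : ℕ) : ℝ) - (i : ℕ)| < 1 := by
    have := abs_sub_le ((j : ℕ) : ℝ) t (i : ℕ)
    rw [abs_sub_comm ((j : ℕ) : ℝ) t] at this
    linarith
  have h4 : |((j : ℕ) : ℤ) - (i : ℕ)| < 1 := by exact_mod_cast h3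
  rw [Int.abs_lt_one_iff, sub_eq_zero] at h4
  exact Fin.ext (by exact_mod_cast h4)

variable {μ : Measure X} [IsProbabilityMeasure μ]

/-- Lévy's upward theorem: the conditional expectations of the integer label `ξ` given the cylinders
converge to it almost everywhere. Rounding them to the nearest label gives partitions coarser than
the cylinder partitions and eventually equal to `ξ` at almost every point. -/
lemma exists_tendsto_condEntropy_itinerary [StandardBorelSpace X] (hT : Measurable T)
    {α : X → Fin l} (hα : Measurable α) (hinj : Function.Injective (fullItinerary T α))
    {ξ : X → Fin k} (hξ : Measurable ξ) {δ : ℝ} (hδ : 0 < δ) :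
    ∃ N, condEntropy μ ξ (itinerary T α N) < δ := by
  have : Nonempty X := nonempty_of_isProbabilityMeasure μ
  have hk : 0 < k := Fin.pos (ξ (Classical.arbitrary X))
  set ℱ := cylinderFiltration hT hα
  set g : X → ℝ := fun x => ((ξ x : ℕ) : ℝ) with hg
  have hgm : Measurable g := (measurable_of_countable (fun i : Fin k => ((i : ℕ) : ℝ))).comp hξ
  have hgi : Integrable g μ := by
    refine Integrable.of_bound hgm.aestronglyMeasurable (k : ℝ) (ae_of_all _ fun x => ?_)
    rw [Real.norm_of_nonneg (by positivity)]
    exact Nat.cast_le.2 (ξ x).2.le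
  have hlim := hgi.tendsto_ae_condExp (ℱ := ℱ)
    (by rw [iSup_cylinderFiltration hT hα hinj]; exact hgm.stronglyMeasurable)
  have hfac : ∀ n, ∃ u : (Fin n → Fin l) → ℝ, Measurable u ∧ μ[g | ℱ n] = u ∘ itinerary T α n :=
    fun n => StronglyMeasurable.exists_eq_measurable_comp stronglyMeasurable_condExp |>.imp
      fun u hu => ⟨hu.1.measurable, hu.2⟩
  choose u hum hu using hfac
  set ξn : ℕ → X → Fin k := fun n x => nearestFin hk (u n (itinerary T α n x))
  have hξn : ∀ n, Measurable (ξn n) := fun n =>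
    (measurable_of_countable (fun w => nearestFin hk (u n w))).comp (measurable_itinerary hT hα n)
  have hev : ∀ᵐ x ∂μ, ∀ᶠ n in atTop, ξn n x = ξ x := by
    filter_upwards [hlim] with x hx
    filter_upwards [Metric.tendsto_atTop'.1 hx (1 / 2) (by norm_num) |>.choose_spec |>
      fun h => (eventually_gt_atTop _).mono h] with n hn
    refine nearestFin_eq hk ?_
    rw [Real.dist_eq, hu n] at hn
    exact hn
  obtain ⟨N, hN⟩ := ((tendsto_condEntropy hξ hξn hev).eventually (gt_mem_nhds hδ)).exists
  exact ⟨N, (condEntropy_le_of_eq_comp hξ (measurable_itinerary hT hα N) (hξn N)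
    (fun w => nearestFin hk (u N w)) fun _ => rfl).trans_lt hN⟩

lemma subadditive_partitionEntropy (hT : MeasurePreserving T μ μ) {α : X → Fin l}
    (hα : Measurable α) : Subadditive fun n => partitionEntropy μ (itinerary T α n) := by
  intro m n
  have hm := measurable_itinerary hT.measurable hα m
  have hn := measurable_itinerary hT.measurable hα n
  have h1 : partitionEntropy μ (itinerary T α (m + n)) ≤
      partitionEntropy μ (fun x => (itinerary T α m x, itinerary T α n (T^[m] x))) := by
    refine partitionEntropy_le_of_eq_comp (hm.prodMk (hn.comp (hT.measurable.iterate m)))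
      (fun w => Fin.addCases w.1 w.2) fun x => ?_
    ext i
    refine Fin.addCases (fun i => ?_) (fun i => ?_) i
    · simp [itinerary]
    · simp [itinerary, ← Function.iterate_add_apply, add_comm]
  have h2 := partitionEntropy_prod_le (μ := μ) hm (hn.comp (hT.measurable.iterate m))
  have h3 := partitionEntropy_comp_measurePreserving (hT.iterate m) hn
  simp only [Function.comp_def] at h2
  linarith

/-- Induction on `n`. The first symbol of `ξ` is conditioned on the first `N` symbols of `α` alone.
The remaining symbols are conditioned on the shifted itinerary, and invariance reduces them to the
previous case. -/
lemma condEntropy_itinerary_le (hT : MeasurePreserving T μ μ) {α : X → Fin l}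
    (hα : Measurable α) {ξ : X → Fin k} (hξ : Measurable ξ) (N n : ℕ) :
    condEntropy μ (itinerary T ξ n) (itinerary T α (n + N)) ≤
      n * condEntropy μ ξ (itinerary T α N) := by
  have hm := fun n => measurable_itinerary hT.measurable hα n
  have hm' := fun n => measurable_itinerary hT.measurable hξ n
  induction n with
  | zero =>
    rw [Nat.cast_zero, zero_mul]
    refine sub_nonpos.2 (partitionEntropy_le_of_eq_comp (hm _) (fun w => (Fin.elim0, w)) fun x => ?_)
    ext i
    · exact i.elim0
    · rfl
  | succ n ih =>
    set ζ := itinerary T α (n + 1 + N)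
    have hζ : Measurable ζ := hm _
    have h1 : condEntropy μ (itinerary T ξ (n + 1)) ζ ≤
        condEntropy μ (fun x => (ξ x, itinerary T ξ n (T x))) ζ := by
      refine sub_le_sub_right (partitionEntropy_le_of_eq_comp
        ((hξ.prodMk ((hm' n).comp hT.measurable)).prodMk hζ)
        (fun w => (Fin.cons w.1.1 w.1.2, w.2)) fun x => ?_) _
      refine Prod.ext (funext fun i => ?_) rfl
      refine Fin.cases ?_ (fun i => ?_) i <;> simp [itinerary]
    have h2 := condEntropy_prod_le (μ := μ) hξ ((hm' n).comp hT.measurable) hζ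
    have h3 : condEntropy μ ξ ζ ≤ condEntropy μ ξ (itinerary T α N) :=
      condEntropy_le_of_eq_comp hξ hζ (hm N)
        (fun w => fun i => w (Fin.castLE (by omega) i)) fun _ => rfl
    have h4 : condEntropy μ (itinerary T ξ n ∘ T) ζ ≤
        condEntropy μ (itinerary T ξ n ∘ T) (itinerary T α (n + N) ∘ T) :=
      condEntropy_le_of_eq_comp ((hm' n).comp hT.measurable) hζ ((hm _).comp hT.measurable)
        (fun w => fun i => w ⟨i + 1, by omega⟩) fun x => by
          ext i; simp [itinerary, ζ]
    have h5 : condEntropy μ (itinerary T ξ n ∘ T) (itinerary T α (n + N) ∘ T) =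
        condEntropy μ (itinerary T ξ n) (itinerary T α (n + N)) := by
      unfold condEntropy
      rw [← partitionEntropy_comp_measurePreserving hT (hm (n + N)),
        ← partitionEntropy_comp_measurePreserving hT ((hm' n).prodMk (hm (n + N)))]
      rfl
    simp only [Function.comp_def] at h2 h4 h5
    push_cast
    linarith

/-- `H(ξⁿ) ≤ H(αⁿ⁺ᴺ) + n H(ξ | αᴺ)`, where the last conditional entropy is arbitrarily small.
Dividing by `n`, Fekete's lemma gives the limit of `H(αⁿ) / n`, which is at most each single term
`H(αᵐ) / m`. -/
theorem metricEntropy_le [StandardBorelSpace X] (hT : MeasurePreserving T μ μ) {α : X → Fin l}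
    (hα : Measurable α) (hinj : Function.Injective (fullItinerary T α)) {m : ℕ} (hm : m ≠ 0) :
    metricEntropy T μ ≤ ENNReal.ofReal (partitionEntropy μ (itinerary T α m) / m) := by
  refine iSup_le fun k => iSup_le fun ξ => iSup_le fun hξ => ?_
  set A : ℕ → ℝ := fun n => partitionEntropy μ (itinerary T α n) with hA
  have hsub : Subadditive A := subadditive_partitionEntropy hT hα
  have hbdd : BddBelow (range fun n => A n / n) :=
    ⟨0, by rintro _ ⟨n, rfl⟩; exact div_nonneg (partitionEntropy_nonneg _) n.cast_nonneg⟩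
  have hlim := hsub.tendsto_lim hbdd
  have hLm := hsub.lim_le_div hbdd hm
  refine le_of_forall_pos_le_add fun ε hε => ?_
  rcases eq_or_ne ε ⊤ with rfl | hεt
  · simp
  obtain ⟨N, hN⟩ := exists_tendsto_condEntropy_itinerary (μ := μ) hT.measurable hα hinj hξ
    (ENNReal.toReal_pos hε.ne' hεt)
  have hbound : ∀ n : ℕ, partitionEntropy μ (itinerary T ξ n) / n ≤
      A (n + N) / n + ε.toReal := by
    intro n
    rcases n.eq_zero_or_pos with rfl | hn
    · simp
    have hn' : (0 : ℝ) < n := by exact_mod_cast hn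
    have h1 := condEntropy_itinerary_le hT hα hξ N n
    have h2 : partitionEntropy μ (itinerary T ξ n) ≤
        partitionEntropy μ (fun x => (itinerary T ξ n x, itinerary T α (n + N) x)) :=
      partitionEntropy_le_of_eq_comp ((measurable_itinerary hT.measurable hξ n).prodMk
        (measurable_itinerary hT.measurable hα _)) Prod.fst fun _ => rfl
    unfold condEntropy at h1
    rw [div_add' _ _ _ hn'.ne', div_le_div_iff_of_pos_right hn']
    have h3 := mul_le_mul_of_nonneg_left hN.le hn'.le
    unfold condEntropy at h3
    simp only [hA]
    linarith
  have hlim2 : Tendsto (fun n : ℕ => A (n + N) / n + ε.toReal) atTop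
      (𝓝 (hsub.lim + ε.toReal)) := by
    refine Tendsto.add ?_ tendsto_const_nhds
    have h1 := (tendsto_add_atTop_iff_nat N).2 hlim
    have h2 : Tendsto (fun n : ℕ => ((n + N : ℕ) : ℝ) / n) atTop (𝓝 1) := by
      have h3 : Tendsto (fun n : ℕ => 1 + (N : ℝ) / n) atTop (𝓝 (1 + 0)) :=
        tendsto_const_nhds.add (tendsto_const_div_atTop_nhds_zero_nat _)
      rw [add_zero] at h3
      refine h3.congr' ?_
      filter_upwards [eventually_gt_atTop 0] with n hn
      have : (n : ℝ) ≠ 0 := by exact_mod_cast hn.ne'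
      push_cast
      field_simp
    have h3 := h1.mul h2
    rw [mul_one] at h3
    refine h3.congr' ?_
    filter_upwards [eventually_gt_atTop 0] with n hn
    have : (n : ℝ) ≠ 0 := by exact_mod_cast hn.ne'
    have : ((n + N : ℕ) : ℝ) ≠ 0 := by positivity
    field_simp
  calc entropyOfPartition T μ ξ
      ≤ limsup (fun n : ℕ => ENNReal.ofReal (A (n + N) / n + ε.toReal)) atTop :=
        limsup_le_limsup (Eventually.of_forall fun n => ENNReal.ofReal_le_ofReal (hbound n))
    _ = ENNReal.ofReal (hsub.lim + ε.toReal) :=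
        ((ENNReal.continuous_ofReal.tendsto _).comp hlim2).limsup_eq
    _ ≤ ENNReal.ofReal (A m / m + ε.toReal) := ENNReal.ofReal_le_ofReal (by linarith)
    _ ≤ ENNReal.ofReal (A m / m) + ENNReal.ofReal ε.toReal := ENNReal.ofReal_add_le
    _ = ENNReal.ofReal (A m / m) + ε := by rw [ENNReal.ofReal_toReal hεt]

end Itinerary

/-! ### Measures for which each of two branches halves mass -/

section BernoulliHalf

variable {X : Type*} [MeasurableSpace X] [StandardBorelSpace X] {T : X → X}

lemma ext_of_cylinders {k : ℕ} (hT : Measurable T) {α : X → Fin k} (hα : Measurable α)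
    (hinj : Function.Injective (fullItinerary T α)) {μ ν : Measure X} [IsFiniteMeasure μ]
    (h : ∀ n w, μ (itinerary T α n ⁻¹' {w}) = ν (itinerary T α n ⁻¹' {w})) : μ = ν := by
  have hmap : ∀ n, ∀ s, MeasurableSet[cylinderFiltration hT hα n] s → μ s = ν s := by
    rintro n _ ⟨W, hW, rfl⟩
    have hm := measurable_itinerary hT hα n
    rw [← Measure.map_apply hm hW, ← Measure.map_apply hm hW]
    congr 1
    refine Measure.ext_of_singleton fun w => ?_
    rw [Measure.map_apply hm (measurableSet_singleton _),
      Measure.map_apply hm (measurableSet_singleton _), h]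
  refine ext_of_generate_finite
    (⋃ n, {s | MeasurableSet[cylinderFiltration hT hα n] s}) ?_ ?_ ?_ ?_
  · exact ((MeasurableSpace.generateFrom_iUnion_measurableSet
      fun n => (cylinderFiltration hT hα n : MeasurableSpace X)).trans
      (iSup_cylinderFiltration hT hα hinj)).symm
  · exact isPiSystem_iUnion_of_monotone _
      (fun n => @MeasurableSpace.isPiSystem_measurableSet _ (cylinderFiltration hT hα n))
      fun m n hmn s hs => (cylinderFiltration hT hα).mono hmn s hs
  · intro s hs
    obtain ⟨n, hn⟩ := mem_iUnion.1 hs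
    exact hmap n s hn
  · exact hmap 0 univ MeasurableSet.univ

variable {α : X → Fin 2} {μ : Measure X}

/-- Since `T ⁻¹' A = A`, removing the first symbol exhibits the intersection as one branch of the
preimage of a shorter cylinder met with `A`, so each symbol costs a factor `2`. -/
lemma measure_inter_cylinder (hT : Measurable T) (hα : Measurable α)
    (hhalf : ∀ i, ∀ B, MeasurableSet B → μ (α ⁻¹' {i} ∩ T ⁻¹' B) = μ B / 2)
    {A : Set X} (hA : MeasurableSet A) (hinv : T ⁻¹' A = A) (n : ℕ) (w : Fin n → Fin 2) :
    μ (itinerary T α n ⁻¹' {w} ∩ A) = μ A / 2 ^ n := by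
  induction n with
  | zero =>
    have : itinerary T α 0 ⁻¹' {w} = univ := by
      ext x; simp [Subsingleton.elim (itinerary T α 0 x) w]
    simp [this]
  | succ n ih =>
    have h : itinerary T α (n + 1) ⁻¹' {w} ∩ A =
        α ⁻¹' {w 0} ∩ T ⁻¹' (itinerary T α n ⁻¹' {Fin.tail w} ∩ A) := by
      ext x
      rw [preimage_inter, hinv]
      simp only [mem_inter_iff, mem_preimage, mem_singleton_iff, ← and_assoc]
      refine and_congr_left fun _ => ?_
      rw [funext_iff, Fin.forall_fin_succ, funext_iff]
      simp [itinerary, Fin.tail]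
    rw [h, hhalf _ _ (((measurable_itinerary hT hα n) (measurableSet_singleton _)).inter hA), ih,
      pow_succ, ENNReal.div_eq_inv_mul, ENNReal.div_eq_inv_mul, ENNReal.div_eq_inv_mul,
      ENNReal.mul_inv (by simp) (by simp)]
    ring

variable [IsProbabilityMeasure μ]

lemma measurePreserving_of_half (hT : Measurable T) (hα : Measurable α)
    (hhalf : ∀ i, ∀ B, MeasurableSet B → μ (α ⁻¹' {i} ∩ T ⁻¹' B) = μ B / 2) :
    MeasurePreserving T μ μ := by
  refine ⟨hT, Measure.ext fun B hB => ?_⟩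
  rw [Measure.map_apply hT hB]
  have h : T ⁻¹' B = (α ⁻¹' {0} ∩ T ⁻¹' B) ∪ (α ⁻¹' {1} ∩ T ⁻¹' B) := by
    ext x
    have : α x = 0 ∨ α x = 1 := by omega
    simp only [mem_union, mem_inter_iff, mem_preimage, mem_singleton_iff]
    tauto
  rw [h, measure_union, hhalf _ _ hB, hhalf _ _ hB, ENNReal.add_halves]
  · refine Set.disjoint_left.2 fun x hx hx' => ?_
    have h1 : α x = 0 := hx.1
    have h2 : α x = 1 := hx'.1
    simp [h1] at h2
  · exact (hα (measurableSet_singleton _)).inter (hT hB)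

theorem ergodic_of_half (hT : Measurable T) (hα : Measurable α)
    (hinj : Function.Injective (fullItinerary T α))
    (hhalf : ∀ i, ∀ B, MeasurableSet B → μ (α ⁻¹' {i} ∩ T ⁻¹' B) = μ B / 2) :
    Ergodic T μ := by
  refine ⟨measurePreserving_of_half hT hα hhalf, ⟨fun A hA hinv => ?_⟩⟩
  -- `A` is independent of every cylinder, hence of every measurable set; evaluated at `A` itself
  -- this reads `μ A = μ A * μ A`.
  have h : μ.restrict A = μ A • μ := by
    refine ext_of_cylinders hT hα hinj fun n w => ?_
    have hm := (measurable_itinerary hT hα n) (measurableSet_singleton w)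
    have h1 := measure_inter_cylinder hT hα hhalf MeasurableSet.univ preimage_univ n w
    rw [inter_univ, measure_univ] at h1
    rw [Measure.restrict_apply hm, measure_inter_cylinder hT hα hhalf hA hinv,
      Measure.smul_apply, h1, smul_eq_mul, mul_one_div]
  have h2 := congrArg (fun ν => ν A) h
  simp only [Measure.restrict_apply hA, inter_self, Measure.smul_apply, smul_eq_mul] at h2
  rw [Filter.eventuallyConst_set']
  rcases eq_or_ne (μ A) 0 with h0 | h0
  · exact Or.inl (ae_eq_empty.2 h0)
  · right
    have h3 : μ A = 1 := by
      have h4 : μ A * 1 = μ A * μ A := by rwa [mul_one]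
      exact ((ENNReal.mul_right_inj h0 (measure_ne_top μ A)).1 h4).symm
    rw [ae_eq_univ, prob_compl_eq_zero_iff hA, h3]

lemma card_cylinders (n : ℕ) : Real.log (Fintype.card (Fin n → Fin 2)) = n * Real.log 2 := by
  simp

/-- For invariant `ν` the entropy is at most `H_ν(α) ≤ log 2`, and `μ` attains `log 2`. If `ν`
attains it as well, then `n log 2 ≤ H_ν(αⁿ)` for every `n > 0`. This is the extreme case of the
bound by the logarithm of the number of atoms, so all cylinders have mass `2⁻ⁿ`, as for `μ`. -/
theorem isTheMeasureOfMaximalEntropy_of_half (hT : Measurable T) (hα : Measurable α)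
    (hinj : Function.Injective (fullItinerary T α))
    (hhalf : ∀ i, ∀ B, MeasurableSet B → μ (α ⁻¹' {i} ∩ T ⁻¹' B) = μ B / 2) :
    IsTheMeasureOfMaximalEntropy T μ := by
  have hcyl : ∀ n w, μ (itinerary T α n ⁻¹' {w}) = 1 / 2 ^ n := fun n w => by
    have h := measure_inter_cylinder hT hα hhalf MeasurableSet.univ preimage_univ n w
    rwa [inter_univ, measure_univ] at h
  have hent : ∀ n, partitionEntropy μ (itinerary T α n) = n * Real.log 2 := by
    intro n
    have h1 : ∀ w, μ.real (itinerary T α n ⁻¹' {w}) = (2 ^ n)⁻¹ := fun w => by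
      simp [Measure.real, hcyl]
    simp [partitionEntropy, h1, Real.negMulLog]
  have hmp := measurePreserving_of_half hT hα hhalf
  have hlow : ENNReal.ofReal (Real.log 2) ≤ metricEntropy T μ := by
    refine le_iSup_of_le 2 (le_iSup_of_le α (le_iSup_of_le hα ?_))
    unfold entropyOfPartition
    refine (Tendsto.limsup_eq ?_).ge
    refine tendsto_const_nhds.congr' ?_
    filter_upwards [eventually_gt_atTop 0] with n hn
    have : (n : ℝ) ≠ 0 := by exact_mod_cast hn.ne'
    rw [hent, mul_div_cancel_left₀ _ this]
  refine ⟨⟨inferInstance, hmp⟩, fun ν hν => ?_⟩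
  obtain ⟨hνp, hνT⟩ := hν
  have hup := fun m (hm : m ≠ 0) => metricEntropy_le (μ := ν) hνT hα hinj (m := m) hm
  have hcard : ∀ m, partitionEntropy ν (itinerary T α m) ≤ m * Real.log 2 := fun m =>
    (partitionEntropy_le_log_card (measurable_itinerary hT hα m)).trans_eq (card_cylinders m)
  refine ⟨((hup 1 one_ne_zero).trans (ENNReal.ofReal_le_ofReal ?_)).trans hlow, fun heq => ?_⟩
  · simpa using hcard 1
  · symm
    refine ext_of_cylinders hT hα hinj fun n w => ?_
    rw [hcyl]
    rcases Nat.eq_zero_or_pos n with rfl | hn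
    · have : itinerary T α 0 ⁻¹' {w} = univ := by
        ext x; simp [Subsingleton.elim (itinerary T α 0 x) w]
      simp [this]
    have h1 := hlow.trans (heq.symm.le.trans (hup n hn.ne'))
    have hlog : 0 < Real.log 2 := Real.log_pos one_lt_two
    have hn' : (0 : ℝ) < n := by exact_mod_cast hn
    rw [ENNReal.ofReal_le_ofReal_iff
      (div_nonneg (partitionEntropy_nonneg _) hn'.le), le_div_iff₀ hn'] at h1
    have h2 := real_preimage_of_partitionEntropy_eq (μ := ν) (measurable_itinerary hT hα n)
      (by rw [card_cylinders]; linarith) w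
    rw [← ENNReal.toReal_eq_toReal_iff' (by simp) (measure_ne_top _ _)]
    change _ = ν.real _
    rw [h2]
    simp

end BernoulliHalf

/-! ### The tent map and Lebesgue measure -/

section Tent

/-- The coding of the tent map by its two branches. -/
def tentCode (x : Icc (0 : ℝ) 1) : Fin 2 := if (x : ℝ) ≤ 1 / 2 then 0 else 1

lemma measurable_tentCode : Measurable tentCode :=
  Measurable.ite (measurableSet_le measurable_subtype_coe measurable_const)
    measurable_const measurable_const

lemma tent_of_le {x : Icc (0 : ℝ) 1} (hx : (x : ℝ) ≤ 1 / 2) : (tent x : ℝ) = 2 * x := by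
  simp only [tent, if_pos hx]

lemma tent_of_ge {x : Icc (0 : ℝ) 1} (hx : 1 / 2 ≤ (x : ℝ)) : (tent x : ℝ) = 2 - 2 * x := by
  rcases hx.eq_or_lt with h | h
  · rw [tent_of_le h.ge, ← h]; norm_num
  · simp only [tent, if_neg h.not_ge]

lemma tent_eq_min (x : Icc (0 : ℝ) 1) : (tent x : ℝ) = min (2 * (x : ℝ)) (2 - 2 * x) := by
  rcases le_total (x : ℝ) (1 / 2) with h | h
  · rw [tent_of_le h, min_eq_left (by linarith)]
  · rw [tent_of_ge h, min_eq_right (by linarith)]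

lemma continuous_tent : Continuous tent := by
  refine Continuous.subtype_mk (f := fun x : Icc (0 : ℝ) 1 =>
    if (x : ℝ) ≤ 1 / 2 then 2 * (x : ℝ) else 2 - 2 * (x : ℝ)) ?_ _
  have : (fun x : Icc (0 : ℝ) 1 => if (x : ℝ) ≤ 1 / 2 then 2 * (x : ℝ) else 2 - 2 * (x : ℝ)) =
      fun x : Icc (0 : ℝ) 1 => min (2 * (x : ℝ)) (2 - 2 * x) := funext tent_eq_min
  rw [this]
  fun_prop

lemma tentCode_eq_zero {x : Icc (0 : ℝ) 1} : tentCode x = 0 ↔ (x : ℝ) ≤ 1 / 2 := by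
  simp [tentCode]

lemma tentCode_eq_one {x : Icc (0 : ℝ) 1} : tentCode x = 1 ↔ 1 / 2 < (x : ℝ) := by
  simp [tentCode]

lemma abs_tent_sub {x y : Icc (0 : ℝ) 1} (h : tentCode x = tentCode y) :
    |(tent x : ℝ) - tent y| = 2 * |(x : ℝ) - y| := by
  have hx : tentCode y = 0 ∨ tentCode y = 1 := by omega
  rcases hx with hy | hy
  · rw [tent_of_le (tentCode_eq_zero.1 (h.trans hy)), tent_of_le (tentCode_eq_zero.1 hy),
      ← mul_sub, abs_mul, abs_two]
  · rw [tent_of_ge (tentCode_eq_one.1 (h.trans hy)).le, tent_of_ge (tentCode_eq_one.1 hy).le,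
      show 2 - 2 * (x : ℝ) - (2 - 2 * y) = -2 * (x - y) by ring, abs_mul]
    norm_num

/-- While two orbits have the same code their distance doubles at each step, which is impossible
forever in an interval of length `1`. -/
lemma injective_fullItinerary_tent : Function.Injective (fullItinerary tent tentCode) := by
  intro x y h
  have hn : ∀ n : ℕ, |(tent^[n] x : ℝ) - tent^[n] y| = 2 ^ n * |(x : ℝ) - y| := by
    intro n
    induction n with
    | zero => simp
    | succ n ih =>
      rw [Function.iterate_succ_apply', Function.iterate_succ_apply',
        abs_tent_sub (congrFun h n), ih, pow_succ]
      ring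
  by_contra hne
  have hpos : 0 < |(x : ℝ) - y| := abs_pos.2 (sub_ne_zero.2 fun h => hne (Subtype.ext h))
  obtain ⟨n, hn'⟩ := pow_unbounded_of_one_lt (1 / |(x : ℝ) - y|) one_lt_two
  rw [div_lt_iff₀ hpos, ← hn n] at hn'
  have h1 := (tent^[n] x).2
  have h2 := (tent^[n] y).2
  have : |(tent^[n] x : ℝ) - tent^[n] y| ≤ 1 := abs_le.2 ⟨by linarith [h1.1, h2.2], by linarith [h1.2, h2.1]⟩
  linarith

lemma leb_apply {a b : ℝ} (s : Set (Icc a b)) : leb a b s = volume (Subtype.val '' s) :=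
  (MeasurableEmbedding.subtype_coe measurableSet_Icc).comap_apply _ _

instance isProbabilityMeasure_leb : IsProbabilityMeasure (leb 0 1) :=
  ⟨by rw [leb_apply, image_univ, Subtype.range_coe]; simp⟩

lemma leb_tentCode_inter (i : Fin 2) (B : Set (Icc (0 : ℝ) 1)) :
    leb 0 1 (tentCode ⁻¹' {i} ∩ tent ⁻¹' B) = leb 0 1 B / 2 := by
  set B' : Set ℝ := Subtype.val '' B with hB'
  have hsub : ∀ x ∈ B', x ∈ Icc (0 : ℝ) 1 := by rintro _ ⟨x, -, rfl⟩; exact x.2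
  have hmem : ∀ x : Icc (0 : ℝ) 1, x ∈ B ↔ (x : ℝ) ∈ B' := fun x =>
    ⟨fun h => ⟨x, h, rfl⟩, fun ⟨y, hy, h⟩ => Subtype.ext h ▸ hy⟩
  have hscale : ∀ c : ℝ, |c| = 2 → volume ((fun x => c * x) ⁻¹' B') = leb 0 1 B / 2 := by
    intro c hc
    have hc0 : c ≠ 0 := by rintro rfl; simp at hc
    rw [Real.volume_preimage_mul_left hc0, abs_inv, hc, leb_apply, ENNReal.div_eq_inv_mul,
      ENNReal.ofReal_inv_of_pos two_pos, ENNReal.ofReal_ofNat]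
  rw [leb_apply]
  have hi : i = 0 ∨ i = 1 := by omega
  rcases hi with rfl | rfl
  · rw [← hscale 2 abs_two]
    congr 1
    ext x
    constructor
    · rintro ⟨y, ⟨h1, h2⟩, rfl⟩
      have := (hmem _).1 h2
      rwa [tent_of_le (tentCode_eq_zero.1 h1)] at this
    · intro hx
      have h := hsub _ hx
      refine ⟨⟨x, by linarith [h.1], by linarith [h.2]⟩, ⟨tentCode_eq_zero.2 ?_, (hmem _).2 ?_⟩, rfl⟩
      · change x ≤ 1 / 2
        linarith [h.2]
      · rw [tent_of_le (show x ≤ 1 / 2 by linarith [h.2])]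
        exact hx
  · rw [← hscale (-2) (by norm_num)]
    have h1 : volume ((fun x : ℝ => -2 * x) ⁻¹' B') =
        volume ((fun x : ℝ => x + -1) ⁻¹' ((fun x : ℝ => -2 * x) ⁻¹' B')) :=
      (measure_preimage_add_right volume _ _).symm
    rw [h1]
    -- The coding assigns `1 / 2` to the left branch, so the two sets may differ at that single
    -- point.
    refine measure_congr ?_
    have hnull : (volume : Measure ℝ) {1 / 2} = 0 := by simp
    filter_upwards [compl_mem_ae_iff.2 hnull] with x hx
    refine propext ⟨?_, ?_⟩
    · rintro ⟨y, ⟨h1, h2⟩, rfl⟩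
      have := (hmem _).1 h2
      rw [tent_of_ge (tentCode_eq_one.1 h1).le] at this
      change -2 * ((y : ℝ) + -1) ∈ B'
      convert this using 1; ring
    · intro hx'
      have hx' : -2 * (x + -1) ∈ B' := hx'
      have h := hsub _ hx'
      have h3 : 1 / 2 < x := lt_of_le_of_ne (by linarith [h.2]) fun h => hx h.symm
      refine ⟨⟨x, by linarith [h.1], by linarith [h.1]⟩, ⟨tentCode_eq_one.2 h3, (hmem _).2 ?_⟩, rfl⟩
      rw [tent_of_ge h3.le]
      convert hx' using 1; ring

end Tent

/-! ### Transport to a map conjugate to the tent map -/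

section Conjugate

variable {a b : ℝ} {f : Icc a b → Icc a b} {h : Icc a b ≃ₜ Icc (0 : ℝ) 1}

lemma muOf_apply (s : Set (Icc a b)) : muOf h s = leb 0 1 (h '' s) := by
  rw [muOf, ← Homeomorph.toMeasurableEquiv_coe, MeasurableEquiv.map_apply,
    Homeomorph.toMeasurableEquiv_coe, h.image_eq_preimage_symm]

instance isProbabilityMeasure_muOf : IsProbabilityMeasure (muOf h) :=
  Measure.isProbabilityMeasure_map h.symm.continuous.measurable.aemeasurable

lemma standardBorelSpace_Icc : StandardBorelSpace (Icc a b) :=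
  measurableSet_Icc.standardBorel

theorem ergodic_and_maximal_entropy (hconj : Function.Semiconj h f tent) :
    Ergodic f (muOf h) ∧ IsTheMeasureOfMaximalEntropy f (muOf h) := by
  have : StandardBorelSpace (Icc a b) := standardBorelSpace_Icc
  have hf : f = h.symm ∘ tent ∘ h := funext fun x => by simp [← hconj x]
  have hfm : Measurable f := by
    rw [hf]
    exact (h.symm.continuous.comp (continuous_tent.comp h.continuous)).measurable
  have hα : Measurable (tentCode ∘ h) := measurable_tentCode.comp h.continuous.measurable
  have hinj : Function.Injective (fullItinerary f (tentCode ∘ h)) := by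
    intro x y hxy
    refine h.injective (injective_fullItinerary_tent (funext fun n => ?_))
    have := congrFun hxy n
    simp only [fullItinerary, Function.comp_apply, (hconj.iterate_right n).eq] at this
    exact this
  have hhalf : ∀ i, ∀ B, MeasurableSet B →
      muOf h ((tentCode ∘ h) ⁻¹' {i} ∩ f ⁻¹' B) = muOf h B / 2 := by
    intro i B _
    rw [muOf_apply, muOf_apply, ← leb_tentCode_inter i]
    congr 1
    ext y
    simp only [h.image_eq_preimage_symm, mem_preimage, mem_inter_iff, Function.comp_apply,
      h.apply_symm_apply, hf]
  exact ⟨ergodic_of_half hfm hα hinj hhalf, isTheMeasureOfMaximalEntropy_of_half hfm hα hinj hhalf⟩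

lemma ext_apply {c d : ℝ} (f : Icc a b → Icc c d) (x : Icc a b) : ext f x = f x :=
  Subtype.val_injective.extend_apply _ _ _

/-- A differentiable map sends null sets to null sets. Nothing is known about derivatives at the
endpoints, but these contribute only two points. -/
theorem absolutelyContinuous_muOf (hs : ContDiffOn ℝ ∞ (ext h) (Ioo a b)) :
    (muOf h).AbsolutelyContinuous (leb a b) := by
  intro s hs0
  rw [leb_apply] at hs0
  rw [muOf_apply, leb_apply]
  have hsub : Subtype.val '' (h '' s) ⊆ ext h '' (Subtype.val '' s ∩ Ioo a b) ∪
      ext h '' {a, b} := by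
    rintro _ ⟨_, ⟨x, hx, rfl⟩, rfl⟩
    rw [← image_union]
    refine ⟨x, ?_, ext_apply _ _⟩
    by_cases h1 : (x : ℝ) = a
    · simp [h1]
    by_cases h2 : (x : ℝ) = b
    · simp [h2]
    · exact Or.inl ⟨⟨x, hx, rfl⟩, lt_of_le_of_ne x.2.1 (Ne.symm h1), lt_of_le_of_ne x.2.2 h2⟩
  refine measure_mono_null hsub (measure_union_null ?_ ?_)
  · refine addHaar_image_eq_zero_of_differentiableOn_of_addHaar_eq_zero _ ?_
      (measure_mono_null inter_subset_left hs0)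
    exact (hs.differentiableOn (by simp)).mono inter_subset_right
  · exact ((Set.toFinite {a, b}).image _).measure_zero _

end Conjugate

/-! ### Maps given by parametrizations `p z ↦ q z` -/

section Parametrization

/-- By the inverse function theorem `g = q ∘ p⁻¹` near `p z`. Regularity of a branch is thereby read
off a parametrization, without a closed form for the branch. -/
lemma ContDiffAt.of_parametrization {n : ℕ∞ω} (hn : 1 ≤ n) {p q g : ℝ → ℝ} {z p' : ℝ}
    (hp : ContDiffAt ℝ n p z) (hp' : HasDerivAt p p' z) (hne : p' ≠ 0) (hq : ContDiffAt ℝ n q z)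
    (h : ∀ᶠ w in 𝓝 z, g (p w) = q w) : ContDiffAt ℝ n g (p z) := by
  have hn0 : n ≠ 0 := (zero_lt_one.trans_le hn).ne'
  have hs : HasStrictDerivAt p p' z := hp.hasStrictDerivAt' hp' hn0
  have hf : HasFDerivAt p (ContinuousLinearEquiv.unitsEquivAut ℝ (Units.mk0 p' hne) : ℝ →L[ℝ] ℝ) z :=
    (hs.hasStrictFDerivAt_equiv hne).hasFDerivAt
  set i := hp.localInverse hf hn0
  have hi : ContDiffAt ℝ n i (p z) := hp.to_localInverse hf hn0
  have hiz : i (p z) = z := hp.localInverse_apply_image hf hn0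
  have hq' : ContDiffAt ℝ n (q ∘ i) (p z) := ContDiffAt.comp _ (hiz.symm ▸ hq) hi
  refine hq'.congr_of_eventuallyEq ?_
  have hright : ∀ᶠ x in 𝓝 (p z), p (i x) = x :=
    (hp.hasStrictFDerivAt' hf hn0).eventually_right_inverse
  have htend : Tendsto i (𝓝 (p z)) (𝓝 z) := by
    have := hi.continuousAt.tendsto
    rwa [hiz] at this
  filter_upwards [hright, htend.eventually h] with x hx1 hx2
  rw [hx1] at hx2
  exact hx2

lemma HasDerivAt.of_parametrization {p q g : ℝ → ℝ} {z p' q' : ℝ}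
    (hp : ContDiffAt ℝ 1 p z) (hp' : HasDerivAt p p' z) (hne : p' ≠ 0) (hq : ContDiffAt ℝ 1 q z)
    (hq' : HasDerivAt q q' z) (h : ∀ᶠ w in 𝓝 z, g (p w) = q w) :
    HasDerivAt g (q' / p') (p z) := by
  have hg := ((ContDiffAt.of_parametrization le_rfl hp hp' hne hq h).differentiableAt
    one_ne_zero).hasDerivAt
  have h1 : HasDerivAt (fun w => g (p w)) (deriv g (p z) * p') z := hg.comp z hp'
  have h2 : HasDerivAt (fun w => g (p w)) q' z := hq'.congr_of_eventuallyEq h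
  rwa [eq_div_of_mul_eq hne (h1.unique h2)] at hg

/-- Transfers one-sided limits from the parameter to the parametrized point, by the intermediate
value theorem. -/
lemma nhdsGT_le_map {p : ℝ → ℝ} {α β : ℝ} (hαβ : α < β) (hc : ContinuousOn p (Icc α β))
    (hm : StrictMonoOn p (Icc α β)) : 𝓝[>] (p α) ≤ map p (𝓝[>] α) := by
  intro s hs
  obtain ⟨u, hu, hus⟩ := mem_nhdsGT_iff_exists_Ioo_subset.1 (mem_map.1 hs)
  have hu' : α < min u β := lt_min hu hαβ
  refine mem_nhdsGT_iff_exists_Ioo_subset.2 ⟨p (min u β),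
    hm (left_mem_Icc.2 hαβ.le) ⟨hu'.le, min_le_right _ _⟩ hu', ?_⟩
  refine (intermediate_value_Ioo hu'.le (hc.mono (Icc_subset_Icc_right (min_le_right _ _)))).trans ?_
  rintro _ ⟨x, hx, rfl⟩
  exact hus ⟨hx.1, hx.2.trans_le (min_le_left _ _)⟩

lemma nhdsLT_le_map {p : ℝ → ℝ} {α β : ℝ} (hαβ : α < β) (hc : ContinuousOn p (Icc α β))
    (hm : StrictMonoOn p (Icc α β)) : 𝓝[<] (p β) ≤ map p (𝓝[<] β) := by
  intro s hs
  obtain ⟨u, hu, hus⟩ := mem_nhdsLT_iff_exists_Ioo_subset.1 (mem_map.1 hs)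
  have hu' : max u α < β := max_lt hu hαβ
  refine mem_nhdsLT_iff_exists_Ioo_subset.2 ⟨p (max u α),
    hm ⟨le_max_right _ _, hu'.le⟩ (right_mem_Icc.2 hαβ.le) hu', ?_⟩
  refine (intermediate_value_Ioo hu'.le (hc.mono (Icc_subset_Icc_left (le_max_right _ _)))).trans ?_
  rintro _ ⟨x, hx, rfl⟩
  exact hus ⟨(le_max_left _ _).trans_lt hx.1, hx.2⟩

end Parametrization

/-! ### Criteria for cusp branches and for cusp maps with two branches -/

section Branches

/-- `g` restricted to `(A, B)` is a branch of a cusp map with Hölder exponent `ε`. -/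
structure IsCuspBranch (g : ℝ → ℝ) (A B ε : ℝ) : Prop where
  lt : A < B
  contDiffOn : ContDiffOn ℝ 1 g (Ioo A B)
  deriv_ne_zero : ∀ x ∈ Ioo A B, deriv g x ≠ 0
  left_limit : TendstoZeroOrInfty (deriv g) (𝓝[>] A)
  right_limit : TendstoZeroOrInfty (deriv g) (𝓝[<] B)
  holder : ∃ C > (0 : ℝ), ∀ x ∈ Ioo A B, ∀ y ∈ Ioo A B,
    (|deriv g x| ≤ 2 → |deriv g y| ≤ 2 → |deriv g x - deriv g y| ≤ C * |x - y| ^ ε) ∧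
    (2⁻¹ ≤ |deriv g x| → 2⁻¹ ≤ |deriv g y| →
      |(deriv g x)⁻¹ - (deriv g y)⁻¹| ≤ C * |x - y| ^ ε)

/-- Rolle's theorem. -/
lemma IsCuspBranch.injOn {g : ℝ → ℝ} {A B ε : ℝ} (h : IsCuspBranch g A B ε) :
    InjOn g (Ioo A B) := by
  have key : ∀ x ∈ Ioo A B, ∀ y ∈ Ioo A B, x < y → g x ≠ g y := by
    intro x hx y hy hxy heq
    have hsub : Icc x y ⊆ Ioo A B := fun z hz => ⟨hx.1.trans_le hz.1, hz.2.trans_lt hy.2⟩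
    obtain ⟨c, hc, hc0⟩ := exists_deriv_eq_zero hxy (h.contDiffOn.continuousOn.mono hsub) heq
    exact h.deriv_ne_zero c (hsub (Ioo_subset_Icc_self hc)) hc0
  intro x hx y hy heq
  rcases lt_trichotomy x y with hlt | h | hlt
  · exact (key x hx y hy hlt heq).elim
  · exact h
  · exact (key y hy x hx hlt heq.symm).elim

theorem isCuspMap_of_branches {g : ℝ → ℝ} {a b c ε : ℝ} (hε : 0 < ε)
    (hcont : ContinuousOn g (Icc a b)) (hmaps : MapsTo g (Icc a b) (Icc a b))
    (hl : IsCuspBranch g a c ε) (hr : IsCuspBranch g c b ε) : IsCuspMap a b g := by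
  have hac := hl.lt
  have hcb := hr.lt
  have hsubl : Ioo a c ⊆ Icc a b := fun x hx => ⟨hx.1.le, (hx.2.trans hcb).le⟩
  have hsubr : Ioo c b ⊆ Icc a b := fun x hx => ⟨(hac.trans hx.1).le, hx.2.le⟩
  have hunion : Icc a b \ {a, c, b} = Ioo a c ∪ Ioo c b := by
    ext x
    simp only [Set.mem_sdiff, mem_insert_iff, mem_singleton_iff, not_or, mem_union, mem_Icc, mem_Ioo]
    constructor
    · rintro ⟨⟨h1, h2⟩, h3, h4, h5⟩
      rcases lt_or_gt_of_ne h4 with h | h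
      · exact Or.inl ⟨lt_of_le_of_ne h1 (Ne.symm h3), h⟩
      · exact Or.inr ⟨h, lt_of_le_of_ne h2 h5⟩
    · rintro (⟨h1, h2⟩ | ⟨h1, h2⟩)
      · exact ⟨⟨h1.le, (h2.trans hcb).le⟩, h1.ne', h2.ne, (h2.trans hcb).ne⟩
      · exact ⟨⟨(hac.trans h1).le, h2.le⟩, (hac.trans h1).ne', h1.ne', h2.ne⟩
  have hopen : IsOpen (Ioo a c ∪ Ioo c b) := isOpen_Ioo.union isOpen_Ioo
  have hsub : Ioo a c ∪ Ioo c b ⊆ Icc a b := union_subset hsubl hsubr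
  have hcd : ContDiffOn ℝ 1 g (Ioo a c ∪ Ioo c b) := by
    rintro x (hx | hx)
    · exact ((hl.contDiffOn x hx).contDiffAt (isOpen_Ioo.mem_nhds hx)).contDiffWithinAt
    · exact ((hr.contDiffOn x hx).contDiffAt (isOpen_Ioo.mem_nhds hx)).contDiffWithinAt
  have hne : ∀ x ∈ Ioo a c ∪ Ioo c b, deriv g x ≠ 0 := by
    rintro x (hx | hx)
    exacts [hl.deriv_ne_zero x hx, hr.deriv_ne_zero x hx]
  have hdw : ∀ x ∈ Ioo a c ∪ Ioo c b, derivWithin g (Icc a b) x = deriv g x := fun x hx =>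
    derivWithin_of_mem_nhds (mem_of_superset (hopen.mem_nhds hx) hsub)
  have hcrit : crit a b {a, c, b} g = ∅ := by
    refine eq_empty_of_forall_notMem fun x hx => ?_
    have h1 : x ∈ Ioo a c ∪ Ioo c b := hunion ▸ hx.1
    exact hne x h1 (hdw x h1 ▸ hx.2)
  -- All three endpoints of the branches are put in the exceptional set, and no critical point is
  -- left outside of it.
  refine ⟨hcont, hmaps, {a, c, b}, ?_, Set.toFinite _ |>.countable, ?_, ?_, {(a, c), (c, b)}, ?_,
    ⟨?_, ?_⟩⟩
  · rintro x (rfl | rfl | rfl)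
    · exact ⟨le_rfl, (hac.trans hcb).le⟩
    · exact ⟨hac.le, hcb.le⟩
    · exact ⟨(hac.trans hcb).le, le_rfl⟩
  · rw [hunion]
    exact fun x hx => ((hcd.differentiableOn one_ne_zero x hx).differentiableAt
      (hopen.mem_nhds hx)).differentiableWithinAt
  · rw [hunion]
    exact (hcd.continuousOn_deriv_of_isOpen hopen le_rfl).congr hdw
  · rw [hcrit, union_empty, hunion]
    simp
  · refine ⟨hac.trans hcb, (Set.toFinite _).countable, ?_, ?_, ?_, ?_, ?_, ?_, ?_, ?_, ?_⟩
    · rintro j (rfl | rfl); exacts [hac, hcb]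
    · rintro j (rfl | rfl); exacts [hsubl, hsubr]
    · have hdis : Disjoint (Ioo a c) (Ioo c b) :=
        Set.disjoint_left.2 fun x hx hx' => (hx.2.trans hx'.1).false
      rintro i (rfl | rfl) j (rfl | rfl) hij
      · exact (hij rfl).elim
      · exact hdis
      · exact hdis.symm
      · exact (hij rfl).elim
    · rintro j (rfl | rfl); exacts [hmaps.mono_left hsubl, hmaps.mono_left hsubr]
    · rintro j (rfl | rfl); exacts [hl.contDiffOn, hr.contDiffOn]
    · rintro j (rfl | rfl); exacts [hl.injOn, hr.injOn]
    · rintro j (rfl | rfl); exacts [hl.deriv_ne_zero, hr.deriv_ne_zero]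
    · rintro j (rfl | rfl); exacts [hl.left_limit, hr.left_limit]
    · rintro j (rfl | rfl); exacts [hl.right_limit, hr.right_limit]
  · obtain ⟨C₁, hC₁, h₁⟩ := hl.holder
    obtain ⟨C₂, hC₂, h₂⟩ := hr.holder
    refine ⟨max C₁ C₂, lt_max_of_lt_left hC₁, ε, hε, ?_⟩
    have hmono : ∀ {C x y t : ℝ}, C ≤ max C₁ C₂ → t ≤ C * |x - y| ^ ε →
        t ≤ max C₁ C₂ * |x - y| ^ ε := fun hC ht =>
      ht.trans (mul_le_mul_of_nonneg_right hC (Real.rpow_nonneg (abs_nonneg _) _))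
    rintro j (rfl | rfl) x hx y hy
    · exact ⟨fun h h' => hmono (le_max_left _ _) ((h₁ x hx y hy).1 h h'),
        fun h h' => hmono (le_max_left _ _) ((h₁ x hx y hy).2 h h')⟩
    · exact ⟨fun h h' => hmono (le_max_right _ _) ((h₂ x hx y hy).1 h h'),
        fun h h' => hmono (le_max_right _ _) ((h₂ x hx y hy).2 h h')⟩

/-- `(1 + r)⁻¹` is a bounded coordinate on `(0, ∞)` that treats critical points and poles alike. On
each of the two ranges, the quantity to be controlled is a Lipschitz function of it, with constant
`9 = (1 + 2)²`. -/
lemma abs_sub_le_of_inv_one_add {r s : ℝ} (hr : 0 < r) (hs : 0 < s) :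
    (r ≤ 2 → s ≤ 2 → |r - s| ≤ 9 * |(1 + r)⁻¹ - (1 + s)⁻¹|) ∧
    (2⁻¹ ≤ r → 2⁻¹ ≤ s → |r⁻¹ - s⁻¹| ≤ 9 * |(1 + r)⁻¹ - (1 + s)⁻¹|) := by
  have e1 : r - s = -((1 + r)⁻¹ - (1 + s)⁻¹) * ((1 + r) * (1 + s)) := by field_simp; ring
  have e2 : r⁻¹ - s⁻¹ = ((1 + r)⁻¹ - (1 + s)⁻¹) * ((1 + r⁻¹) * (1 + s⁻¹)) := by field_simp; ring
  constructor
  · intro h h'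
    rw [e1, abs_mul, abs_neg, mul_comm, abs_of_pos (by positivity : 0 < (1 + r) * (1 + s))]
    refine mul_le_mul_of_nonneg_right ?_ (abs_nonneg _)
    nlinarith
  · intro h h'
    have h1 : r⁻¹ ≤ 2 := inv_le_of_inv_le₀ two_pos h
    have h2 : s⁻¹ ≤ 2 := inv_le_of_inv_le₀ two_pos h'
    have h3 := inv_pos.2 hr
    have h4 := inv_pos.2 hs
    rw [e2, abs_mul, mul_comm, abs_of_pos (by positivity : 0 < (1 + r⁻¹) * (1 + s⁻¹))]
    refine mul_le_mul_of_nonneg_right ?_ (abs_nonneg _)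
    nlinarith

/-- Everything is read off the parameter `z`, where the derivative of the branch is `q' / p'`. The
hypothesis `hW` alone covers both Hölder conditions, through the coordinate `(1 + |Dg|)⁻¹`. -/
theorem IsCuspBranch.of_parametrization {g p q p' q' : ℝ → ℝ} {α β A B ε C : ℝ} (hαβ : α < β)
    (hp : ContinuousOn p (Icc α β)) (hA : p α = A) (hB : p β = B)
    (hpc : ∀ z ∈ Ioo α β, ContDiffAt ℝ 1 p z) (hqc : ∀ z ∈ Ioo α β, ContDiffAt ℝ 1 q z)
    (hp' : ∀ z ∈ Ioo α β, HasDerivAt p (p' z) z) (hq' : ∀ z ∈ Ioo α β, HasDerivAt q (q' z) z)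
    (hpos : ∀ z ∈ Ioo α β, 0 < p' z) (hgp : ∀ z ∈ Ioo α β, g (p z) = q z)
    (hsign : (∀ z ∈ Ioo α β, 0 < q' z) ∨ ∀ z ∈ Ioo α β, q' z < 0)
    (hl : TendstoZeroOrInfty (fun z => q' z / p' z) (𝓝[>] α))
    (hr : TendstoZeroOrInfty (fun z => q' z / p' z) (𝓝[<] β)) (hC : 0 < C)
    (hW : ∀ z ∈ Ioo α β, ∀ w ∈ Ioo α β,
      |(1 + |q' z / p' z|)⁻¹ - (1 + |q' w / p' w|)⁻¹| ≤ C * |p z - p w| ^ ε) :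
    IsCuspBranch g A B ε := by
  subst hA hB
  have hm : StrictMonoOn p (Icc α β) := by
    refine strictMonoOn_of_deriv_pos (convex_Icc _ _) hp fun z hz => ?_
    rw [interior_Icc] at hz
    rw [(hp' z hz).deriv]
    exact hpos z hz
  have hsurj : ∀ x ∈ Ioo (p α) (p β), ∃ z ∈ Ioo α β, p z = x := fun x hx =>
    intermediate_value_Ioo hαβ.le hp hx
  have hev : ∀ z ∈ Ioo α β, ∀ᶠ w in 𝓝 z, g (p w) = q w := fun z hz =>
    (isOpen_Ioo.eventually_mem hz).mono hgp
  have hder : ∀ z ∈ Ioo α β, deriv g (p z) = q' z / p' z := fun z hz =>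
    (HasDerivAt.of_parametrization (hpc z hz) (hp' z hz) (hpos z hz).ne' (hqc z hz) (hq' z hz)
      (hev z hz)).deriv
  have hq0 : ∀ z ∈ Ioo α β, q' z ≠ 0 := by
    rcases hsign with h | h
    exacts [fun z hz => (h z hz).ne', fun z hz => (h z hz).ne]
  refine ⟨hm (left_mem_Icc.2 hαβ.le) (right_mem_Icc.2 hαβ.le) hαβ, ?_, ?_, ?_, ?_, 9 * C,
    by positivity, ?_⟩
  · intro x hx
    obtain ⟨z, hz, rfl⟩ := hsurj x hx
    exact (ContDiffAt.of_parametrization le_rfl (hpc z hz) (hp' z hz) (hpos z hz).ne' (hqc z hz)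
      (hev z hz)).contDiffWithinAt
  · intro x hx
    obtain ⟨z, hz, rfl⟩ := hsurj x hx
    rw [hder z hz]
    exact div_ne_zero (hq0 z hz) (hpos z hz).ne'
  · have key : ∀ l, Tendsto (fun z => q' z / p' z) (𝓝[>] α) l →
        Tendsto (deriv g) (𝓝[>] (p α)) l := by
      intro l h
      have h1 : Tendsto (deriv g) (map p (𝓝[>] α)) l := tendsto_map'_iff.2 (h.congr' (by
        filter_upwards [Ioo_mem_nhdsGT hαβ] with z hz using (hder z hz).symm))
      exact h1.mono_left (nhdsGT_le_map hαβ hp hm)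
    exact hl.imp (key _) (Or.imp (key _) (key _))
  · have key : ∀ l, Tendsto (fun z => q' z / p' z) (𝓝[<] β) l →
        Tendsto (deriv g) (𝓝[<] (p β)) l := by
      intro l h
      have h1 : Tendsto (deriv g) (map p (𝓝[<] β)) l := tendsto_map'_iff.2 (h.congr' (by
        filter_upwards [Ioo_mem_nhdsLT hαβ] with z hz using (hder z hz).symm))
      exact h1.mono_left (nhdsLT_le_map hαβ hp hm)
    exact hr.imp (key _) (Or.imp (key _) (key _))
  · intro x hx y hy
    obtain ⟨z, hz, rfl⟩ := hsurj x hx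
    obtain ⟨w, hw, rfl⟩ := hsurj y hy
    rw [hder z hz, hder w hw]
    have hWzw := hW z hz w hw
    set r := q' z / p' z with hr
    set s := q' w / p' w with hs
    have hr0 : 0 < |r| := abs_pos.2 (div_ne_zero (hq0 z hz) (hpos z hz).ne')
    have hs0 : 0 < |s| := abs_pos.2 (div_ne_zero (hq0 w hw) (hpos w hw).ne')
    obtain ⟨h1, h2⟩ := abs_sub_le_of_inv_one_add hr0 hs0
    -- The derivative has constant sign on a branch, so passing to absolute values loses nothing.
    have e : |r - s| = |(|r| - |s|)| ∧ |r⁻¹ - s⁻¹| = |(|r|⁻¹ - |s|⁻¹)| := by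
      rcases hsign with h | h
      · rw [abs_of_pos (div_pos (h z hz) (hpos z hz)), abs_of_pos (div_pos (h w hw) (hpos w hw))]
        exact ⟨rfl, rfl⟩
      · rw [abs_of_neg (div_neg_of_neg_of_pos (h z hz) (hpos z hz)),
          abs_of_neg (div_neg_of_neg_of_pos (h w hw) (hpos w hw)), inv_neg, inv_neg,
          neg_sub_neg, neg_sub_neg, abs_sub_comm, abs_sub_comm r⁻¹]
        exact ⟨rfl, rfl⟩
    rw [e.1, e.2, mul_assoc]
    exact ⟨fun h h' => (h1 h h').trans (by linarith), fun h h' => (h2 h h').trans (by linarith)⟩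

/-- A function with bounded derivative is `1 / 2`-Hölder with respect to a parametrization with at
most quadratic critical points. -/
lemma holder_half_of_quadratic {W W' p : ℝ → ℝ} {α β C c : ℝ} (hc : 0 < c) (hC : 0 ≤ C)
    (hW : ∀ z ∈ Ioo α β, HasDerivAt W (W' z) z) (hW' : ∀ z ∈ Ioo α β, |W' z| ≤ C)
    (hp : ∀ z ∈ Ioo α β, ∀ w ∈ Ioo α β, z < w → c * (w - z) ^ 2 ≤ p w - p z) :
    ∀ z ∈ Ioo α β, ∀ w ∈ Ioo α β, |W z - W w| ≤ (C / √c + 1) * |p z - p w| ^ (1 / 2 : ℝ) := by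
  have key : ∀ z ∈ Ioo α β, ∀ w ∈ Ioo α β, z < w →
      |W z - W w| ≤ (C / √c + 1) * |p z - p w| ^ (1 / 2 : ℝ) := by
    intro z hz w hw hzw
    have h1 := Convex.norm_image_sub_le_of_norm_hasDerivWithin_le
      (fun x hx => (hW x hx).hasDerivWithinAt) (fun x hx => hW' x hx) (convex_Ioo α β) hw hz
    rw [Real.norm_eq_abs, Real.norm_eq_abs] at h1
    have h2 : √c * |z - w| ≤ √|p z - p w| := by
      rw [← Real.sqrt_sq_eq_abs, ← Real.sqrt_mul hc.le]
      refine Real.sqrt_le_sqrt ?_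
      have := hp z hz w hw hzw
      rw [abs_sub_comm (p z)]
      refine le_trans ?_ (this.trans (le_abs_self _))
      exact (by ring : c * (z - w) ^ 2 = c * (w - z) ^ 2).le
    rw [← Real.sqrt_eq_rpow]
    have hsc : 0 < √c := Real.sqrt_pos.2 hc
    calc |W z - W w| ≤ C * |z - w| := h1
      _ = C / √c * (√c * |z - w|) := by field_simp
      _ ≤ C / √c * √|p z - p w| := mul_le_mul_of_nonneg_left h2 (by positivity)
      -- The added `1` only keeps the Hölder constant positive when `C = 0`.
      _ ≤ _ := mul_le_mul_of_nonneg_right (by linarith) (Real.sqrt_nonneg _)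
  intro z hz w hw
  rcases lt_trichotomy z w with h | h | h
  · exact key z hz w hw h
  · subst h
    simp
  · rw [abs_sub_comm, abs_sub_comm (p z)]
    exact key w hw z hz h

end Branches

/-! ### Conjugates of the tent map by increasing homeomorphisms -/

section Homeomorphisms

lemma exists_homeomorph {φ : ℝ → ℝ} (h0 : φ 0 = 0) (h1 : φ 1 = 1)
    (hc : ContinuousOn φ (Icc 0 1)) (hm : StrictMonoOn φ (Icc 0 1)) :
    ∃ H : Icc (0 : ℝ) 1 ≃ₜ Icc (0 : ℝ) 1, ∀ y, (H y : ℝ) = φ y := by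
  have hmem : ∀ y : Icc (0 : ℝ) 1, φ y ∈ Icc (0 : ℝ) 1 := fun y =>
    ⟨h0.symm.le.trans (hm.monotoneOn (left_mem_Icc.2 zero_le_one) y.2 y.2.1),
      (hm.monotoneOn y.2 (right_mem_Icc.2 zero_le_one) y.2.2).trans h1.le⟩
  set F : Icc (0 : ℝ) 1 → Icc (0 : ℝ) 1 := fun y => ⟨φ y, hmem y⟩
  have hF : StrictMono F := fun x y hxy => hm x.2 y.2 hxy
  have hs : Function.Surjective F := by
    intro y
    obtain ⟨x, hx, hxy⟩ := intermediate_value_Icc zero_le_one hc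
      (by rw [h0, h1]; exact y.2)
    exact ⟨⟨x, hx⟩, Subtype.ext hxy⟩
  exact ⟨(hF.orderIsoOfSurjective F hs).toHomeomorph, fun y => rfl⟩

/-- The map `H ∘ tent ∘ H⁻¹`. -/
def tentConj (H : Icc (0 : ℝ) 1 ≃ₜ Icc (0 : ℝ) 1) : Icc (0 : ℝ) 1 → Icc (0 : ℝ) 1 :=
  fun x => H (tent (H.symm x))

lemma semiconj_tentConj (H : Icc (0 : ℝ) 1 ≃ₜ Icc (0 : ℝ) 1) :
    Function.Semiconj H.symm (tentConj H) tent := fun x => by simp [tentConj]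

lemma continuousOn_ext {a b c d : ℝ} {f : Icc a b → Icc c d} (hf : Continuous f) :
    ContinuousOn (ext f) (Icc a b) := by
  rw [continuousOn_iff_continuous_domRestrict]
  have : (Icc a b).domRestrict (ext f) = fun x => (f x : ℝ) := funext fun x => ext_apply f x
  rw [this]
  exact continuous_subtype_val.comp hf

lemma mapsTo_ext {a b c d : ℝ} (f : Icc a b → Icc c d) : MapsTo (ext f) (Icc a b) (Icc c d) :=
  fun x hx => (ext_apply f ⟨x, hx⟩).symm ▸ (f ⟨x, hx⟩).2

lemma continuous_tentConj (H : Icc (0 : ℝ) 1 ≃ₜ Icc (0 : ℝ) 1) : Continuous (tentConj H) :=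
  H.continuous.comp (continuous_tent.comp H.symm.continuous)

lemma tentConj_apply (H : Icc (0 : ℝ) 1 ≃ₜ Icc (0 : ℝ) 1) (y : Icc (0 : ℝ) 1) :
    tentConj H (H y) = H (tent y) := by simp [tentConj]

end Homeomorphisms

/-! ### Computation of Lyapunov exponents in the coordinate of the tent map -/

section LyapunovTools

lemma ae_leb_notMem {s : Set ℝ} (hs : s.Finite) : ∀ᵐ y : Icc (0 : ℝ) 1 ∂(leb 0 1), (y : ℝ) ∉ s := by
  rw [ae_iff, leb_apply]
  refine (hs.subset ?_).measure_zero _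
  rintro _ ⟨y, hy, rfl⟩
  exact not_not.1 hy

lemma ae_leb_mem_Ioo : ∀ᵐ y : Icc (0 : ℝ) 1 ∂(leb 0 1), (y : ℝ) ∈ Ioo (0 : ℝ) 1 ∧ (y : ℝ) ≠ 1 / 2 := by
  filter_upwards [ae_leb_notMem (s := {0, 1 / 2, 1}) (Set.toFinite _)] with y hy
  simp only [mem_insert_iff, mem_singleton_iff, not_or] at hy
  exact ⟨⟨lt_of_le_of_ne y.2.1 (Ne.symm hy.1), lt_of_le_of_ne y.2.2 hy.2.2⟩, hy.2.1⟩

lemma lintegral_leb (u : ℝ → ℝ≥0∞) :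
    ∫⁻ y, u y ∂(leb 0 1) = ∫⁻ y in Icc (0 : ℝ) 1, u y :=
  lintegral_subtype_comap measurableSet_Icc u

lemma integrable_leb {u : ℝ → ℝ} (hu : IntegrableOn u (Icc 0 1)) :
    Integrable (fun y : Icc (0 : ℝ) 1 => u y) (leb 0 1) := by
  have hemb := MeasurableEmbedding.subtype_coe (measurableSet_Icc (a := (0 : ℝ)) (b := 1))
  rw [IntegrableOn, ← map_comap_subtype_coe measurableSet_Icc,
    hemb.integrable_map_iff] at hu
  exact hu

variable {f : Icc (0 : ℝ) 1 → Icc (0 : ℝ) 1} {H : Icc (0 : ℝ) 1 ≃ₜ Icc (0 : ℝ) 1}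
  {R : Icc (0 : ℝ) 1 → ℝ}

lemma lintegral_muOf (u : Icc (0 : ℝ) 1 → ℝ≥0∞) :
    ∫⁻ x, u x ∂(muOf H.symm) = ∫⁻ y, u (H y) ∂(leb 0 1) :=
  lintegral_map_equiv u H.toMeasurableEquiv

lemma lyapunovPos_eq
    (hR : ∀ᵐ y ∂(leb 0 1), |derivWithin (ext f) (Icc 0 1) (H y)| = R y ∧ 0 < R y) :
    lyapunovPos f (muOf H.symm) = ∫⁻ y, ENNReal.ofReal (Real.log (R y)) ∂(leb 0 1) := by
  rw [lyapunovPos, lintegral_muOf]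
  refine lintegral_congr_ae ?_
  filter_upwards [hR] with y hy
  rw [logAbsDeriv, hy.1, ENNReal.log_ofReal_of_pos hy.2, EReal.real_coe_toENNReal]

lemma lyapunovNeg_eq
    (hR : ∀ᵐ y ∂(leb 0 1), |derivWithin (ext f) (Icc 0 1) (H y)| = R y ∧ 0 < R y) :
    lyapunovNeg f (muOf H.symm) = ∫⁻ y, ENNReal.ofReal (-Real.log (R y)) ∂(leb 0 1) := by
  rw [lyapunovNeg, lintegral_muOf]
  refine lintegral_congr_ae ?_
  filter_upwards [hR] with y hy
  rw [logAbsDeriv, hy.1, ENNReal.log_ofReal_of_pos hy.2, ← EReal.coe_neg,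
    EReal.real_coe_toENNReal]

lemma measurePreserving_tent : MeasurePreserving tent (leb 0 1) (leb 0 1) :=
  measurePreserving_of_half continuous_tent.measurable measurable_tentCode
    fun i B _ => leb_tentCode_inter i B

/-- `log |Df|` is cohomologous to `log 2` through `log ρ`. Integrability of `log ρ` makes both parts
finite, and invariance of Lebesgue measure under the tent map makes the coboundary integrate to
zero. -/
theorem hasLyapunovExponent_log_two {ρ : ℝ → ℝ} (hρ : ∀ y ∈ Ioo (0 : ℝ) 1, 0 < ρ y)
    (hint : IntegrableOn (fun y => Real.log (ρ y)) (Icc 0 1))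
    (hR : ∀ y : Icc (0 : ℝ) 1, (y : ℝ) ∈ Ioo (0 : ℝ) 1 → (y : ℝ) ≠ 1 / 2 →
      |derivWithin (ext f) (Icc 0 1) (H y)| = 2 * ρ (tent y) / ρ y) :
    HasLyapunovExponent f (muOf H.symm) ((Real.log 2 : ℝ) : EReal) := by
  have hR' : ∀ᵐ y ∂(leb 0 1), |derivWithin (ext f) (Icc 0 1) (H y)| = 2 * ρ (tent y) / ρ y ∧
      0 < 2 * ρ (tent y) / ρ y := by
    filter_upwards [ae_leb_mem_Ioo, measurePreserving_tent.quasiMeasurePreserving.ae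
      ae_leb_mem_Ioo] with y hy hy'
    have h1 := hρ _ hy.1
    have h2 := hρ _ hy'.1
    exact ⟨hR y hy.1 hy.2, by positivity⟩
  rw [HasLyapunovExponent, lyapunovPos_eq hR', lyapunovNeg_eq hR']
  set G : Icc (0 : ℝ) 1 → ℝ := fun y => Real.log (ρ y) with hG
  have hGi : Integrable G (leb 0 1) := integrable_leb hint
  have hGT : Integrable (G ∘ tent) (leb 0 1) :=
    measurePreserving_tent.integrable_comp_of_integrable hGi
  have hGTe : ∫ y, G (tent y) ∂(leb 0 1) = ∫ y, G y ∂(leb 0 1) := by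
    rw [← integral_map measurePreserving_tent.measurable.aemeasurable,
      measurePreserving_tent.map_eq]
    rw [measurePreserving_tent.map_eq]
    exact hGi.aestronglyMeasurable
  set F : Icc (0 : ℝ) 1 → ℝ := fun y => Real.log (2 * ρ (tent y) / ρ y) with hF
  have hFe : F =ᵐ[leb 0 1] fun y => Real.log 2 + (G ∘ tent) y - G y := by
    filter_upwards [ae_leb_mem_Ioo, measurePreserving_tent.quasiMeasurePreserving.ae
      ae_leb_mem_Ioo] with y hy hy'
    have h1 := hρ _ hy.1
    have h2 := hρ _ hy'.1
    simp only [hF, hG, Function.comp_apply]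
    rw [Real.log_div (by positivity) h1.ne', Real.log_mul two_ne_zero h2.ne']
  have hFi0 := ((integrable_const (μ := leb 0 1) (Real.log 2)).add hGT).sub hGi
  have hFi : Integrable F (leb 0 1) := hFi0.congr hFe.symm
  have hFint : ∫ y, F y ∂(leb 0 1) = Real.log 2 := by
    have h1 : ∫ y, (Real.log 2 + (G ∘ tent) y - G y) ∂(leb 0 1) =
        ∫ y, (Real.log 2 + (G ∘ tent) y) ∂(leb 0 1) - ∫ y, G y ∂(leb 0 1) :=
      integral_sub ((integrable_const _).add hGT) hGi
    have h2 : ∫ y, (Real.log 2 + (G ∘ tent) y) ∂(leb 0 1) =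
        ∫ _, Real.log 2 ∂(leb 0 1) + ∫ y, (G ∘ tent) y ∂(leb 0 1) :=
      integral_add (integrable_const _) hGT
    rw [integral_congr_ae hFe, h1, h2]
    simp only [Function.comp_apply]
    rw [hGTe]
    simp
  have hpos : ∫⁻ y, ENNReal.ofReal (F y) ∂(leb 0 1) ≠ ⊤ := hFi.lintegral_lt_top.ne
  have hneg : ∫⁻ y, ENNReal.ofReal (-F y) ∂(leb 0 1) ≠ ⊤ := hFi.neg.lintegral_lt_top.ne
  refine ⟨Or.inl hpos, ?_⟩
  rw [integral_eq_lintegral_pos_part_sub_lintegral_neg_part hFi] at hFint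
  rw [← hFint, EReal.coe_sub, EReal.coe_ennreal_toReal hpos, EReal.coe_ennreal_toReal hneg]

end LyapunovTools

/-! ### Conjugacies with a smooth positive derivative on the open interval -/

section SmoothConjugacy

/-- `φ` is a homeomorphism of `[0, 1]` with smooth positive derivative `ρ` on `(0, 1)`. -/
structure IsSmoothReparam (φ ρ : ℝ → ℝ) : Prop where
  zero : φ 0 = 0
  one : φ 1 = 1
  cont : ContinuousOn φ (Icc 0 1)
  hasDerivAt : ∀ y ∈ Ioo (0 : ℝ) 1, HasDerivAt φ (ρ y) y
  pos : ∀ y ∈ Ioo (0 : ℝ) 1, 0 < ρ y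
  smooth : ContDiffOn ℝ ∞ ρ (Ioo 0 1)

variable {φ ρ : ℝ → ℝ}

lemma IsSmoothReparam.strictMonoOn (c : IsSmoothReparam φ ρ) : StrictMonoOn φ (Icc 0 1) := by
  refine strictMonoOn_of_deriv_pos (convex_Icc _ _) c.cont fun z hz => ?_
  rw [interior_Icc] at hz
  rw [(c.hasDerivAt z hz).deriv]
  exact c.pos z hz

lemma IsSmoothReparam.exists_homeomorph (c : IsSmoothReparam φ ρ) :
    ∃ H : Icc (0 : ℝ) 1 ≃ₜ Icc (0 : ℝ) 1, ∀ y, (H y : ℝ) = φ y :=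
  CuspMaps.exists_homeomorph c.zero c.one c.cont c.strictMonoOn

lemma IsSmoothReparam.contDiffAt (c : IsSmoothReparam φ ρ) {y : ℝ} (hy : y ∈ Ioo (0 : ℝ) 1) :
    ContDiffAt ℝ ∞ φ y := by
  have h : ContDiffOn ℝ ∞ φ (Ioo 0 1) := by
    rw [contDiffOn_infty_iff_deriv_of_isOpen isOpen_Ioo]
    exact ⟨fun z hz => (c.hasDerivAt z hz).differentiableAt.differentiableWithinAt,
      c.smooth.congr fun z hz => (c.hasDerivAt z hz).deriv⟩
  exact (h y hy).contDiffAt (isOpen_Ioo.mem_nhds hy)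

variable {H : Icc (0 : ℝ) 1 ≃ₜ Icc (0 : ℝ) 1}

lemma IsSmoothReparam.smooth_homeomorph (c : IsSmoothReparam φ ρ) (hH : ∀ y, (H y : ℝ) = φ y) :
    ContDiffOn ℝ ∞ (ext H) (Ioo 0 1) := by
  intro y hy
  refine (c.contDiffAt hy).contDiffWithinAt.congr (fun z hz => ?_) ?_
  · exact (ext_apply H ⟨z, Ioo_subset_Icc_self hz⟩).trans (hH _)
  · exact (ext_apply H ⟨y, Ioo_subset_Icc_self hy⟩).trans (hH _)

lemma IsSmoothReparam.exists_eq (c : IsSmoothReparam φ ρ) {x : ℝ} (hx : x ∈ Ioo (0 : ℝ) 1) :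
    ∃ y ∈ Ioo (0 : ℝ) 1, φ y = x :=
  intermediate_value_Ioo zero_le_one c.cont (by rwa [c.zero, c.one])

/-- The inverse is the map parametrized by `φ y ↦ y`. -/
lemma IsSmoothReparam.smooth_homeomorph_symm (c : IsSmoothReparam φ ρ)
    (hH : ∀ y, (H y : ℝ) = φ y) : ContDiffOn ℝ ∞ (ext H.symm) (Ioo 0 1) := by
  intro x hx
  obtain ⟨y, hy, rfl⟩ := c.exists_eq hx
  refine (ContDiffAt.of_parametrization (by simp) (c.contDiffAt hy) (c.hasDerivAt y hy)
    (c.pos y hy).ne' contDiffAt_id ?_).contDiffWithinAt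
  filter_upwards [isOpen_Ioo.mem_nhds hy] with w hw
  have h := ext_apply H.symm (H ⟨w, Ioo_subset_Icc_self hw⟩)
  rw [hH, H.symm_apply_apply] at h
  exact h

lemma tcSmooth_of_reparam (c : IsSmoothReparam φ ρ) (hH : ∀ y, (H y : ℝ) = φ y)
    (hcusp : IsCuspMapOrRestriction (tentConj H)) : TCSmooth (tentConj H) H.symm where
  cusp := hcusp
  conj := semiconj_tentConj H
  smooth := c.smooth_homeomorph_symm hH
  smooth_symm := c.smooth_homeomorph hH

lemma ext_tentConj_left (hH : ∀ y, (H y : ℝ) = φ y) {y : ℝ} (hy : y ∈ Icc (0 : ℝ) (1 / 2)) :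
    ext (tentConj H) (φ y) = φ (2 * y) := by
  have h := ext_apply (tentConj H) (H ⟨y, hy.1, by linarith [hy.2]⟩)
  rwa [tentConj_apply, hH, hH, tent_of_le hy.2] at h

lemma ext_tentConj_right (hH : ∀ y, (H y : ℝ) = φ y) {y : ℝ} (hy : y ∈ Icc (1 / 2 : ℝ) 1) :
    ext (tentConj H) (φ y) = φ (2 - 2 * y) := by
  have h := ext_apply (tentConj H) (H ⟨y, by linarith [hy.1], hy.2⟩)
  rwa [tentConj_apply, hH, hH, tent_of_ge hy.1] at h

lemma two_mul_mem_Ioo {y : ℝ} (hy : y ∈ Ioo (0 : ℝ) (1 / 2)) : 2 * y ∈ Ioo (0 : ℝ) 1 :=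
  ⟨by linarith [hy.1], by linarith [hy.2]⟩

lemma two_sub_mem_Ioo {y : ℝ} (hy : y ∈ Ioo (1 / 2 : ℝ) 1) : 2 - 2 * y ∈ Ioo (0 : ℝ) 1 :=
  ⟨by linarith [hy.2], by linarith [hy.1]⟩

lemma left_mem_Ioo {y : ℝ} (hy : y ∈ Ioo (0 : ℝ) (1 / 2)) : y ∈ Ioo (0 : ℝ) 1 :=
  ⟨hy.1, by linarith [hy.2]⟩

lemma right_mem_Ioo {y : ℝ} (hy : y ∈ Ioo (1 / 2 : ℝ) 1) : y ∈ Ioo (0 : ℝ) 1 :=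
  ⟨by linarith [hy.1], hy.2⟩

lemma IsSmoothReparam.hasDerivAt_left (c : IsSmoothReparam φ ρ) {y : ℝ}
    (hy : y ∈ Ioo (0 : ℝ) (1 / 2)) : HasDerivAt (fun y => φ (2 * y)) (2 * ρ (2 * y)) y := by
  have h := (c.hasDerivAt _ (two_mul_mem_Ioo hy)).comp y ((hasDerivAt_id y).const_mul 2)
  simpa [Function.comp_def, mul_comm] using h

lemma IsSmoothReparam.hasDerivAt_right (c : IsSmoothReparam φ ρ) {y : ℝ}
    (hy : y ∈ Ioo (1 / 2 : ℝ) 1) :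
    HasDerivAt (fun y => φ (2 - 2 * y)) (-(2 * ρ (2 - 2 * y))) y := by
  have h := (c.hasDerivAt _ (two_sub_mem_Ioo hy)).comp y
    (((hasDerivAt_id y).const_mul 2).const_sub 2)
  simpa [Function.comp_def, mul_comm] using h

lemma IsSmoothReparam.contDiffAt_left (c : IsSmoothReparam φ ρ) {y : ℝ}
    (hy : y ∈ Ioo (0 : ℝ) (1 / 2)) : ContDiffAt ℝ ∞ (fun y => φ (2 * y)) y :=
  ContDiffAt.comp y (c.contDiffAt (two_mul_mem_Ioo hy)) (by fun_prop)

lemma IsSmoothReparam.contDiffAt_right (c : IsSmoothReparam φ ρ) {y : ℝ}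
    (hy : y ∈ Ioo (1 / 2 : ℝ) 1) : ContDiffAt ℝ ∞ (fun y => φ (2 - 2 * y)) y :=
  ContDiffAt.comp y (c.contDiffAt (two_sub_mem_Ioo hy)) (by fun_prop)

lemma one_le_infty : (1 : ℕ∞ω) ≤ (∞ : ℕ∞ω) := by simp

lemma eventually_ext_left (hH : ∀ y, (H y : ℝ) = φ y) {y : ℝ} (hy : y ∈ Ioo (0 : ℝ) (1 / 2)) :
    ∀ᶠ w in 𝓝 y, ext (tentConj H) (φ w) = φ (2 * w) :=
  (isOpen_Ioo.eventually_mem hy).mono fun _ hw => ext_tentConj_left hH (Ioo_subset_Icc_self hw)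

lemma eventually_ext_right (hH : ∀ y, (H y : ℝ) = φ y) {y : ℝ} (hy : y ∈ Ioo (1 / 2 : ℝ) 1) :
    ∀ᶠ w in 𝓝 y, ext (tentConj H) (φ w) = φ (2 - 2 * w) :=
  (isOpen_Ioo.eventually_mem hy).mono fun _ hw => ext_tentConj_right hH (Ioo_subset_Icc_self hw)

lemma IsSmoothReparam.deriv_ext_left (c : IsSmoothReparam φ ρ) (hH : ∀ y, (H y : ℝ) = φ y) {y : ℝ}
    (hy : y ∈ Ioo (0 : ℝ) (1 / 2)) :
    deriv (ext (tentConj H)) (φ y) = 2 * ρ (2 * y) / ρ y :=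
  (HasDerivAt.of_parametrization ((c.contDiffAt (left_mem_Ioo hy)).of_le one_le_infty)
    (c.hasDerivAt y (left_mem_Ioo hy)) (c.pos y (left_mem_Ioo hy)).ne'
    ((c.contDiffAt_left hy).of_le one_le_infty) (c.hasDerivAt_left hy)
    (eventually_ext_left hH hy)).deriv

lemma IsSmoothReparam.deriv_ext_right (c : IsSmoothReparam φ ρ) (hH : ∀ y, (H y : ℝ) = φ y)
    {y : ℝ} (hy : y ∈ Ioo (1 / 2 : ℝ) 1) :
    deriv (ext (tentConj H)) (φ y) = -(2 * ρ (2 - 2 * y)) / ρ y :=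
  (HasDerivAt.of_parametrization ((c.contDiffAt (right_mem_Ioo hy)).of_le one_le_infty)
    (c.hasDerivAt y (right_mem_Ioo hy)) (c.pos y (right_mem_Ioo hy)).ne'
    ((c.contDiffAt_right hy).of_le one_le_infty) (c.hasDerivAt_right hy)
    (eventually_ext_right hH hy)).deriv

lemma IsSmoothReparam.apply_mem_Ioo (c : IsSmoothReparam φ ρ) {y : ℝ} (hy : y ∈ Ioo (0 : ℝ) 1) :
    φ y ∈ Ioo (0 : ℝ) 1 :=
  ⟨c.zero ▸ c.strictMonoOn (left_mem_Icc.2 zero_le_one) (Ioo_subset_Icc_self hy) hy.1,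
    c.one ▸ c.strictMonoOn (Ioo_subset_Icc_self hy) (right_mem_Icc.2 zero_le_one) hy.2⟩

lemma IsSmoothReparam.abs_derivWithin_ext (c : IsSmoothReparam φ ρ) (hH : ∀ y, (H y : ℝ) = φ y)
    {y : Icc (0 : ℝ) 1} (hy : (y : ℝ) ∈ Ioo (0 : ℝ) 1) (hy' : (y : ℝ) ≠ 1 / 2) :
    |derivWithin (ext (tentConj H)) (Icc 0 1) (H y)| = 2 * ρ (tent y) / ρ y := by
  rw [hH, derivWithin_of_mem_nhds (Icc_mem_nhds (c.apply_mem_Ioo hy).1 (c.apply_mem_Ioo hy).2)]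
  have h0 := c.pos _ hy
  rcases lt_or_gt_of_ne hy' with h | h
  · have h2 := c.pos _ (two_mul_mem_Ioo ⟨hy.1, h⟩)
    rw [c.deriv_ext_left hH ⟨hy.1, h⟩, tent_of_le h.le, abs_of_pos (by positivity)]
  · have h2 := c.pos _ (two_sub_mem_Ioo ⟨h, hy.2⟩)
    rw [c.deriv_ext_right hH ⟨h, hy.2⟩, tent_of_ge h.le, neg_div, abs_neg,
      abs_of_pos (by positivity)]

lemma IsSmoothReparam.isCuspBranch_left (c : IsSmoothReparam φ ρ) (hH : ∀ y, (H y : ℝ) = φ y)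
    {ε C : ℝ} (hl : TendstoZeroOrInfty (fun y => 2 * ρ (2 * y) / ρ y) (𝓝[>] 0))
    (hr : TendstoZeroOrInfty (fun y => 2 * ρ (2 * y) / ρ y) (𝓝[<] (1 / 2))) (hC : 0 < C)
    (hW : ∀ z ∈ Ioo (0 : ℝ) (1 / 2), ∀ w ∈ Ioo (0 : ℝ) (1 / 2),
      |(1 + 2 * ρ (2 * z) / ρ z)⁻¹ - (1 + 2 * ρ (2 * w) / ρ w)⁻¹| ≤ C * |φ z - φ w| ^ ε) :
    IsCuspBranch (ext (tentConj H)) 0 (φ (1 / 2)) ε := by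
  have habs : ∀ y ∈ Ioo (0 : ℝ) (1 / 2), |2 * ρ (2 * y) / ρ y| = 2 * ρ (2 * y) / ρ y := by
    intro y hy
    have h1 := c.pos _ (left_mem_Ioo hy)
    have h2 := c.pos _ (two_mul_mem_Ioo hy)
    exact abs_of_pos (by positivity)
  refine IsCuspBranch.of_parametrization (p := φ) (q := fun y => φ (2 * y)) (p' := ρ)
    (q' := fun y => 2 * ρ (2 * y)) (α := 0) (β := 1 / 2) (by norm_num)
    (c.cont.mono (Icc_subset_Icc_right (by norm_num))) c.zero rfl
    (fun z hz => (c.contDiffAt (left_mem_Ioo hz)).of_le one_le_infty)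
    (fun z hz => (c.contDiffAt_left hz).of_le one_le_infty)
    (fun z hz => c.hasDerivAt z (left_mem_Ioo hz)) (fun z hz => c.hasDerivAt_left hz)
    (fun z hz => c.pos z (left_mem_Ioo hz))
    (fun z hz => ext_tentConj_left hH (Ioo_subset_Icc_self hz))
    (Or.inl fun z hz => mul_pos two_pos (c.pos _ (two_mul_mem_Ioo hz))) hl hr hC
    fun z hz w hw => ?_
  rw [habs z hz, habs w hw]
  exact hW z hz w hw

/-- Stated for a general `g`, because the parabolic example needs it for the extension of the
conjugated map to a larger interval. -/
lemma IsSmoothReparam.isCuspBranch_right (c : IsSmoothReparam φ ρ) {g : ℝ → ℝ}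
    (hg : ∀ y ∈ Ioo (1 / 2 : ℝ) 1, g (φ y) = φ (2 - 2 * y)) {ε C : ℝ}
    (hl : TendstoZeroOrInfty (fun y => -(2 * ρ (2 - 2 * y)) / ρ y) (𝓝[>] (1 / 2)))
    (hr : TendstoZeroOrInfty (fun y => -(2 * ρ (2 - 2 * y)) / ρ y) (𝓝[<] 1)) (hC : 0 < C)
    (hW : ∀ z ∈ Ioo (1 / 2 : ℝ) 1, ∀ w ∈ Ioo (1 / 2 : ℝ) 1,
      |(1 + 2 * ρ (2 - 2 * z) / ρ z)⁻¹ - (1 + 2 * ρ (2 - 2 * w) / ρ w)⁻¹| ≤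
        C * |φ z - φ w| ^ ε) :
    IsCuspBranch g (φ (1 / 2)) 1 ε := by
  have habs : ∀ y ∈ Ioo (1 / 2 : ℝ) 1,
      |-(2 * ρ (2 - 2 * y)) / ρ y| = 2 * ρ (2 - 2 * y) / ρ y := by
    intro y hy
    have h1 := c.pos _ (right_mem_Ioo hy)
    have h2 := c.pos _ (two_sub_mem_Ioo hy)
    rw [neg_div, abs_neg, abs_of_pos (by positivity)]
  refine IsCuspBranch.of_parametrization (p := φ) (q := fun y => φ (2 - 2 * y)) (p' := ρ)
    (q' := fun y => -(2 * ρ (2 - 2 * y))) (α := 1 / 2) (β := 1) (by norm_num)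
    (c.cont.mono (Icc_subset_Icc_left (by norm_num))) rfl c.one
    (fun z hz => (c.contDiffAt (right_mem_Ioo hz)).of_le one_le_infty)
    (fun z hz => (c.contDiffAt_right hz).of_le one_le_infty)
    (fun z hz => c.hasDerivAt z (right_mem_Ioo hz)) (fun z hz => c.hasDerivAt_right hz)
    (fun z hz => c.pos z (right_mem_Ioo hz))
    hg
    (Or.inr fun z hz => neg_neg_of_pos (mul_pos two_pos (c.pos _ (two_sub_mem_Ioo hz)))) hl hr hC
    fun z hz w hw => ?_
  rw [habs z hz, habs w hw]
  exact hW z hz w hw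

end SmoothConjugacy

/-! ### Hölder bounds from pointwise derivative bounds -/

section HolderCriterion

/-- A pointwise bound on the derivative gives a Hölder bound with respect to a
parametrization. -/
lemma holder_of_deriv_le {W W' φ ρ : ℝ → ℝ} {α β K ε : ℝ} (hε : 0 < ε) (hε1 : ε ≤ 1)
    (hK : 0 ≤ K) (hW : ∀ z ∈ Ioo α β, HasDerivAt W (W' z) z)
    (hφ : ∀ z ∈ Ioo α β, HasDerivAt φ (ρ z) z) (hpos : ∀ z ∈ Ioo α β, 0 < φ z)
    (hρ : ∀ z ∈ Ioo α β, 0 < ρ z) (h : ∀ z ∈ Ioo α β, |W' z| ≤ K * (φ z ^ (ε - 1) * ρ z)) :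
    ∀ z ∈ Ioo α β, ∀ w ∈ Ioo α β, |W z - W w| ≤ K / ε * |φ z - φ w| ^ ε := by
  -- The hypothesis says that the derivative of `(K / ε) φ ^ ε` dominates `|W'|`, so this function
  -- plus or minus `W` is monotone.
  have hV : ∀ z ∈ Ioo α β, HasDerivAt (fun z => K / ε * φ z ^ ε)
      (K * (φ z ^ (ε - 1) * ρ z)) z := by
    intro z hz
    have h1 := ((hφ z hz).rpow_const (p := ε) (Or.inl (hpos z hz).ne')).const_mul (K / ε)
    have h2 : K / ε * (ρ z * ε * φ z ^ (ε - 1)) = K * (φ z ^ (ε - 1) * ρ z) := by field_simp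
    rwa [h2] at h1
  have hmφ : StrictMonoOn φ (Ioo α β) := by
    refine strictMonoOn_of_deriv_pos (convex_Ioo _ _)
      (fun z hz => (hφ z hz).continuousAt.continuousWithinAt) fun z hz => ?_
    rw [interior_Ioo] at hz
    rw [(hφ z hz).deriv]
    exact hρ z hz
  have mono : ∀ {F F' : ℝ → ℝ}, (∀ z ∈ Ioo α β, HasDerivAt F (F' z) z) →
      (∀ z ∈ Ioo α β, 0 ≤ F' z) → MonotoneOn F (Ioo α β) := by
    intro F F' hF hF'
    refine monotoneOn_of_deriv_nonneg (convex_Ioo _ _)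
      (fun z hz => (hF z hz).continuousAt.continuousWithinAt) (fun z hz => ?_) fun z hz => ?_
    · rw [interior_Ioo] at hz ⊢
      exact (hF z hz).differentiableAt.differentiableWithinAt
    · rw [interior_Ioo] at hz
      rw [(hF z hz).deriv]
      exact hF' z hz
  have m1 := mono (fun z hz => (hV z hz).add (hW z hz)) fun z hz => by
    linarith [neg_le_of_abs_le (h z hz)]
  have m2 := mono (fun z hz => (hV z hz).sub (hW z hz)) fun z hz => by
    linarith [le_of_abs_le (h z hz)]
  have key : ∀ z ∈ Ioo α β, ∀ w ∈ Ioo α β, z < w → |W z - W w| ≤ K / ε * |φ z - φ w| ^ ε := by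
    intro z hz w hw hzw
    have h1 := m1 hz hw hzw.le
    have h2 := m2 hz hw hzw.le
    have h3 := hmφ hz hw hzw
    simp only [Pi.add_apply, Pi.sub_apply] at h1 h2
    -- Subadditivity of `t ↦ t ^ ε`, where `ε ≤ 1` is needed.
    have h4 : φ w ^ ε ≤ φ z ^ ε + (φ w - φ z) ^ ε := by
      have := Real.rpow_add_le_add_rpow (hpos z hz).le (sub_nonneg.2 h3.le) hε.le hε1
      rwa [add_sub_cancel] at this
    have h5 := mul_le_mul_of_nonneg_left h4 (by positivity : 0 ≤ K / ε)
    rw [abs_sub_comm (φ z), abs_of_pos (sub_pos.2 h3)]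
    exact abs_le.2 ⟨by linarith, by linarith⟩
  intro z hz w hw
  rcases lt_trichotomy z w with h | h | h
  · exact key z hz w hw h
  · subst h
    simp [Real.zero_rpow hε.ne']
  · rw [abs_sub_comm, abs_sub_comm (φ z)]
    exact key w hw z hz h

end HolderCriterion

/-! ### Conjugacies with density proportional to `exp (-w)` -/

section FlatWeights

/-- Symmetric weights `w` such that `exp (-w)` is the derivative of a conjugacy from the tent map
to a cusp map with poles at the boundary and a flat critical point. -/
structure IsFlatWeight (w : ℝ → ℝ) : Prop where
  smooth : ContDiffOn ℝ ∞ w (Ioo 0 1)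
  symm : ∀ y, w (1 - y) = w y
  one_le : ∀ y ∈ Ioo (0 : ℝ) 1, 1 ≤ w y
  deriv_le : ∀ y ∈ Ioo (0 : ℝ) 1, |deriv w y| ≤ w y ^ 3
  double : ∀ y ∈ Ioc (0 : ℝ) (1 / 4), w (2 * y) ≤ 7 / 8 * w y
  le_six : ∀ y ∈ Icc (1 / 4 : ℝ) (1 / 2), w y ≤ 6
  anti : AntitoneOn w (Ioc 0 (1 / 2))
  lim : Tendsto w (𝓝[>] 0) atTop

/-- The total mass of `exp (-w)`. -/
def flatMass (w : ℝ → ℝ) : ℝ := ∫ y in (0 : ℝ)..1, Real.exp (-w y)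

/-- The normalization of `exp (-w)`. -/
def flatDensity (w : ℝ → ℝ) (y : ℝ) : ℝ := Real.exp (-w y) / flatMass w

/-- The distribution function of `flatDensity w`. -/
def flatPrimitive (w : ℝ → ℝ) (y : ℝ) : ℝ := ∫ t in (0 : ℝ)..y, flatDensity w t

variable {w : ℝ → ℝ}

namespace IsFlatWeight

lemma continuousOn_exp (hw : IsFlatWeight w) :
    ContinuousOn (fun y => Real.exp (-w y)) (Ioo 0 1) :=
  Real.continuous_exp.comp_continuousOn hw.smooth.continuousOn.neg

lemma intervalIntegrable_exp (hw : IsFlatWeight w) :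
    IntervalIntegrable (fun y => Real.exp (-w y)) volume 0 1 := by
  rw [intervalIntegrable_iff_integrableOn_Ioo_of_le zero_le_one]
  refine IntegrableOn.of_bound (by simp)
    (hw.continuousOn_exp.aestronglyMeasurable measurableSet_Ioo) 1 ?_
  refine (ae_restrict_iff' measurableSet_Ioo).2 (ae_of_all _ fun y hy => ?_)
  rw [Real.norm_eq_abs, Real.abs_exp, Real.exp_le_one_iff]
  linarith [hw.one_le y hy]

lemma flatMass_pos (hw : IsFlatWeight w) : 0 < flatMass w :=
  intervalIntegral.intervalIntegral_pos_of_pos_on hw.intervalIntegrable_exp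
    (fun _ _ => Real.exp_pos _) zero_lt_one

lemma flatDensity_pos (hw : IsFlatWeight w) (y : ℝ) : 0 < flatDensity w y :=
  div_pos (Real.exp_pos _) hw.flatMass_pos

lemma intervalIntegrable (hw : IsFlatWeight w) :
    IntervalIntegrable (flatDensity w) volume 0 1 :=
  hw.intervalIntegrable_exp.div_const _

lemma contDiffOn_flatDensity (hw : IsFlatWeight w) : ContDiffOn ℝ ∞ (flatDensity w) (Ioo 0 1) :=
  (Real.contDiff_exp.comp_contDiffOn hw.smooth.neg).div_const _

lemma isSmoothReparam (hw : IsFlatWeight w) :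
    IsSmoothReparam (flatPrimitive w) (flatDensity w) where
  zero := intervalIntegral.integral_same
  one := by
    simp only [flatPrimitive, flatDensity]
    rw [intervalIntegral.integral_div]
    exact div_self hw.flatMass_pos.ne'
  cont := by
    have h := intervalIntegral.continuousOn_primitive_interval' hw.intervalIntegrable
      (left_mem_uIcc (a := (0 : ℝ)) (b := 1))
    rwa [uIcc_of_le zero_le_one] at h
  hasDerivAt y hy := by
    have hc := hw.contDiffOn_flatDensity.continuousOn
    refine intervalIntegral.integral_hasDerivAt_right
      (hw.intervalIntegrable.mono_set ?_) (hc.stronglyMeasurableAtFilter isOpen_Ioo y hy)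
      (hc.continuousAt (isOpen_Ioo.mem_nhds hy))
    rw [uIcc_of_le hy.1.le, uIcc_of_le zero_le_one]
    exact Icc_subset_Icc_right hy.2.le
  pos y _ := hw.flatDensity_pos y
  smooth := hw.contDiffOn_flatDensity

lemma flatDensity_symm (hw : IsFlatWeight w) (y : ℝ) :
    flatDensity w (1 - y) = flatDensity w y := by
  rw [flatDensity, hw.symm, flatDensity]

lemma flatPrimitive_symm (hw : IsFlatWeight w) {y : ℝ} (hy : y ∈ Icc (0 : ℝ) 1) :
    flatPrimitive w (1 - y) = 1 - flatPrimitive w y := by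
  have h1 : ∫ t in (0 : ℝ)..(1 - y), flatDensity w t = ∫ t in y..1, flatDensity w t := by
    have h := intervalIntegral.integral_comp_sub_left (a := y) (b := 1) (flatDensity w) 1
    rw [sub_self] at h
    rw [← h]
    exact intervalIntegral.integral_congr fun t _ => hw.flatDensity_symm t
  have hi : ∀ a b, a ∈ Icc (0 : ℝ) 1 → b ∈ Icc (0 : ℝ) 1 →
      IntervalIntegrable (flatDensity w) volume a b := fun a b ha hb =>
    hw.intervalIntegrable.mono_set (by
      rw [uIcc_of_le zero_le_one]
      exact uIcc_subset_Icc ha hb)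
  have h2 := intervalIntegral.integral_add_adjacent_intervals
    (hi 0 y ⟨le_rfl, zero_le_one⟩ hy) (hi y 1 hy ⟨zero_le_one, le_rfl⟩)
  have h3 : ∫ t in (0 : ℝ)..1, flatDensity w t = 1 := hw.isSmoothReparam.one
  unfold flatPrimitive
  linarith

/-- The density increases on `(0, 1 / 2]`, so its integral up to `y` is at most `y` times its value
at `y`. -/
lemma flatPrimitive_le (hw : IsFlatWeight w) {y : ℝ} (hy : y ∈ Ioo (0 : ℝ) (1 / 2)) :
    flatPrimitive w y ≤ flatDensity w y := by
  have hi : IntervalIntegrable (flatDensity w) volume 0 y := hw.intervalIntegrable.mono_set (by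
    rw [uIcc_of_le zero_le_one, uIcc_of_le hy.1.le]
    exact Icc_subset_Icc_right (by linarith [hy.2]))
  have h1 : ∫ t in (0 : ℝ)..y, flatDensity w t ≤ ∫ _ in (0 : ℝ)..y, flatDensity w y := by
    refine intervalIntegral.integral_mono_on_of_le_Ioo hy.1.le hi (by simp) fun t ht => ?_
    refine div_le_div_of_nonneg_right (Real.exp_le_exp.2 (neg_le_neg ?_)) hw.flatMass_pos.le
    exact hw.anti ⟨ht.1, by linarith [ht.2, hy.2]⟩ ⟨hy.1, hy.2.le⟩ ht.2.le
  rw [intervalIntegral.integral_const, smul_eq_mul, sub_zero] at h1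
  refine h1.trans ?_
  nlinarith [hw.flatDensity_pos y, hy.1, hy.2]

/-- The modulus of the derivative of the left branch. -/
lemma ratio_eq (hw : IsFlatWeight w) (y : ℝ) :
    2 * flatDensity w (2 * y) / flatDensity w y = 2 * Real.exp (w y - w (2 * y)) := by
  have hM := hw.flatMass_pos.ne'
  rw [flatDensity, flatDensity, Real.exp_sub, Real.exp_neg, Real.exp_neg]
  field_simp

lemma ratio_eq_right (hw : IsFlatWeight w) (y : ℝ) :
    2 * flatDensity w (2 - 2 * y) / flatDensity w y =
      2 * Real.exp (w (1 - y) - w (2 * (1 - y))) := by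
  rw [← hw.ratio_eq, hw.flatDensity_symm]
  ring_nf

/-- The doubling bound gives `w y - w (2 * y) ≥ w y / 8`, which tends to infinity. -/
lemma tendsto_ratio_zero (hw : IsFlatWeight w) :
    Tendsto (fun y => 2 * Real.exp (w y - w (2 * y))) (𝓝[>] 0) atTop := by
  refine Tendsto.const_mul_atTop two_pos (Real.tendsto_exp_atTop.comp ?_)
  refine tendsto_atTop_mono' _ ?_ (hw.lim.const_mul_atTop (by norm_num : (0 : ℝ) < 1 / 8))
  filter_upwards [Ioo_mem_nhdsGT (by norm_num : (0 : ℝ) < 1 / 4)] with y hy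
  linarith [hw.double y ⟨hy.1, hy.2.le⟩]

/-- Here `w y` stays below `6`, while `w (2 * y) = w (1 - 2 * y)` blows up. -/
lemma tendsto_ratio_half (hw : IsFlatWeight w) :
    Tendsto (fun y => 2 * Real.exp (w y - w (2 * y))) (𝓝[<] (1 / 2)) (𝓝 0) := by
  have h0 : Tendsto (fun y : ℝ => 1 - 2 * y) (𝓝[<] (1 / 2)) (𝓝[>] 0) := by
    refine tendsto_nhdsWithin_iff.2 ⟨?_, ?_⟩
    · have : Tendsto (fun y : ℝ => 1 - 2 * y) (𝓝 (1 / 2)) (𝓝 (1 - 2 * (1 / 2))) :=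
        Continuous.tendsto (by fun_prop) _
      norm_num at this
      norm_num
      exact this.mono_left nhdsWithin_le_nhds
    · filter_upwards [self_mem_nhdsWithin] with y hy
      have : y < 1 / 2 := hy
      exact mem_Ioi.2 (by linarith)
  have h1 : Tendsto (fun y => w (2 * y)) (𝓝[<] (1 / 2)) atTop :=
    (hw.lim.comp h0).congr fun y => hw.symm (2 * y)
  rw [← mul_zero (2 : ℝ)]
  refine Tendsto.const_mul _ (Real.tendsto_exp_atBot.comp ?_)
  refine tendsto_atBot_mono' _ ?_
    (tendsto_atBot_add_const_left _ (6 : ℝ) (tendsto_neg_atTop_atBot.comp h1))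
  filter_upwards [Ioo_mem_nhdsLT (by norm_num : (1 / 4 : ℝ) < 1 / 2)] with y hy
  have := hw.le_six y (Ioo_subset_Icc_self hy)
  simp only [Function.comp_apply]
  linarith

lemma pow_three_mul_exp_neg_le {x : ℝ} (hx : 0 ≤ x) : x ^ 3 * Real.exp (-x) ≤ 6 := by
  have h := Real.pow_div_factorial_le_exp x hx 3
  rw [Real.exp_neg, mul_inv_le_iff₀ (Real.exp_pos _)]
  have h6 : ((Nat.factorial 3 : ℕ) : ℝ) = 6 := by norm_num [Nat.factorial]
  rw [h6, div_le_iff₀ (by norm_num)] at h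
  linarith

lemma hasDerivAt_inv_ratio (hw : IsFlatWeight w) {y : ℝ} (hy : y ∈ Ioo (0 : ℝ) (1 / 2)) :
    HasDerivAt (fun y => (1 + 2 * Real.exp (w y - w (2 * y)))⁻¹)
      (-(2 * (Real.exp (w y - w (2 * y)) * (deriv w y - 2 * deriv w (2 * y)))) /
        (1 + 2 * Real.exp (w y - w (2 * y))) ^ 2) y := by
  have hd : ∀ z ∈ Ioo (0 : ℝ) 1, HasDerivAt w (deriv w z) z := fun z hz =>
    ((hw.smooth.differentiableOn (by simp) z hz).differentiableAt
      (isOpen_Ioo.mem_nhds hz)).hasDerivAt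
  have h1 := hd y (left_mem_Ioo hy)
  have h2 : HasDerivAt (fun y => w (2 * y)) (2 * deriv w (2 * y)) y := by
    have h := (hd _ (two_mul_mem_Ioo hy)).comp y ((hasDerivAt_id y).const_mul 2)
    simpa [Function.comp_def, mul_comm] using h
  exact (((h1.sub h2).exp.const_mul 2).const_add 1).fun_inv (by positivity)

/-- The exponential factors absorb the cubic growth of `w'`. For `y ≤ 1 / 4` the ratio is large: `2
E / (1 + 2 E)² ≤ 1 / (2 E) ≤ exp (-w / 8) / 2`, and half of that exponent absorbs `w³`. For `y ≥ 1 /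
4` one has `w y ≤ 6`, and `exp (-w (2 * y))` absorbs `w (2 * y)³`. The bound is expressed by `exp
(-w / 16)`, a constant times the density to the power `1 / 16`. -/
lemma abs_deriv_inv_ratio_le (hw : IsFlatWeight w) {y : ℝ} (hy : y ∈ Ioo (0 : ℝ) (1 / 2)) :
    |-(2 * (Real.exp (w y - w (2 * y)) * (deriv w y - 2 * deriv w (2 * y)))) /
        (1 + 2 * Real.exp (w y - w (2 * y))) ^ 2| ≤
      (36864 + 456 * Real.exp 7) * Real.exp (-w y / 16) := by
  set E := Real.exp (w y - w (2 * y)) with hE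
  have hE0 : 0 < E := Real.exp_pos _
  have w1 := hw.one_le y (left_mem_Ioo hy)
  have w2 := hw.one_le _ (two_mul_mem_Ioo hy)
  have hd : |deriv w y - 2 * deriv w (2 * y)| ≤ w y ^ 3 + 2 * w (2 * y) ^ 3 := by
    refine (abs_sub _ _).trans (add_le_add (hw.deriv_le y (left_mem_Ioo hy)) ?_)
    rw [abs_mul, abs_two]
    exact mul_le_mul_of_nonneg_left (hw.deriv_le _ (two_mul_mem_Ioo hy)) two_pos.le
  have h0 : |-(2 * (E * (deriv w y - 2 * deriv w (2 * y)))) / (1 + 2 * E) ^ 2| ≤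
      2 * E / (1 + 2 * E) ^ 2 * (w y ^ 3 + 2 * w (2 * y) ^ 3) := by
    rw [abs_div, abs_neg, abs_mul, abs_mul, abs_two, abs_of_pos hE0,
      abs_of_pos (by positivity : 0 < (1 + 2 * E) ^ 2), div_mul_eq_mul_div, mul_assoc]
    gcongr
  refine h0.trans ?_
  have hexp16 := Real.exp_pos (-w y / 16)
  rcases le_total y (1 / 4) with hy4 | hy4
  · have hdb := hw.double y ⟨hy.1, hy4⟩
    have h1 : 2 * E / (1 + 2 * E) ^ 2 ≤ 1 / 2 * Real.exp (-w y / 8) := by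
      have h2 : Real.exp (w y / 8) ≤ E := Real.exp_le_exp.2 (by linarith)
      have h3 : 2 * E / (1 + 2 * E) ^ 2 ≤ 1 / 2 * E⁻¹ := by
        rw [div_le_iff₀ (by positivity)]
        have : 1 / 2 * E⁻¹ * (1 + 2 * E) ^ 2 = 1 / 2 * E⁻¹ + 2 + 2 * E := by field_simp; ring
        rw [this]
        have := inv_pos.2 hE0
        linarith
      refine h3.trans (mul_le_mul_of_nonneg_left ?_ (by norm_num))
      rw [neg_div, Real.exp_neg]
      exact inv_anti₀ (Real.exp_pos _) h2
    have h4 : w (2 * y) ^ 3 ≤ w y ^ 3 := pow_le_pow_left₀ (by linarith) (by linarith) 3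
    have h5 := pow_three_mul_exp_neg_le (x := w y / 16) (by linarith)
    have h6 : Real.exp (-w y / 8) = Real.exp (-(w y / 16)) * Real.exp (-w y / 16) := by
      rw [← Real.exp_add]; ring_nf
    calc 2 * E / (1 + 2 * E) ^ 2 * (w y ^ 3 + 2 * w (2 * y) ^ 3)
        ≤ 1 / 2 * Real.exp (-w y / 8) * (3 * w y ^ 3) := by
          gcongr
          linarith
      -- `6144 = (3 / 2) * 16 ^ 3`.
      _ = 6144 * ((w y / 16) ^ 3 * Real.exp (-(w y / 16))) * Real.exp (-w y / 16) := by
          rw [h6]; ring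
      _ ≤ 6144 * 6 * Real.exp (-w y / 16) := by gcongr
      _ ≤ _ := by
          have := Real.exp_pos 7
          gcongr
          linarith
  · have h6 := hw.le_six y ⟨hy4, hy.2.le⟩
    have h1 : 2 * E / (1 + 2 * E) ^ 2 ≤ 2 * (Real.exp 6 * Real.exp (-w (2 * y))) := by
      have h2 : E ≤ Real.exp 6 * Real.exp (-w (2 * y)) := by
        rw [← Real.exp_add]
        exact Real.exp_le_exp.2 (by linarith)
      refine (div_le_self (by positivity) ?_).trans (by linarith)
      nlinarith
    have h2 := pow_three_mul_exp_neg_le (x := w (2 * y)) (by linarith)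
    have h3 : w y ^ 3 ≤ 6 ^ 3 := pow_le_pow_left₀ (by linarith) h6 3
    have h4 : Real.exp (-w (2 * y)) ≤ 1 := Real.exp_le_one_iff.2 (by linarith)
    have h5 : 1 ≤ Real.exp 1 * Real.exp (-w y / 16) := by
      rw [← Real.exp_add]
      exact Real.one_le_exp (by linarith)
    have h7 : Real.exp 7 = Real.exp 6 * Real.exp 1 := by rw [← Real.exp_add]; norm_num
    calc 2 * E / (1 + 2 * E) ^ 2 * (w y ^ 3 + 2 * w (2 * y) ^ 3)
        ≤ 2 * (Real.exp 6 * Real.exp (-w (2 * y))) * (6 ^ 3 + 2 * w (2 * y) ^ 3) := by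
          gcongr
      _ = 2 * Real.exp 6 * (216 * Real.exp (-w (2 * y)) +
            2 * (w (2 * y) ^ 3 * Real.exp (-w (2 * y)))) := by ring
      _ ≤ 2 * Real.exp 6 * (216 * 1 + 2 * 6) := by gcongr
      _ = 456 * Real.exp 6 * 1 := by ring
      _ ≤ 456 * Real.exp 6 * (Real.exp 1 * Real.exp (-w y / 16)) := by gcongr
      _ = 456 * Real.exp 7 * Real.exp (-w y / 16) := by rw [h7]; ring
      _ ≤ _ := by
          gcongr
          linarith

/-- The criterion asks for `|W'| ≤ K φ ^ (ε - 1) ρ` with `ε = 1 / 16`. Since `φ ≤ ρ` and the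
exponent is negative, `φ ^ (ε - 1) ρ ≥ ρ ^ ε`, which is a multiple of `exp (-w / 16)`. -/
lemma exists_holder (hw : IsFlatWeight w) :
    ∃ C > 0, ∀ z ∈ Ioo (0 : ℝ) (1 / 2), ∀ v ∈ Ioo (0 : ℝ) (1 / 2),
      |(1 + 2 * Real.exp (w z - w (2 * z)))⁻¹ - (1 + 2 * Real.exp (w v - w (2 * v)))⁻¹| ≤
        C * |flatPrimitive w z - flatPrimitive w v| ^ (1 / 16 : ℝ) := by
  have c := hw.isSmoothReparam
  have hM := hw.flatMass_pos
  set K := (36864 + 456 * Real.exp 7) * flatMass w ^ (1 / 16 : ℝ) with hK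
  have hK0 : 0 < K := by positivity
  refine ⟨K / (1 / 16), by positivity, ?_⟩
  refine holder_of_deriv_le (by norm_num) (by norm_num) hK0.le
    (fun y hy => hw.hasDerivAt_inv_ratio hy) (fun y hy => c.hasDerivAt y (left_mem_Ioo hy))
    (fun y hy => (c.apply_mem_Ioo (left_mem_Ioo hy)).1) (fun y _ => hw.flatDensity_pos y)
    fun y hy => (hw.abs_deriv_inv_ratio_le hy).trans ?_
  have hφ := (c.apply_mem_Ioo (left_mem_Ioo hy)).1
  have hρ := hw.flatDensity_pos y
  rw [hK, mul_assoc]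
  refine mul_le_mul_of_nonneg_left ?_ (by positivity)
  have h1 : flatDensity w y ^ (1 / 16 : ℝ) ≤
      flatPrimitive w y ^ (1 / 16 - 1 : ℝ) * flatDensity w y := by
    calc flatDensity w y ^ (1 / 16 : ℝ)
        = flatDensity w y ^ (1 / 16 - 1 : ℝ) * flatDensity w y := by
          rw [← Real.rpow_add_one hρ.ne']; norm_num
      _ ≤ _ := mul_le_mul_of_nonneg_right
          (Real.rpow_le_rpow_of_nonpos hφ (hw.flatPrimitive_le hy) (by norm_num)) hρ.le
  have h2 : flatMass w ^ (1 / 16 : ℝ) * flatDensity w y ^ (1 / 16 : ℝ) =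
      Real.exp (-w y / 16) := by
    rw [← Real.mul_rpow hM.le hρ.le, flatDensity, mul_div_cancel₀ _ hM.ne', ← Real.exp_mul]
    ring_nf
  rw [← h2]
  exact mul_le_mul_of_nonneg_left h1 (by positivity)

variable {H : Icc (0 : ℝ) 1 ≃ₜ Icc (0 : ℝ) 1}

lemma tendsto_one_sub_half : Tendsto (fun y : ℝ => 1 - y) (𝓝[>] (1 / 2)) (𝓝[<] (1 / 2)) := by
  refine tendsto_nhdsWithin_iff.2 ⟨?_, ?_⟩
  · have : Tendsto (fun y : ℝ => 1 - y) (𝓝 (1 / 2)) (𝓝 (1 - 1 / 2)) :=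
      Continuous.tendsto (by fun_prop) _
    rw [show (1 - 1 / 2 : ℝ) = 1 / 2 by norm_num] at this
    exact this.mono_left nhdsWithin_le_nhds
  · filter_upwards [self_mem_nhdsWithin] with y hy
    have : 1 / 2 < y := hy
    exact mem_Iio.2 (by linarith)

lemma tendsto_one_sub_one : Tendsto (fun y : ℝ => 1 - y) (𝓝[<] 1) (𝓝[>] 0) := by
  refine tendsto_nhdsWithin_iff.2 ⟨?_, ?_⟩
  · have : Tendsto (fun y : ℝ => 1 - y) (𝓝 1) (𝓝 (1 - 1)) :=
      Continuous.tendsto (by fun_prop) _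
    rw [sub_self] at this
    exact this.mono_left nhdsWithin_le_nhds
  · filter_upwards [self_mem_nhdsWithin] with y hy
    have : y < 1 := hy
    exact mem_Ioi.2 (by linarith)

lemma isCuspBranch_left (hw : IsFlatWeight w) (hH : ∀ y, (H y : ℝ) = flatPrimitive w y) :
    IsCuspBranch (ext (tentConj H)) 0 (flatPrimitive w (1 / 2)) (1 / 16) := by
  obtain ⟨C, hC, h⟩ := hw.exists_holder
  refine hw.isSmoothReparam.isCuspBranch_left hH ?_ ?_ hC ?_
  · simp only [hw.ratio_eq]
    exact Or.inr (Or.inl hw.tendsto_ratio_zero)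
  · simp only [hw.ratio_eq]
    exact Or.inl hw.tendsto_ratio_half
  · simpa only [hw.ratio_eq] using h

lemma isCuspBranch_right (hw : IsFlatWeight w) (hH : ∀ y, (H y : ℝ) = flatPrimitive w y) :
    IsCuspBranch (ext (tentConj H)) (flatPrimitive w (1 / 2)) 1 (1 / 16) := by
  obtain ⟨C, hC, h⟩ := hw.exists_holder
  refine hw.isSmoothReparam.isCuspBranch_right
    (fun z hz => ext_tentConj_right hH (Ioo_subset_Icc_self hz)) ?_ ?_ hC ?_
  · simp only [neg_div, hw.ratio_eq_right]
    left
    rw [← neg_zero]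
    exact (hw.tendsto_ratio_half.comp tendsto_one_sub_half).neg
  · simp only [neg_div, hw.ratio_eq_right]
    right; right
    exact tendsto_neg_atTop_atBot.comp (hw.tendsto_ratio_zero.comp tendsto_one_sub_one)
  · intro z hz v hv
    have hmem : ∀ {y : ℝ}, y ∈ Ioo (1 / 2 : ℝ) 1 → 1 - y ∈ Ioo (0 : ℝ) (1 / 2) := fun hy =>
      ⟨by linarith [hy.2], by linarith [hy.1]⟩
    have h1 := h _ (hmem hz) _ (hmem hv)
    rw [hw.flatPrimitive_symm (Ioo_subset_Icc_self (right_mem_Ioo hz)),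
      hw.flatPrimitive_symm (Ioo_subset_Icc_self (right_mem_Ioo hv)), sub_sub_sub_cancel_left,
      abs_sub_comm (flatPrimitive w v)] at h1
    rw [hw.ratio_eq_right, hw.ratio_eq_right]
    exact h1

theorem tcSmooth (hw : IsFlatWeight w) (hH : ∀ y, (H y : ℝ) = flatPrimitive w y) :
    TCSmooth (tentConj H) H.symm :=
  tcSmooth_of_reparam hw.isSmoothReparam hH ⟨0, 1, ext (tentConj H), le_rfl, le_rfl,
    isCuspMap_of_branches (by norm_num) (continuousOn_ext (continuous_tentConj H))
      (mapsTo_ext _) (hw.isCuspBranch_left hH) (hw.isCuspBranch_right hH), ext_apply _⟩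

theorem hasPolesAtBoundary (hw : IsFlatWeight w) (hH : ∀ y, (H y : ℝ) = flatPrimitive w y) :
    HasPolesAtBoundary (tentConj H) := by
  have c := hw.isSmoothReparam
  have hhalf := c.apply_mem_Ioo (y := 1 / 2) (by norm_num)
  refine ⟨⟨flatPrimitive w (1 / 2), hhalf.1, ?_, ?_, ?_⟩,
    ⟨1 - flatPrimitive w (1 / 2), by linarith [hhalf.2], ?_, ?_, ?_⟩⟩
  · rw [zero_add]
    exact fun x hx => ⟨hx.1.le, (hx.2.trans hhalf.2).le⟩
  · rw [zero_add]
    exact (hw.isCuspBranch_left hH).contDiffOn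
  · have h := nhdsGT_le_map zero_lt_one c.cont c.strictMonoOn
    rw [c.zero] at h
    refine Tendsto.mono_left (tendsto_map'_iff.2 (hw.tendsto_ratio_zero.congr' ?_)) h
    filter_upwards [Ioo_mem_nhdsGT (by norm_num : (0 : ℝ) < 1 / 2)] with y hy
    rw [Function.comp_apply, c.deriv_ext_left hH hy, hw.ratio_eq, abs_of_pos (by positivity)]
  · rw [sub_sub_cancel]
    exact fun x hx => ⟨(hhalf.1.trans hx.1).le, hx.2.le⟩
  · rw [sub_sub_cancel]
    exact (hw.isCuspBranch_right hH).contDiffOn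
  · have h := nhdsLT_le_map zero_lt_one c.cont c.strictMonoOn
    rw [c.one] at h
    refine Tendsto.mono_left (tendsto_map'_iff.2
      ((hw.tendsto_ratio_zero.comp tendsto_one_sub_one).congr' ?_)) h
    filter_upwards [Ioo_mem_nhdsLT (by norm_num : (1 / 2 : ℝ) < 1)] with y hy
    rw [Function.comp_apply, Function.comp_apply, c.deriv_ext_right hH hy, neg_div, abs_neg,
      hw.ratio_eq_right, abs_of_pos (by positivity)]

end IsFlatWeight

end FlatWeights

/-! ### Poles at the boundary, and an exponent that does not exist -/

section ExamplesFlat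

/-- The weight `1 / (y (1 - y))`. -/
def invWeight (y : ℝ) : ℝ := (y * (1 - y))⁻¹

lemma mul_one_sub_pos {y : ℝ} (hy : y ∈ Ioo (0 : ℝ) 1) : 0 < y * (1 - y) :=
  mul_pos hy.1 (sub_pos.2 hy.2)

lemma one_le_invWeight {y : ℝ} (hy : y ∈ Ioo (0 : ℝ) 1) : 4 ≤ invWeight y := by
  rw [invWeight, le_inv_comm₀ (by norm_num) (mul_one_sub_pos hy)]
  nlinarith [sq_nonneg (y - 1 / 2)]

lemma hasDerivAt_invWeight {y : ℝ} (hy : y ∈ Ioo (0 : ℝ) 1) :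
    HasDerivAt invWeight (-(1 - 2 * y) * invWeight y ^ 2) y := by
  have h := ((hasDerivAt_id y).mul ((hasDerivAt_id y).const_sub 1)).fun_inv
    (mul_one_sub_pos hy).ne'
  refine h.congr_deriv ?_
  simp only [invWeight, id, Pi.mul_apply, inv_pow]
  rw [div_eq_mul_inv]
  congr 1
  ring

lemma abs_deriv_invWeight_le {y : ℝ} (hy : y ∈ Ioo (0 : ℝ) 1) :
    |deriv invWeight y| ≤ invWeight y ^ 2 := by
  rw [(hasDerivAt_invWeight hy).deriv, abs_mul, abs_neg, abs_of_nonneg (sq_nonneg (invWeight y))]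
  have : |1 - 2 * y| ≤ 1 := abs_le.2 ⟨by linarith [hy.2], by linarith [hy.1]⟩
  nlinarith [sq_nonneg (invWeight y)]

lemma contDiffOn_invWeight : ContDiffOn ℝ ∞ invWeight (Ioo 0 1) :=
  ContDiffOn.inv (by fun_prop) fun _ hy => (mul_one_sub_pos hy).ne'

lemma invWeight_symm (y : ℝ) : invWeight (1 - y) = invWeight y := by
  rw [invWeight, invWeight, sub_sub_cancel, mul_comm]

lemma invWeight_double {y : ℝ} (hy : y ∈ Ioc (0 : ℝ) (1 / 4)) :
    invWeight (2 * y) ≤ 3 / 4 * invWeight y := by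
  have h1 := mul_one_sub_pos (y := y) ⟨hy.1, by linarith [hy.2]⟩
  have h2 := mul_one_sub_pos (y := 2 * y) ⟨by linarith [hy.1], by linarith [hy.2]⟩
  rw [invWeight, invWeight, ← div_eq_mul_inv, inv_eq_one_div, div_le_div_iff₀ h2 h1]
  nlinarith [hy.1, hy.2]

lemma invWeight_le_six {y : ℝ} (hy : y ∈ Icc (1 / 4 : ℝ) (1 / 2)) : invWeight y ≤ 6 := by
  rw [invWeight, inv_le_comm₀ (mul_one_sub_pos ⟨by linarith [hy.1], by linarith [hy.2]⟩)
    (by norm_num)]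
  nlinarith [hy.1, hy.2]

lemma antitoneOn_invWeight : AntitoneOn invWeight (Ioc 0 (1 / 2)) := by
  intro x hx y hy hxy
  refine inv_anti₀ (mul_one_sub_pos ⟨hx.1, by linarith [hx.2]⟩) ?_
  nlinarith [hx.1, hx.2, hy.1, hy.2]

lemma tendsto_invWeight : Tendsto invWeight (𝓝[>] 0) atTop := by
  refine tendsto_inv_nhdsGT_zero.comp (tendsto_nhdsWithin_iff.2 ⟨?_, ?_⟩)
  · have : Tendsto (fun y : ℝ => y * (1 - y)) (𝓝 0) (𝓝 (0 * (1 - 0))) :=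
      Continuous.tendsto (by fun_prop) _
    rw [zero_mul] at this
    exact this.mono_left nhdsWithin_le_nhds
  · filter_upwards [Ioo_mem_nhdsGT (zero_lt_one' ℝ)] with y hy using mul_one_sub_pos hy

lemma isFlatWeight_invWeight : IsFlatWeight invWeight where
  smooth := contDiffOn_invWeight
  symm := invWeight_symm
  one_le y hy := by linarith [one_le_invWeight hy]
  deriv_le y hy := (abs_deriv_invWeight_le hy).trans
    (pow_le_pow_right₀ (by linarith [one_le_invWeight hy]) (by norm_num))
  double y hy := by
    have := one_le_invWeight (y := y) ⟨hy.1, by linarith [hy.2]⟩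
    linarith [invWeight_double hy]
  le_six y hy := invWeight_le_six hy
  anti := antitoneOn_invWeight
  lim := tendsto_invWeight

/-- The weight `1 / √(y (1 - y))`. -/
def invSqrtWeight (y : ℝ) : ℝ := √(invWeight y)

lemma hasDerivAt_invSqrtWeight {y : ℝ} (hy : y ∈ Ioo (0 : ℝ) 1) :
    HasDerivAt invSqrtWeight (deriv invWeight y / (2 * invSqrtWeight y)) y := by
  have h := (hasDerivAt_invWeight hy).differentiableAt.hasDerivAt
  exact h.sqrt (by linarith [one_le_invWeight hy])

/-- With `w² = v` and `|v'| ≤ v²` one gets `|w'| ≤ w⁴ / (2 w) ≤ w³`. The factor `7 / 8` in the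
doubling condition leaves room for `√(3 / 4)`. -/
lemma isFlatWeight_invSqrtWeight : IsFlatWeight invSqrtWeight where
  smooth := contDiffOn_invWeight.sqrt fun y hy => by linarith [one_le_invWeight hy]
  symm y := by rw [invSqrtWeight, invWeight_symm, invSqrtWeight]
  one_le y hy := Real.one_le_sqrt.2 (by linarith [one_le_invWeight hy])
  deriv_le y hy := by
    have h4 := one_le_invWeight hy
    have h1 : 1 ≤ invSqrtWeight y := Real.one_le_sqrt.2 (by linarith)
    have h2 : invSqrtWeight y ^ 2 = invWeight y := Real.sq_sqrt (by linarith)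
    have h0 : 0 < 2 * invSqrtWeight y := by linarith
    rw [(hasDerivAt_invSqrtWeight hy).deriv, abs_div, abs_of_pos h0, div_le_iff₀ h0]
    refine (abs_deriv_invWeight_le hy).trans ?_
    rw [← h2]
    nlinarith [pow_pos (zero_lt_one.trans_le h1) 4]
  double y hy := by
    have h4 := one_le_invWeight (y := y) ⟨hy.1, by linarith [hy.2]⟩
    unfold invSqrtWeight
    rw [Real.sqrt_le_left (by positivity), mul_pow, Real.sq_sqrt (by linarith)]
    linarith [invWeight_double hy]
  le_six y hy := by
    rw [invSqrtWeight, Real.sqrt_le_left (by norm_num)]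
    linarith [invWeight_le_six hy]
  anti _ hx _ hy hxy := Real.sqrt_le_sqrt (antitoneOn_invWeight hx hy hxy)
  lim := Real.tendsto_sqrt_atTop.comp tendsto_invWeight

lemma measurable_invWeight : Measurable invWeight := by unfold invWeight; fun_prop

/-- `1 / (y (1 - y)) = 1 / y + 1 / (1 - y)`, whose square root is at most `y ^ (-1 / 2) + (1 - y) ^
(-1 / 2)`. -/
lemma integrableOn_invSqrtWeight : IntegrableOn invSqrtWeight (Icc 0 1) := by
  have h1 : IntervalIntegrable (fun y : ℝ => y ^ (-1 / 2 : ℝ)) volume 0 1 :=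
    intervalIntegral.intervalIntegrable_rpow' (by norm_num)
  have h2 : IntervalIntegrable (fun y : ℝ => (1 - y) ^ (-1 / 2 : ℝ)) volume 0 1 := by
    have := (h1.comp_sub_left 1).symm
    simpa using this
  have h3 := (h1.add h2)
  rw [intervalIntegrable_iff_integrableOn_Ioo_of_le zero_le_one] at h3
  rw [integrableOn_Icc_iff_integrableOn_Ioo]
  refine Integrable.mono' h3 (measurable_invWeight.sqrt.aestronglyMeasurable) ?_
  refine (ae_restrict_iff' measurableSet_Ioo).2 (ae_of_all _ fun y hy => ?_)
  have hy0 := hy.1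
  have hy1 : 0 < 1 - y := sub_pos.2 hy.2
  rw [invSqrtWeight, Real.norm_of_nonneg (Real.sqrt_nonneg _), Real.sqrt_le_left (by positivity)]
  have e : ∀ t : ℝ, 0 < t → (t ^ (-1 / 2 : ℝ)) ^ 2 = t⁻¹ := fun t ht => by
    rw [← Real.rpow_natCast, ← Real.rpow_mul ht.le]
    norm_num [Real.rpow_neg_one]
  have e1 := e y hy0
  have e2 := e (1 - y) hy1
  have e3 : invWeight y = y⁻¹ + (1 - y)⁻¹ := by
    rw [invWeight]; field_simp; ring
  have e4 : 0 ≤ y ^ (-1 / 2 : ℝ) * (1 - y) ^ (-1 / 2 : ℝ) := by positivity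
  nlinarith

/-- A map with poles at the boundary whose Lyapunov exponent is `log 2`. -/
theorem exists_poles_log_two :
    ∃ (f : Icc (0 : ℝ) 1 → Icc (0 : ℝ) 1) (h : Icc (0 : ℝ) 1 ≃ₜ Icc (0 : ℝ) 1),
      TCSmooth f h ∧ HasPolesAtBoundary f ∧
        HasLyapunovExponent f (muOf h) ((Real.log 2 : ℝ) : EReal) := by
  have hw := isFlatWeight_invSqrtWeight
  have c := hw.isSmoothReparam
  obtain ⟨H, hH⟩ := c.exists_homeomorph
  refine ⟨tentConj H, H.symm, hw.tcSmooth hH, hw.hasPolesAtBoundary hH,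
    hasLyapunovExponent_log_two (ρ := flatDensity invSqrtWeight) c.pos ?_
      fun y hy hy' => c.abs_derivWithin_ext hH hy hy'⟩
  have h : (fun y => Real.log (flatDensity invSqrtWeight y)) =
      fun y => -invSqrtWeight y - Real.log (flatMass invSqrtWeight) := by
    ext y
    rw [flatDensity, Real.log_div (Real.exp_pos _).ne' hw.flatMass_pos.ne', Real.log_exp]
  rw [h]
  exact integrableOn_invSqrtWeight.neg.sub (integrableOn_const (by simp))

lemma lintegral_inv_eq_top {a b c K : ℝ} (hab : a < b) (hc : c ∈ Icc a b) (hK : 0 < K) :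
    ∫⁻ x in Ioo a b, ENNReal.ofReal (K * |x - c|⁻¹) = ⊤ := by
  by_contra hne
  have hmeas : Measurable fun x : ℝ => (x - c)⁻¹ := by fun_prop
  have hint : IntervalIntegrable (fun x => (x - c)⁻¹) volume a b := by
    rw [intervalIntegrable_iff_integrableOn_Ioo_of_le hab.le]
    refine ⟨hmeas.aestronglyMeasurable, ?_⟩
    have h1 : ∀ x, ENNReal.ofReal (K * |x - c|⁻¹) = ENNReal.ofReal K * ‖(x - c)⁻¹‖ₑ := fun x => by
      rw [ENNReal.ofReal_mul hK.le, ← ofReal_norm, norm_inv, Real.norm_eq_abs]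
    simp only [h1] at hne
    rw [lintegral_const_mul' _ _ ENNReal.ofReal_ne_top] at hne
    rw [HasFiniteIntegral, lt_top_iff_ne_top]
    intro htop
    rw [htop, ENNReal.mul_top (by simpa using hK)] at hne
    exact hne rfl
  rcases intervalIntegrable_sub_inv_iff.1 hint with h | h
  · exact hab.ne h
  · rw [uIcc_of_le hab.le] at h
    exact h hc

lemma lintegral_leb_eq_top {u : ℝ → ℝ≥0∞} {a b c K : ℝ} (ha : 0 ≤ a) (hb : b ≤ 1) (hab : a < b)
    (hc : c ∈ Icc a b) (hK : 0 < K)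
    (h : ∀ y ∈ Ioo a b, ENNReal.ofReal (K * |y - c|⁻¹) ≤ u y) :
    ∫⁻ y, u y ∂(leb 0 1) = ⊤ := by
  rw [lintegral_leb, eq_top_iff, ← lintegral_inv_eq_top hab hc hK]
  refine (setLIntegral_mono' measurableSet_Ioo h).trans (lintegral_mono_set ?_)
  exact fun x hx => ⟨ha.trans hx.1.le, hx.2.le.trans hb⟩

/-- A map for which the Lyapunov exponent does not exist. -/
theorem exists_no_lyapunov :
    ∃ (f : Icc (0 : ℝ) 1 → Icc (0 : ℝ) 1) (h : Icc (0 : ℝ) 1 ≃ₜ Icc (0 : ℝ) 1),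
      TCSmooth f h ∧ ¬ ∃ χ : EReal, HasLyapunovExponent f (muOf h) χ := by
  have hw := isFlatWeight_invWeight
  have c := hw.isSmoothReparam
  obtain ⟨H, hH⟩ := c.exists_homeomorph
  refine ⟨tentConj H, H.symm, hw.tcSmooth hH, ?_⟩
  set ρ := flatDensity invWeight with hρ
  set R : ℝ → ℝ := fun y => 2 * ρ (min (2 * y) (2 - 2 * y)) / ρ y with hR
  have hRae : ∀ᵐ y : Icc (0 : ℝ) 1 ∂(leb 0 1),
      |derivWithin (ext (tentConj H)) (Icc 0 1) (H y)| = R y ∧ 0 < R y := by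
    filter_upwards [ae_leb_mem_Ioo] with y hy
    have h := c.abs_derivWithin_ext hH hy.1 hy.2
    rw [tent_eq_min] at h
    have h1 := hw.flatDensity_pos (y : ℝ)
    have h2 := hw.flatDensity_pos (min (2 * (y : ℝ)) (2 - 2 * y))
    exact ⟨h, by positivity⟩
  have hlog : ∀ y ∈ Ioo (0 : ℝ) (1 / 2),
      Real.log (R y) = Real.log 2 + (invWeight y - invWeight (2 * y)) := by
    intro y hy
    have h : R y = 2 * Real.exp (invWeight y - invWeight (2 * y)) := by
      rw [← hw.ratio_eq]
      simp only [hR]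
      rw [min_eq_left (by linarith [hy.2])]
    rw [h, Real.log_mul two_ne_zero (Real.exp_pos _).ne', Real.log_exp]
  have hlog2 := Real.log_pos one_lt_two
  have hlog2' := Real.log_two_lt_d9
  -- Near `0`, `log |Df| ≥ w(y) / 8 ≥ 1 / (8 y)`.
  have hpos : lyapunovPos (tentConj H) (muOf H.symm) = ⊤ := by
    rw [lyapunovPos_eq hRae]
    refine lintegral_leb_eq_top (u := fun y => ENNReal.ofReal (Real.log (R y))) (a := 0)
      (b := 1 / 4) (c := 0) (K := 1 / 8) le_rfl (by norm_num) (by norm_num) (by norm_num)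
      (by norm_num) fun y hy => ENNReal.ofReal_le_ofReal ?_
    rw [hlog y ⟨hy.1, by linarith [hy.2]⟩, sub_zero, abs_of_pos hy.1]
    have h1 := hw.double y ⟨hy.1, hy.2.le⟩
    have h2 : y⁻¹ ≤ invWeight y :=
      inv_anti₀ (mul_one_sub_pos ⟨hy.1, by linarith [hy.2]⟩) (by nlinarith [hy.1])
    linarith
  -- With `d = 1 / 2 - y`, one has `w(2 y) ≥ 1 / (2 d)` and `w(y) ≤ 6`. On `(15 / 32, 1 / 2)`, `1 /
  -- d ≥ 32`, so half of `1 / (2 d)` is at least `8` and pays for `6 + log 2`; the other half, `1 /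
  -- (4 d)`, is not integrable.
  have hneg : lyapunovNeg (tentConj H) (muOf H.symm) = ⊤ := by
    rw [lyapunovNeg_eq hRae]
    refine lintegral_leb_eq_top (u := fun y => ENNReal.ofReal (-Real.log (R y))) (a := 15 / 32)
      (b := 1 / 2) (c := 1 / 2) (K := 1 / 4) (by norm_num) (by norm_num) (by norm_num)
      (by norm_num) (by norm_num) fun y hy => ENNReal.ofReal_le_ofReal ?_
    rw [hlog y ⟨by linarith [hy.1], hy.2⟩, abs_of_neg (by linarith [hy.2])]
    have h1 := hw.le_six y ⟨by linarith [hy.1], hy.2.le⟩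
    have hd : 0 < -(y - 1 / 2) := by linarith [hy.2]
    have h2 : 1 / 2 * (-(y - 1 / 2))⁻¹ ≤ invWeight (2 * y) := by
      rw [invWeight, ← one_div, ← one_div, div_mul_div_comm, one_mul]
      refine div_le_div_of_nonneg_left (by norm_num) ?_ ?_
      · exact mul_one_sub_pos ⟨by linarith [hy.1], by linarith [hy.2]⟩
      · nlinarith [hy.1, hy.2]
    have h3 : 32 ≤ (-(y - 1 / 2))⁻¹ := by
      rw [le_inv_comm₀ (by norm_num) hd]
      norm_num
      linarith [hy.1]
    linarith
  rintro ⟨χ, h, -⟩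
  rcases h with h | h
  exacts [h hpos, h hneg]

end ExamplesFlat

/-! ### The parabolic example: its rational left branch -/

section Parabolic

/-- The left branch of the parabolic example is `P z ↦ Q z`; this is `P`. -/
def parabolicP (z : ℝ) : ℝ := z * (z + 1) / (z ^ 2 + z + 1)

/-- The left branch of the parabolic example is `P z ↦ Q z`; this is `Q`. -/
def parabolicQ (z : ℝ) : ℝ := z / (1 - z + z ^ 2)

/-- The inverse of `parabolicP` on `[-1 / 2, 1]`. -/
def parabolicPInv (x : ℝ) : ℝ := (√((1 + 3 * x) / (1 - x)) - 1) / 2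

lemma denomP_pos (z : ℝ) : 0 < z ^ 2 + z + 1 := by nlinarith [sq_nonneg (z + 1 / 2)]

lemma denomQ_pos (z : ℝ) : 0 < 1 - z + z ^ 2 := by nlinarith [sq_nonneg (z - 1 / 2)]

lemma hasDerivAt_parabolicP (z : ℝ) :
    HasDerivAt parabolicP ((2 * z + 1) / (z ^ 2 + z + 1) ^ 2) z := by
  have h := ((hasDerivAt_id z).mul ((hasDerivAt_id z).add_const 1)).div
    (((hasDerivAt_pow 2 z).add (hasDerivAt_id z)).add_const 1) (denomP_pos z).ne'
  refine h.congr_deriv ?_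
  congr 1
  simp
  ring

lemma hasDerivAt_parabolicQ (z : ℝ) :
    HasDerivAt parabolicQ ((1 - z ^ 2) / (1 - z + z ^ 2) ^ 2) z := by
  have h := (hasDerivAt_id z).div
    (((hasDerivAt_id z).const_sub 1).add (hasDerivAt_pow 2 z)) (denomQ_pos z).ne'
  refine h.congr_deriv ?_
  congr 1
  simp
  ring

lemma contDiff_parabolicP {n : ℕ∞ω} : ContDiff ℝ n parabolicP :=
  ContDiff.div (by fun_prop) (by fun_prop) fun z => (denomP_pos z).ne'

lemma contDiff_parabolicQ {n : ℕ∞ω} : ContDiff ℝ n parabolicQ :=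
  ContDiff.div (by fun_prop) (by fun_prop) fun z => (denomQ_pos z).ne'

lemma parabolicPInv_parabolicP {z : ℝ} (hz : -1 / 2 ≤ z) : parabolicPInv (parabolicP z) = z := by
  have hD := denomP_pos z
  have h1 : 1 - parabolicP z = 1 / (z ^ 2 + z + 1) := by
    rw [parabolicP, eq_div_iff hD.ne', sub_mul, div_mul_cancel₀ _ hD.ne']; ring
  have h2 : 1 + 3 * parabolicP z = (2 * z + 1) ^ 2 / (z ^ 2 + z + 1) := by
    rw [parabolicP, eq_div_iff hD.ne', add_mul, mul_assoc, div_mul_cancel₀ _ hD.ne']; ring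
  rw [parabolicPInv, h1, h2, div_div_div_cancel_right₀ hD.ne', div_one,
    Real.sqrt_sq (by linarith)]
  ring

lemma exists_parabolicP_eq {x : ℝ} (hx : x ∈ Icc (-1 / 3 : ℝ) (2 / 3)) :
    ∃ z ∈ Icc (-1 / 2 : ℝ) 1, parabolicP z = x := by
  refine intermediate_value_Icc (by norm_num)
    (contDiff_parabolicP (n := 0)).continuous.continuousOn ?_
  have h1 : parabolicP (-1 / 2) = -1 / 3 := by norm_num [parabolicP]
  have h2 : parabolicP 1 = 2 / 3 := by norm_num [parabolicP]
  rwa [h1, h2]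

/-- The difference factors as `(w - z) (w + z + 1)` over denominators at most `3`, and `w + z + 1 ≥
w - z` because `z ≥ -1 / 2`, the critical point of `parabolicP`. -/
lemma parabolicP_quadratic {z w : ℝ} (hz : -1 / 2 ≤ z) (hzw : z < w) (hw : w ≤ 1) :
    1 / 9 * (w - z) ^ 2 ≤ parabolicP w - parabolicP z := by
  have h1 := denomP_pos z
  have h2 := denomP_pos w
  have e : parabolicP w - parabolicP z =
      (w - z) * (w + z + 1) / ((w ^ 2 + w + 1) * (z ^ 2 + z + 1)) := by
    rw [parabolicP, parabolicP, div_sub_div _ _ h2.ne' h1.ne']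
    congr 1
    ring
  rw [e, le_div_iff₀ (by positivity)]
  have h3 : z ^ 2 + z + 1 ≤ 3 := by nlinarith
  have h4 : w ^ 2 + w + 1 ≤ 3 := by nlinarith
  have h5 : (w ^ 2 + w + 1) * (z ^ 2 + z + 1) ≤ 3 * 3 := mul_le_mul h4 h3 h1.le (by norm_num)
  have h6 : (w - z) * (w - z) ≤ (w - z) * (w + z + 1) :=
    mul_le_mul_of_nonneg_left (by linarith) (by linarith)
  nlinarith [sq_nonneg (w - z)]

lemma parabolicQ_mem {z : ℝ} : parabolicQ z ∈ Icc (-1 / 3 : ℝ) 1 := by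
  have h := denomQ_pos z
  rw [parabolicQ]
  refine ⟨?_, ?_⟩
  · rw [le_div_iff₀ h]
    nlinarith [sq_nonneg (z + 1)]
  · rw [div_le_one h]
    nlinarith [sq_nonneg (z - 1)]

/-- As a function of `z`, `(1 + |Df|)⁻¹` is the rational function `N / (N + M)`, whose denominator
is positive on the compact parameter interval. Its derivative is therefore bounded, and the
quadratic lower bound for `parabolicP` turns this into exponent `1 / 2`. -/
lemma exists_holder_parabolic_left : ∃ C > 0, ∀ z ∈ Ioo (-1 / 2 : ℝ) 1, ∀ w ∈ Ioo (-1 / 2 : ℝ) 1,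
    |(1 + |(1 - z ^ 2) / (1 - z + z ^ 2) ^ 2 / ((2 * z + 1) / (z ^ 2 + z + 1) ^ 2)|)⁻¹ -
      (1 + |(1 - w ^ 2) / (1 - w + w ^ 2) ^ 2 / ((2 * w + 1) / (w ^ 2 + w + 1) ^ 2)|)⁻¹| ≤
      C * |parabolicP z - parabolicP w| ^ (1 / 2 : ℝ) := by
  set N : ℝ → ℝ := fun z => (1 - z + z ^ 2) ^ 2 * (2 * z + 1) with hN
  set M : ℝ → ℝ := fun z => (1 - z ^ 2) * (z ^ 2 + z + 1) ^ 2 with hM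
  set W : ℝ → ℝ := fun z => N z / (N z + M z) with hW
  set U : Set ℝ := {z | N z + M z ≠ 0} with hU
  have hUo : IsOpen U := isOpen_ne_fun (by fun_prop) continuous_const
  have hpos : ∀ z ∈ Icc (-1 / 2 : ℝ) 1, 0 < N z + M z := by
    intro z hz
    have h1 := denomP_pos z
    have h2 := denomQ_pos z
    rcases hz.1.eq_or_lt with rfl | h
    · norm_num [hN, hM]
    · have h3 : 0 < N z := mul_pos (by positivity) (by linarith)
      have h4 : 0 ≤ M z := mul_nonneg (by nlinarith [hz.2]) (by positivity)
      linarith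
  have hcd : ContDiffOn ℝ 1 W U := ContDiffOn.div (by fun_prop) (by fun_prop) fun z hz => hz
  obtain ⟨C, hC⟩ := isCompact_Icc.exists_bound_of_continuousOn
    ((hcd.continuousOn_deriv_of_isOpen hUo le_rfl).mono fun z hz => (hpos z hz).ne')
  have hC0 : 0 ≤ C := (norm_nonneg _).trans (hC 0 (by norm_num))
  refine ⟨C / √(1 / 9) + 1, by positivity, fun z hz w hw => ?_⟩
  have heq : ∀ z ∈ Ioo (-1 / 2 : ℝ) 1,
      (1 + |(1 - z ^ 2) / (1 - z + z ^ 2) ^ 2 / ((2 * z + 1) / (z ^ 2 + z + 1) ^ 2)|)⁻¹ = W z := by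
    intro z hz
    have h1 := denomP_pos z
    have h2 := denomQ_pos z
    have h3 : 0 < 2 * z + 1 := by linarith [hz.1]
    have h4 : 0 < 1 - z ^ 2 := by nlinarith [hz.1, hz.2]
    have h5 : ∀ {A B c m : ℝ}, 0 < A → 0 < B → 0 < c → 0 < m →
        (1 + m / A ^ 2 / (c / B ^ 2))⁻¹ = A ^ 2 * c / (A ^ 2 * c + m * B ^ 2) := by
      intro A B c m hA hB hc hm
      field_simp
    rw [abs_of_pos (by positivity)]
    exact h5 h2 h1 h3 h4
  rw [heq z hz, heq w hw]
  exact holder_half_of_quadratic (W' := deriv W) (by norm_num) hC0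
    (fun z hz => ((hcd.differentiableOn one_ne_zero).differentiableAt
      (hUo.mem_nhds (hpos z (Ioo_subset_Icc_self hz)).ne')).hasDerivAt)
    (fun z hz => hC z (Ioo_subset_Icc_self hz))
    (fun z hz w hw hzw => parabolicP_quadratic hz.1.le hzw hw.2.le) z hz w hw

/-- `-log₂ y`. -/
def lgInv (y : ℝ) : ℝ := -Real.log y / Real.log 2

/-- `(1 + ℓ) / (1 + ℓ + ℓ²)` with `ℓ = -log₂ y`. -/
def parabolicPrimitive (y : ℝ) : ℝ :=
  if y ≤ 0 then 0 else (1 + lgInv y) / (1 + lgInv y + lgInv y ^ 2)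

/-- The derivative of `-(1 + ℓ) / (1 + ℓ + ℓ²)`. -/
def parabolicKernel (l : ℝ) : ℝ := l * (l + 2) / (1 + l + l ^ 2) ^ 2

/-- The derivative of `parabolicPrimitive`. -/
def parabolicDensity (y : ℝ) : ℝ := parabolicKernel (lgInv y) / (y * Real.log 2)

lemma denom_pos (l : ℝ) : 0 < 1 + l + l ^ 2 := by nlinarith [sq_nonneg (l + 1 / 2)]

lemma log_two_bounds : 1 / 2 < Real.log 2 ∧ Real.log 2 < 1 :=
  ⟨by linarith [Real.log_two_gt_d9], by linarith [Real.log_two_lt_d9]⟩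

lemma hasDerivAt_lgInv {y : ℝ} (hy : 0 < y) : HasDerivAt lgInv (-(1 / (y * Real.log 2))) y := by
  have h := (Real.hasDerivAt_log hy.ne').neg.div_const (Real.log 2)
  refine h.congr_deriv ?_
  rw [neg_div, inv_eq_one_div, div_div]

lemma lgInv_pos {y : ℝ} (hy : y ∈ Ioo (0 : ℝ) 1) : 0 < lgInv y :=
  div_pos (neg_pos.2 (Real.log_neg hy.1 hy.2)) (Real.log_pos one_lt_two)

lemma lgInv_two_mul {y : ℝ} (hy : 0 < y) : lgInv (2 * y) = lgInv y - 1 := by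
  have := (Real.log_pos one_lt_two).ne'
  rw [lgInv, lgInv, Real.log_mul two_ne_zero hy.ne']
  field_simp
  ring

lemma parabolicKernel_pos {l : ℝ} (hl : 0 < l) : 0 < parabolicKernel l := by
  have := denom_pos l
  unfold parabolicKernel
  positivity

lemma parabolicDensity_pos {y : ℝ} (hy : y ∈ Ioo (0 : ℝ) 1) : 0 < parabolicDensity y :=
  div_pos (parabolicKernel_pos (lgInv_pos hy)) (mul_pos hy.1 (Real.log_pos one_lt_two))

lemma hasDerivAt_psi (l : ℝ) :
    HasDerivAt (fun l => (1 + l) / (1 + l + l ^ 2)) (-parabolicKernel l) l := by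
  have h := ((hasDerivAt_id l).const_add 1).div
    (((hasDerivAt_id l).const_add 1).add (hasDerivAt_pow 2 l)) (denom_pos l).ne'
  refine h.congr_deriv ?_
  rw [parabolicKernel, ← neg_div]
  congr 1
  simp
  ring

lemma parabolicPrimitive_of_pos {y : ℝ} (hy : 0 < y) :
    parabolicPrimitive y = (1 + lgInv y) / (1 + lgInv y + lgInv y ^ 2) := if_neg hy.not_ge

lemma hasDerivAt_parabolicPrimitive {y : ℝ} (hy : 0 < y) :
    HasDerivAt parabolicPrimitive (parabolicDensity y) y := by
  have h := (hasDerivAt_psi (lgInv y)).comp y (hasDerivAt_lgInv hy)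
  have h2 : HasDerivAt parabolicPrimitive _ y := h.congr_of_eventuallyEq (by
    filter_upwards [lt_mem_nhds hy] with t ht using parabolicPrimitive_of_pos ht)
  refine h2.congr_deriv ?_
  rw [parabolicDensity, neg_mul_neg, mul_one_div]

lemma tendsto_lgInv : Tendsto lgInv (𝓝[>] 0) atTop :=
  (tendsto_neg_atBot_atTop.comp Real.tendsto_log_nhdsGT_zero).atTop_div_const
    (Real.log_pos one_lt_two)

/-- `(1 + ℓ) / (1 + ℓ + ℓ²) ≤ 2 / ℓ`, and `ℓ → ∞` as `y → 0`. -/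
lemma continuousWithinAt_parabolicPrimitive_zero :
    ContinuousWithinAt parabolicPrimitive (Icc 0 1) 0 := by
  have h0 : parabolicPrimitive 0 = 0 := if_pos le_rfl
  have h1 : Tendsto parabolicPrimitive (𝓝[>] 0) (𝓝 0) := by
    have h2 : Tendsto (fun y => 1 / lgInv y) (𝓝[>] 0) (𝓝 0) :=
      tendsto_const_nhds.div_atTop tendsto_lgInv
    have h3 : Tendsto (fun y => 2 * (1 / lgInv y)) (𝓝[>] 0) (𝓝 0) := by
      simpa using h2.const_mul 2
    refine squeeze_zero' ?_ ?_ h3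
    · filter_upwards [Ioo_mem_nhdsGT (zero_lt_one' ℝ)] with y hy
      have := lgInv_pos hy
      rw [parabolicPrimitive_of_pos hy.1]
      positivity
    · filter_upwards [Ioo_mem_nhdsGT (zero_lt_one' ℝ)] with y hy
      have := lgInv_pos hy
      rw [parabolicPrimitive_of_pos hy.1, mul_one_div, div_le_div_iff₀ (by positivity) this]
      nlinarith
  have h2 : ContinuousWithinAt parabolicPrimitive (Ioi 0) 0 := by
    rw [ContinuousWithinAt, h0]
    exact h1
  exact (continuousWithinAt_Ioi_iff_Ici.1 h2).mono Icc_subset_Ici_self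

lemma contDiffOn_parabolicDensity {n : ℕ∞ω} : ContDiffOn ℝ n parabolicDensity (Ioi 0) := by
  have hl : ContDiffOn ℝ n lgInv (Ioi 0) :=
    ((contDiffOn_id.log fun x (hx : 0 < x) => hx.ne').neg).div_const _
  have hK : ContDiff ℝ n parabolicKernel :=
    ContDiff.div (by fun_prop) (by fun_prop) fun l => (pow_pos (denom_pos l) 2).ne'
  exact (hK.comp_contDiffOn hl).div (by fun_prop) fun y (hy : 0 < y) =>
    (mul_pos hy (Real.log_pos one_lt_two)).ne'

lemma isSmoothReparam_parabolic : IsSmoothReparam parabolicPrimitive parabolicDensity where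
  zero := if_pos le_rfl
  one := by simp [parabolicPrimitive, lgInv]
  cont y hy := by
    rcases hy.1.eq_or_lt with rfl | h
    · exact continuousWithinAt_parabolicPrimitive_zero
    · exact (hasDerivAt_parabolicPrimitive h).continuousAt.continuousWithinAt
  hasDerivAt y hy := hasDerivAt_parabolicPrimitive hy.1
  pos y hy := parabolicDensity_pos hy
  smooth := contDiffOn_parabolicDensity.mono fun _ hy => hy.1

lemma lgInv_half : lgInv (1 / 2) = 1 := by
  rw [lgInv, one_div, Real.log_inv, neg_neg, div_self (Real.log_pos one_lt_two).ne']

lemma parabolicPrimitive_half : parabolicPrimitive (1 / 2) = 2 / 3 := by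
  rw [parabolicPrimitive_of_pos (by norm_num), lgInv_half]
  norm_num

/-- The point of `(0, 1 / 2]` with `parabolicPrimitive y = parabolicP z`. -/
lemma exists_parabolicPrimitive_eq {z : ℝ} (hz : z ∈ Ioc (0 : ℝ) 1) :
    ∃ y ∈ Ioc (0 : ℝ) (1 / 2), parabolicPrimitive y = parabolicP z ∧
      parabolicPrimitive (2 * y) = parabolicQ z := by
  have hL := Real.log_pos one_lt_two
  -- Chosen so that `lgInv y = 1 / z`. Doubling `y` gives `1 / z - 1`, and `z ≤ 1` means `y ≤ 1 /
  -- 2`.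
  set y := Real.exp (-(Real.log 2 / z)) with hy
  have hy0 : 0 < y := Real.exp_pos _
  have hl : lgInv y = 1 / z := by
    rw [lgInv, hy, Real.log_exp]
    have := hz.1.ne'
    field_simp
  refine ⟨y, ⟨hy0, ?_⟩, ?_, ?_⟩
  · have h : Real.exp (-Real.log 2) = 1 / 2 := by
      rw [Real.exp_neg, Real.exp_log two_pos, one_div]
    rw [← h, hy]
    refine Real.exp_le_exp.2 (neg_le_neg ?_)
    rw [le_div_iff₀ hz.1]
    nlinarith [hz.2]
  · have h1 := denomP_pos z
    have h2 := denom_pos (1 / z)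
    have := hz.1.ne'
    rw [parabolicPrimitive_of_pos hy0, hl, parabolicP, div_eq_div_iff h2.ne' h1.ne']
    field_simp
  · have h1 := denomQ_pos z
    have h2 := denom_pos (1 / z - 1)
    have := hz.1.ne'
    rw [parabolicPrimitive_of_pos (by positivity), lgInv_two_mul hy0, hl, parabolicQ,
      div_eq_div_iff h2.ne' h1.ne']
    field_simp
    ring

end Parabolic

/-! ### The parabolic example: estimates on the right branch -/

section ParabolicRight

lemma parabolicKernel_le_one {l : ℝ} (hl : 0 ≤ l) : parabolicKernel l ≤ 1 := by
  have := denom_pos l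
  rw [parabolicKernel, div_le_one (by positivity)]
  nlinarith [pow_nonneg hl 2, pow_nonneg hl 3, pow_nonneg hl 4]

lemma exists_hasDerivAt_parabolicKernel {l : ℝ} (hl : 0 ≤ l) :
    ∃ k, HasDerivAt parabolicKernel k l ∧ |k| ≤ 10 := by
  have hD := denom_pos l
  have h1 : HasDerivAt (fun l : ℝ => l * (l + 2)) (2 * l + 2) l :=
    ((hasDerivAt_id l).mul ((hasDerivAt_id l).add_const 2)).congr_deriv (by simp; ring)
  have h2 : HasDerivAt (fun l : ℝ => (1 + l + l ^ 2) ^ 2) (2 * (1 + l + l ^ 2) * (1 + 2 * l)) l :=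
    ((((hasDerivAt_id l).const_add 1).add (hasDerivAt_pow 2 l)).pow 2).congr_deriv (by simp)
  refine ⟨_, h1.div h2 (by positivity), ?_⟩
  rw [abs_div, abs_of_pos (by positivity : 0 < ((1 + l + l ^ 2) ^ 2) ^ 2),
    div_le_iff₀ (by positivity)]
  set D := 1 + l + l ^ 2 with hDdef
  -- Each polynomial factor is at most `2 D`, so the numerator is at most `10 D³ ≤ 10 D⁴`.
  have hD1 : 1 ≤ D := by nlinarith
  have e1 : 2 * l + 2 ≤ 2 * D := by nlinarith
  have e2 : l * (l + 2) ≤ 2 * D := by nlinarith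
  have e3 : 1 + 2 * l ≤ 2 * D := by nlinarith
  have f1 : (2 * l + 2) * D ^ 2 ≤ 2 * D * D ^ 2 := mul_le_mul_of_nonneg_right e1 (by positivity)
  have f2 : l * (l + 2) * (2 * D * (1 + 2 * l)) ≤ 2 * D * (2 * D * (2 * D)) := by
    gcongr
  have f3 : D ^ 3 ≤ D ^ 4 := pow_le_pow_right₀ hD1 (by norm_num)
  refine (abs_sub _ _).trans ?_
  rw [abs_of_nonneg (by positivity), abs_of_nonneg (by positivity)]
  nlinarith

lemma exists_hasDerivAt_parabolicDensity {y : ℝ} (hy : y ∈ Ioo (0 : ℝ) 1) :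
    ∃ k, HasDerivAt parabolicDensity k y ∧ |k| ≤ 44 / y ^ 2 := by
  obtain ⟨hL1, hL2⟩ := log_two_bounds
  have hL : 0 < Real.log 2 := by linarith
  have hy0 := hy.1
  obtain ⟨k, hk, hk10⟩ := exists_hasDerivAt_parabolicKernel (lgInv_pos hy).le
  have hK0 := parabolicKernel_pos (lgInv_pos hy)
  have hK1 := parabolicKernel_le_one (lgInv_pos hy).le
  have h := (hk.comp y (hasDerivAt_lgInv hy0)).div ((hasDerivAt_id y).mul_const (Real.log 2))
    (mul_pos hy0 hL).ne'
  refine ⟨-(k + parabolicKernel (lgInv y) * Real.log 2) / (y * Real.log 2) ^ 2,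
    h.congr_deriv ?_, ?_⟩
  · simp only [Function.comp_apply, id]
    congr 1
    field_simp
    ring
  · rw [abs_div, abs_neg, abs_of_pos (by positivity : 0 < (y * Real.log 2) ^ 2),
      div_le_div_iff₀ (by positivity) (by positivity)]
    have h1 : |k + parabolicKernel (lgInv y) * Real.log 2| ≤ 11 := by
      refine (abs_add_le _ _).trans ?_
      rw [abs_of_pos (mul_pos hK0 hL)]
      nlinarith
    have h2 : 1 ≤ 4 * Real.log 2 ^ 2 := by nlinarith
    have h3 : 0 < y ^ 2 := by positivity
    calc _ ≤ 11 * y ^ 2 := mul_le_mul_of_nonneg_right h1 h3.le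
      _ ≤ 11 * y ^ 2 * (4 * Real.log 2 ^ 2) := le_mul_of_one_le_right (by positivity) h2
      _ = _ := by ring

lemma lgInv_le {y : ℝ} (hy : y ∈ Ioo (1 / 2 : ℝ) 1) : lgInv y ≤ 4 * (1 - y) := by
  obtain ⟨hL1, hL2⟩ := log_two_bounds
  have hy0 : 0 < y := by linarith [hy.1]
  have h1 := Real.one_sub_inv_le_log_of_pos hy0
  have h2 : y⁻¹ - 1 ≤ 2 * (1 - y) := by
    rw [inv_eq_one_div, div_sub_one hy0.ne', div_le_iff₀ hy0]
    nlinarith [hy.1, hy.2]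
  rw [lgInv, div_le_iff₀ (by linarith)]
  nlinarith [hy.2]

lemma lgInv_le_one {y : ℝ} (hy : 1 / 2 ≤ y) : lgInv y ≤ 1 := by
  have hy0 : 0 < y := by linarith
  rw [lgInv, div_le_one (Real.log_pos one_lt_two), ← Real.log_inv]
  refine Real.log_le_log (by positivity) ?_
  rw [inv_le_comm₀ hy0 two_pos]
  exact (by norm_num : (2 : ℝ)⁻¹ = 1 / 2).le.trans hy

/-- The density vanishes linearly at `1`, since the kernel has a simple zero at `ℓ = 0` and `ℓ ≤ 4
(1 - y)`. -/
lemma parabolicDensity_le {y : ℝ} (hy : y ∈ Ioo (1 / 2 : ℝ) 1) :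
    parabolicDensity y ≤ 24 * (2 - 2 * y) := by
  obtain ⟨hL1, hL2⟩ := log_two_bounds
  have h1 := lgInv_le hy
  have h0 := lgInv_pos (right_mem_Ioo hy)
  have h2 : parabolicKernel (lgInv y) ≤ lgInv y * (lgInv y + 2) := by
    rw [parabolicKernel]
    refine div_le_self (by positivity) (one_le_pow₀ ?_)
    nlinarith
  have h3 := lgInv_le_one hy.1.le
  have h4 : parabolicKernel (lgInv y) ≤ 6 * (2 - 2 * y) := by nlinarith
  have h5 : 1 / 2 * (1 / 2) ≤ y * Real.log 2 :=
    mul_le_mul hy.1.le hL1.le (by norm_num) (by linarith [hy.1])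
  rw [parabolicDensity, div_le_iff₀ (by linarith)]
  nlinarith [hy.2]

/-- The density is of order `1 / (s ℓ²)` near `0`, and the logarithm is dominated by a power: `ℓ s ^
(1 / 4) ≤ 8`. The constant is `576 = 9 * 8 ^ 2`. -/
lemma parabolicDensity_ge {s : ℝ} (hs : s ∈ Ioc (0 : ℝ) (1 / 2)) :
    1 / (576 * √s) ≤ parabolicDensity s := by
  obtain ⟨hL1, hL2⟩ := log_two_bounds
  have hs0 := hs.1
  set t := √(√s) with ht
  have ht0 : 0 < t := Real.sqrt_pos.2 (Real.sqrt_pos.2 hs0)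
  have ht2 : t ^ 2 = √s := Real.sq_sqrt (Real.sqrt_nonneg _)
  have ht4 : t ^ 4 = s := by
    rw [show t ^ 4 = (t ^ 2) ^ 2 by ring, ht2, Real.sq_sqrt hs0.le]
  have hl1 : 1 ≤ lgInv s := by
    rw [lgInv, le_div_iff₀ (by linarith), one_mul, ← Real.log_inv]
    refine Real.log_le_log two_pos ?_
    rw [le_inv_comm₀ two_pos hs0]
    exact hs.2.trans (by norm_num)
  have hl2 : lgInv s * t ≤ 8 := by
    have h1 := Real.one_sub_inv_le_log_of_pos ht0
    have h2 : Real.log s = 4 * Real.log t := by rw [← ht4, Real.log_pow]; norm_num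
    have h3 : -Real.log s * t ≤ 4 := by
      rw [h2]
      have h4 : (1 - t⁻¹) * t ≤ Real.log t * t := mul_le_mul_of_nonneg_right h1 ht0.le
      rw [sub_mul, inv_mul_cancel₀ ht0.ne'] at h4
      nlinarith
    rw [lgInv, div_mul_eq_mul_div, div_le_iff₀ (by linarith)]
    linarith
  set l := lgInv s
  have hD := denom_pos l
  have hK : 1 / (9 * l ^ 2) ≤ parabolicKernel l := by
    rw [parabolicKernel, div_le_div_iff₀ (by positivity) (by positivity)]
    have h1 : 1 + l + l ^ 2 ≤ 3 * l ^ 2 := by nlinarith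
    have h2 : (1 + l + l ^ 2) ^ 2 ≤ (3 * l ^ 2) ^ 2 := pow_le_pow_left₀ hD.le h1 2
    have h3 : 0 ≤ l ^ 3 := by positivity
    nlinarith
  have h1 : (l * t) ^ 2 ≤ 8 ^ 2 := pow_le_pow_left₀ (by positivity) hl2 2
  rw [← ht2]
  calc 1 / (576 * t ^ 2) ≤ 1 / (9 * l ^ 2) / s := by
        rw [div_div, ← ht4]
        refine one_div_le_one_div_of_le (by positivity) ?_
        have : 0 < t ^ 2 := by positivity
        nlinarith
    _ ≤ parabolicKernel l / s := by gcongr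
    _ ≤ _ := by
        have := parabolicKernel_pos (lt_of_lt_of_le one_pos hl1)
        unfold parabolicDensity
        refine div_le_div_of_nonneg_left this.le (mul_pos hs0 (by linarith)) ?_
        nlinarith

lemma parabolicDensity_le_two_div {s : ℝ} (hs : s ∈ Ioo (0 : ℝ) 1) :
    parabolicDensity s ≤ 2 / s := by
  obtain ⟨hL1, hL2⟩ := log_two_bounds
  have h := parabolicKernel_le_one (lgInv_pos hs).le
  have hs0 := hs.1
  rw [parabolicDensity, div_le_div_iff₀ (mul_pos hs0 (by linarith)) hs0]
  nlinarith

/-- For `s = 2 - 2 y ≤ 1 / 2` the term `2 ρ(s) ≥ 1 / (288 √s)` suffices, with `82944 = 288 ^ 2`.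
Otherwise `y` stays away from `1` and `ρ(y) ≥ 1 / 18`. -/
lemma parabolic_sum_ge {y : ℝ} (hy : y ∈ Ioo (1 / 2 : ℝ) 1) :
    1 / 82944 ≤ (2 - 2 * y) * (parabolicDensity y + 2 * parabolicDensity (2 - 2 * y)) ^ 2 := by
  obtain ⟨hL1, hL2⟩ := log_two_bounds
  have h1 := parabolicDensity_pos (right_mem_Ioo hy)
  have hs := two_sub_mem_Ioo hy
  have h2 := parabolicDensity_pos hs
  rcases le_or_gt (2 - 2 * y) (1 / 2) with h | h
  · set s := 2 - 2 * y
    have h3 := parabolicDensity_ge ⟨hs.1, h⟩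
    have hsq : √s ^ 2 = s := Real.sq_sqrt hs.1.le
    have hs0 := Real.sqrt_pos.2 hs.1
    have h4 : 1 / (288 * √s) ≤ parabolicDensity y + 2 * parabolicDensity s := by
      have : 1 / (288 * √s) = 2 * (1 / (576 * √s)) := by field_simp; norm_num
      linarith
    calc (1 / 82944 : ℝ) = s * (1 / (288 * √s)) ^ 2 := by
          rw [div_pow, mul_pow, hsq]
          have := hs.1.ne'
          field_simp
          norm_num
      _ ≤ _ := by
          have := hs.1.le
          gcongr
  · have hy0 : 0 < y := by linarith [hy.1]
    have h0 := lgInv_pos (right_mem_Ioo hy)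
    have h3 : 1 / 4 ≤ lgInv y := by
      rw [lgInv, le_div_iff₀ (by linarith)]
      have := Real.log_le_sub_one_of_pos hy0
      linarith
    have h5 := lgInv_le_one hy.1.le
    set l := lgInv y with hl
    have hK : 1 / 18 ≤ parabolicKernel l := by
      have hD := denom_pos l
      rw [parabolicKernel, div_le_div_iff₀ (by norm_num) (by positivity)]
      have h6 : 1 + l + l ^ 2 ≤ 3 := by nlinarith
      have h7 : (1 + l + l ^ 2) ^ 2 ≤ 3 ^ 2 := pow_le_pow_left₀ hD.le h6 2
      nlinarith
    have h8 : 1 / 18 ≤ parabolicDensity y := by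
      refine hK.trans ?_
      rw [parabolicDensity]
      refine le_div_self (by linarith) (mul_pos hy0 (by linarith)) ?_
      nlinarith [hy.2]
    have h9 : (1 / 18 : ℝ) ^ 2 ≤ (parabolicDensity y + 2 * parabolicDensity (2 - 2 * y)) ^ 2 :=
      pow_le_pow_left₀ (by norm_num) (by linarith) 2
    nlinarith

/-- In the quotient rule the numerator is `O(1 / s)` with `s = 2 - 2 y`: `ρ'(s) = O(s⁻²)` comes with
the factor `ρ(y) = O(s)`, and `ρ(s) = O(1 / s)` with the bounded `ρ'(y)`. The squared denominator is
at least a constant over `s`, so the singularities cancel. -/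
lemma exists_hasDerivAt_parabolic_right {y : ℝ} (hy : y ∈ Ioo (1 / 2 : ℝ) 1) :
    ∃ k, HasDerivAt (fun y => parabolicDensity y /
      (parabolicDensity y + 2 * parabolicDensity (2 - 2 * y))) k y ∧ |k| ≤ 5000 * 82944 := by
  have hs := two_sub_mem_Ioo hy
  obtain ⟨k, hk, hkb⟩ := exists_hasDerivAt_parabolicDensity (right_mem_Ioo hy)
  obtain ⟨m, hm, hmb⟩ := exists_hasDerivAt_parabolicDensity hs
  have h1 := parabolicDensity_pos (right_mem_Ioo hy)
  have h2 := parabolicDensity_pos hs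
  have h3 := parabolic_sum_ge hy
  have h4 := parabolicDensity_le hy
  have h5 := parabolicDensity_le_two_div hs
  have hm' : HasDerivAt (fun y => parabolicDensity (2 - 2 * y)) (-(2 * m)) y := by
    have := HasDerivAt.comp y hm (((hasDerivAt_id y).const_mul 2).const_sub 2)
    simpa [Function.comp_def, mul_comm] using this
  have hd := hk.div (hk.add (hm'.const_mul 2))
    (ne_of_gt (show 0 < parabolicDensity y + 2 * parabolicDensity (2 - 2 * y) by positivity))
  refine ⟨(2 * k * parabolicDensity (2 - 2 * y) + 4 * parabolicDensity y * m) /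
    (parabolicDensity y + 2 * parabolicDensity (2 - 2 * y)) ^ 2, hd.congr_deriv ?_, ?_⟩
  · simp only [Pi.add_apply]
    congr 1
    ring
  · set s := 2 - 2 * y
    set r := parabolicDensity y
    set u := parabolicDensity s
    have hs0 := hs.1
    have hk' : |k| ≤ 176 := by
      refine hkb.trans ?_
      rw [div_le_iff₀ (by nlinarith [hy.1])]
      nlinarith [hy.1]
    have n1 : |2 * k * u + 4 * r * m| ≤ 5000 / s := by
      refine (abs_add_le _ _).trans ?_
      rw [abs_mul, abs_mul, abs_mul, abs_mul, abs_of_pos h2, abs_of_pos h1, abs_two,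
        abs_of_pos (by norm_num : (0 : ℝ) < 4)]
      have a1 : 2 * |k| * u ≤ 2 * 176 * (2 / s) := by gcongr
      have a2 : 4 * r * |m| ≤ 4 * (24 * s) * (44 / s ^ 2) := by gcongr
      have a3 : 2 * 176 * (2 / s) + 4 * (24 * s) * (44 / s ^ 2) = 4928 / s := by
        field_simp
        norm_num
      have a4 : 4928 / s ≤ 5000 / s := by gcongr; norm_num
      linarith
    rw [abs_div, abs_of_pos (by positivity : 0 < (r + 2 * u) ^ 2), div_le_iff₀ (by positivity)]
    refine n1.trans ?_
    rw [div_le_iff₀ hs0]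
    nlinarith

/-- With `a = lgInv z > b = lgInv w`, the difference factors as `(a - b) (a + b + a b)` over
denominators at most `3`. Both factors are at least `w - z`, because `a - b ≥ w - z`. -/
lemma parabolicPrimitive_quadratic {z w : ℝ} (hz : 1 / 2 < z) (hzw : z < w) (hw : w < 1) :
    1 / 9 * (w - z) ^ 2 ≤ parabolicPrimitive w - parabolicPrimitive z := by
  obtain ⟨hL1, hL2⟩ := log_two_bounds
  have hz0 : 0 < z := by linarith
  have hw0 : 0 < w := by linarith
  rw [parabolicPrimitive_of_pos hz0, parabolicPrimitive_of_pos hw0]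
  have hb := lgInv_pos ⟨hw0, hw⟩
  have ha := lgInv_le_one hz.le
  have hab : w - z ≤ lgInv z - lgInv w := by
    rw [lgInv, lgInv, ← sub_div, le_div_iff₀ (by linarith)]
    have h1 := Real.one_sub_inv_le_log_of_pos (div_pos hw0 hz0)
    rw [Real.log_div hw0.ne' hz0.ne', inv_div] at h1
    have h2 : w - z ≤ 1 - z / w := by
      rw [one_sub_div hw0.ne', le_div_iff₀ hw0]
      nlinarith
    nlinarith
  set a := lgInv z
  set b := lgInv w
  have hDa := denom_pos a
  have hDb := denom_pos b
  have e : (1 + b) / (1 + b + b ^ 2) - (1 + a) / (1 + a + a ^ 2) =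
      (a - b) * (a + b + a * b) / ((1 + b + b ^ 2) * (1 + a + a ^ 2)) := by
    rw [div_sub_div _ _ hDb.ne' hDa.ne']
    congr 1
    ring
  rw [e, le_div_iff₀ (by positivity)]
  have h3 : 1 + a + a ^ 2 ≤ 3 := by nlinarith
  have h4 : 1 + b + b ^ 2 ≤ 3 := by nlinarith
  have h5 : (1 + b + b ^ 2) * (1 + a + a ^ 2) ≤ 3 * 3 := mul_le_mul h4 h3 hDa.le (by norm_num)
  have h6 : (w - z) ^ 2 ≤ (a - b) * (a + b + a * b) := by
    rw [sq]
    have hba : 0 < a := by linarith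
    refine mul_le_mul hab ?_ (by linarith) (by linarith)
    have := mul_pos hba hb
    linarith
  nlinarith [sq_nonneg (w - z)]

lemma exists_holder_parabolic_right : ∃ C > 0, ∀ z ∈ Ioo (1 / 2 : ℝ) 1, ∀ w ∈ Ioo (1 / 2 : ℝ) 1,
    |(1 + 2 * parabolicDensity (2 - 2 * z) / parabolicDensity z)⁻¹ -
      (1 + 2 * parabolicDensity (2 - 2 * w) / parabolicDensity w)⁻¹| ≤
      C * |parabolicPrimitive z - parabolicPrimitive w| ^ (1 / 2 : ℝ) := by
  refine ⟨5000 * 82944 / √(1 / 9) + 1, by positivity, fun z hz w hw => ?_⟩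
  have heq : ∀ y ∈ Ioo (1 / 2 : ℝ) 1,
      (1 + 2 * parabolicDensity (2 - 2 * y) / parabolicDensity y)⁻¹ =
      parabolicDensity y / (parabolicDensity y + 2 * parabolicDensity (2 - 2 * y)) := by
    intro y hy
    rw [one_add_div (parabolicDensity_pos (right_mem_Ioo hy)).ne', inv_div]
  rw [heq z hz, heq w hw]
  set W : ℝ → ℝ := fun y => parabolicDensity y /
      (parabolicDensity y + 2 * parabolicDensity (2 - 2 * y))
  refine holder_half_of_quadratic (W := W) (W' := deriv W)
    (by norm_num) (by norm_num) (fun y hy => ?_) (fun y hy => ?_)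
    (fun z hz w hw hzw => parabolicPrimitive_quadratic hz.1 hzw hw.2) z hz w hw
  · obtain ⟨k, hk, -⟩ := exists_hasDerivAt_parabolic_right hy
    exact hk.differentiableAt.hasDerivAt
  · obtain ⟨k, hk, hb⟩ := exists_hasDerivAt_parabolic_right hy
    rwa [hk.deriv]

lemma continuousAt_parabolicDensity {y : ℝ} (hy : 0 < y) : ContinuousAt parabolicDensity y :=
  (contDiffOn_parabolicDensity (n := 0)).continuousOn.continuousAt (Ioi_mem_nhds hy)

/-- At `y = 1 / 2` the derivative tends to `0` because the density vanishes at `1`. At `y = 1` the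
denominator vanishes linearly, while `ρ(2 - 2 y)` stays at least `1 / 576`, so there is a pole. -/
lemma isCuspBranch_parabolic_right {g : ℝ → ℝ}
    (hg : ∀ y ∈ Ioo (1 / 2 : ℝ) 1, g (parabolicPrimitive y) = parabolicPrimitive (2 - 2 * y)) :
    IsCuspBranch g (2 / 3) 1 (1 / 2) := by
  obtain ⟨C, hC, hW⟩ := exists_holder_parabolic_right
  rw [← parabolicPrimitive_half]
  refine isSmoothReparam_parabolic.isCuspBranch_right hg (Or.inl ?_) (Or.inr (Or.inr ?_)) hC hW
  · have h1 : parabolicDensity 1 = 0 := by simp [parabolicDensity, lgInv, parabolicKernel]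
    have hc : ContinuousAt (fun y => -(2 * parabolicDensity (2 - 2 * y)) / parabolicDensity y)
        (1 / 2) := by
      refine ContinuousAt.div (ContinuousAt.neg (ContinuousAt.const_mul ?_ 2))
        (continuousAt_parabolicDensity (by norm_num))
        (parabolicDensity_pos (by norm_num)).ne'
      refine ContinuousAt.comp (f := fun y : ℝ => 2 - 2 * y)
        (continuousAt_parabolicDensity (by norm_num)) (by fun_prop)
    have h2 := hc.tendsto
    rw [show (2 : ℝ) - 2 * (1 / 2) = 1 by norm_num, h1, mul_zero, neg_zero, zero_div] at h2
    exact h2.mono_left nhdsWithin_le_nhds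
  · have h1 : Tendsto (fun y : ℝ => (1 - y)⁻¹) (𝓝[<] 1) atTop := by
      refine tendsto_inv_nhdsGT_zero.comp (tendsto_nhdsWithin_iff.2 ⟨?_, ?_⟩)
      · have : ContinuousAt (fun y : ℝ => 1 - y) 1 := by fun_prop
        simpa using this.tendsto.mono_left (nhdsWithin_le_nhds (s := Iio 1))
      · filter_upwards [self_mem_nhdsWithin] with y hy
        exact sub_pos.2 (mem_Iio.1 hy)
    have h2 : Tendsto (fun y : ℝ => -(1 / (576 * 24) * (1 - y)⁻¹)) (𝓝[<] 1) atBot :=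
      tendsto_neg_atTop_atBot.comp (h1.const_mul_atTop (by norm_num))
    refine tendsto_atBot_mono' _ ?_ h2
    filter_upwards [Ioo_mem_nhdsLT (by norm_num : (3 / 4 : ℝ) < 1)] with y hy
    have hy' : y ∈ Ioo (1 / 2 : ℝ) 1 := ⟨by linarith [hy.1], hy.2⟩
    have a0 := parabolicDensity_pos (right_mem_Ioo hy')
    have a1 := parabolicDensity_le hy'
    have hs := two_sub_mem_Ioo hy'
    have a2 := parabolicDensity_ge ⟨hs.1, by linarith [hy.1]⟩
    have a3 : 1 / 576 ≤ 1 / (576 * √(2 - 2 * y)) := by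
      refine one_div_le_one_div_of_le (mul_pos (by norm_num) (Real.sqrt_pos.2 hs.1)) ?_
      have : √(2 - 2 * y) ≤ 1 := Real.sqrt_le_one.2 hs.2.le
      linarith
    have h1y : 0 < 1 - y := by linarith [hy.2]
    rw [neg_div, neg_le_neg_iff, ← div_eq_mul_inv, div_le_div_iff₀ h1y a0]
    nlinarith

end ParabolicRight

/-! ### The parabolic example: extension past the fixed point, and its exponent -/

section ParabolicExample

variable {H : Icc (0 : ℝ) 1 ≃ₜ Icc (0 : ℝ) 1}

/-- The extension of the parabolic example to `[-1 / 3, 1]`. -/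
def parabolicExtension (H : Icc (0 : ℝ) 1 ≃ₜ Icc (0 : ℝ) 1) (x : ℝ) : ℝ :=
  if x < 0 then parabolicQ (parabolicPInv x) else ext (tentConj H) x

lemma parabolicExtension_of_nonneg {x : ℝ} (hx : 0 ≤ x) :
    parabolicExtension H x = ext (tentConj H) x := if_neg hx.not_gt

lemma strictMonoOn_parabolicP : StrictMonoOn parabolicP (Icc (-1 / 2) 1) := by
  intro z hz w hw hzw
  have h1 := parabolicP_quadratic hz.1 hzw hw.2
  have h2 : 0 < (w - z) ^ 2 := pow_pos (sub_pos.2 hzw) 2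
  linarith

lemma parabolicP_zero : parabolicP 0 = 0 := by simp [parabolicP]

/-- Negative parameters use the definition and positive ones the conjugacy. One rational
parametrization thus covers both sides of the fixed point. -/
lemma parabolicExtension_parabolicP (hH : ∀ y, (H y : ℝ) = parabolicPrimitive y) {z : ℝ}
    (hz : z ∈ Icc (-1 / 2 : ℝ) 1) : parabolicExtension H (parabolicP z) = parabolicQ z := by
  have h0 : (0 : ℝ) ∈ Icc (-1 / 2 : ℝ) 1 := by norm_num
  rcases lt_trichotomy z 0 with h | rfl | h
  · have h1 := strictMonoOn_parabolicP hz h0 h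
    rw [parabolicP_zero] at h1
    rw [parabolicExtension, if_pos h1, parabolicPInv_parabolicP hz.1]
  · rw [parabolicP_zero, parabolicExtension_of_nonneg le_rfl]
    have h1 := ext_tentConj_left hH (y := 0) (by norm_num)
    rw [mul_zero, isSmoothReparam_parabolic.zero] at h1
    rw [h1]
    simp [parabolicQ]
  · have h1 := strictMonoOn_parabolicP h0 hz h
    rw [parabolicP_zero] at h1
    obtain ⟨y, hy, h2, h3⟩ := exists_parabolicPrimitive_eq ⟨h, hz.2⟩
    rw [parabolicExtension_of_nonneg h1.le, ← h2, ext_tentConj_left hH ⟨hy.1.le, hy.2⟩, h3]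

lemma continuousOn_parabolicPInv : ContinuousOn parabolicPInv (Iio 1) := by
  refine ContinuousOn.div_const (ContinuousOn.sub (ContinuousOn.sqrt ?_) continuousOn_const) _
  exact ContinuousOn.div (by fun_prop) (by fun_prop) fun x hx => (sub_pos.2 (mem_Iio.1 hx)).ne'

lemma continuousOn_parabolicExtension (hH : ∀ y, (H y : ℝ) = parabolicPrimitive y) :
    ContinuousOn (parabolicExtension H) (Icc (-1 / 3) 1) := by
  have h1 : ContinuousOn (parabolicExtension H) (Icc (-1 / 3) (2 / 3)) := by
    refine ContinuousOn.congr (f := parabolicQ ∘ parabolicPInv)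
      ((contDiff_parabolicQ (n := 0)).continuous.comp_continuousOn
      (continuousOn_parabolicPInv.mono fun x hx => ?_)) fun x hx => ?_
    · exact hx.2.trans_lt (by norm_num)
    · obtain ⟨z, hz, rfl⟩ := exists_parabolicP_eq hx
      rw [parabolicExtension_parabolicP hH hz, Function.comp_apply,
        parabolicPInv_parabolicP hz.1]
  have h2 : ContinuousOn (parabolicExtension H) (Icc 0 1) :=
    (continuousOn_ext (continuous_tentConj H)).congr fun x hx => parabolicExtension_of_nonneg hx.1
  refine (h1.union_of_isClosed h2 isClosed_Icc isClosed_Icc).mono fun x hx => ?_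
  rcases le_total x (2 / 3) with h | h
  · exact Or.inl ⟨hx.1, h⟩
  · exact Or.inr ⟨by linarith, hx.2⟩

/-- A derivative of modulus `1` is not an allowed limit at the end of a branch. The extension makes
`0` an interior point; the ends are now a pole at `-1 / 3`, where `P'(-1 / 2) = 0`, and a critical
point at `2 / 3`, where `Q'(1) = 0`. -/
lemma isCuspBranch_parabolic_left (hH : ∀ y, (H y : ℝ) = parabolicPrimitive y) :
    IsCuspBranch (parabolicExtension H) (-1 / 3) (2 / 3) (1 / 2) := by
  obtain ⟨C, hC, hW⟩ := exists_holder_parabolic_left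
  refine IsCuspBranch.of_parametrization (p := parabolicP) (q := parabolicQ)
    (p' := fun z => (2 * z + 1) / (z ^ 2 + z + 1) ^ 2)
    (q' := fun z => (1 - z ^ 2) / (1 - z + z ^ 2) ^ 2) (α := -1 / 2) (β := 1) (by norm_num)
    (contDiff_parabolicP (n := 0)).continuous.continuousOn (by norm_num [parabolicP])
    (by norm_num [parabolicP]) (fun z _ => contDiff_parabolicP.contDiffAt)
    (fun z _ => contDiff_parabolicQ.contDiffAt) (fun z _ => hasDerivAt_parabolicP z)
    (fun z _ => hasDerivAt_parabolicQ z) (fun z hz => ?_)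
    (fun z hz => parabolicExtension_parabolicP hH (Ioo_subset_Icc_self hz))
    (Or.inl fun z hz => ?_) (Or.inr (Or.inl ?_)) (Or.inl ?_) hC hW
  · exact div_pos (by linarith [hz.1]) (pow_pos (denomP_pos z) 2)
  · exact div_pos (by nlinarith [hz.1, hz.2]) (pow_pos (denomQ_pos z) 2)
  · have hc : ContinuousAt
        (fun z : ℝ => (1 - z ^ 2) / (1 - z + z ^ 2) ^ 2 * (z ^ 2 + z + 1) ^ 2) (-1 / 2) :=
      ContinuousAt.mul (ContinuousAt.div (by fun_prop) (by fun_prop) (by norm_num)) (by fun_prop)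
    have h1 : Tendsto (fun z : ℝ => (2 * z + 1)⁻¹) (𝓝[>] (-1 / 2)) atTop := by
      refine tendsto_inv_nhdsGT_zero.comp (tendsto_nhdsWithin_iff.2 ⟨?_, ?_⟩)
      · have : ContinuousAt (fun z : ℝ => 2 * z + 1) (-1 / 2) := by fun_prop
        have h := this.tendsto.mono_left (nhdsWithin_le_nhds (s := Ioi (-1 / 2 : ℝ)))
        rwa [show (2 : ℝ) * (-1 / 2) + 1 = 0 by norm_num] at h
      · filter_upwards [self_mem_nhdsWithin] with z hz
        have : -1 / 2 < z := hz
        exact mem_Ioi.2 (by linarith)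
    refine (Tendsto.pos_mul_atTop (by norm_num)
      (hc.tendsto.mono_left (nhdsWithin_le_nhds (s := Ioi (-1 / 2 : ℝ)))) h1).congr fun z => ?_
    rw [div_div_eq_mul_div, div_eq_mul_inv _ (2 * z + 1)]
  · have hc : ContinuousAt (fun z : ℝ => (1 - z ^ 2) / (1 - z + z ^ 2) ^ 2 /
        ((2 * z + 1) / (z ^ 2 + z + 1) ^ 2)) 1 :=
      ContinuousAt.div (ContinuousAt.div (by fun_prop) (by fun_prop) (by norm_num))
        (ContinuousAt.div (by fun_prop) (by fun_prop) (by norm_num)) (by norm_num)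
    have h := hc.tendsto
    rw [show ((1 : ℝ) - 1 ^ 2) = 0 by norm_num, zero_div, zero_div] at h
    exact h.mono_left nhdsWithin_le_nhds

lemma isCuspMap_parabolicExtension (hH : ∀ y, (H y : ℝ) = parabolicPrimitive y) :
    IsCuspMap (-1 / 3) 1 (parabolicExtension H) := by
  refine isCuspMap_of_branches (by norm_num) (continuousOn_parabolicExtension hH)
    (fun x hx => ?_) (isCuspBranch_parabolic_left hH)
    (isCuspBranch_parabolic_right fun y hy => ?_)
  · rcases lt_or_ge x 0 with h | h
    · rw [parabolicExtension, if_pos h]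
      exact parabolicQ_mem
    · rw [parabolicExtension_of_nonneg h]
      exact Icc_subset_Icc_left (by norm_num) (mapsTo_ext _ ⟨h, hx.2⟩)
  · rw [parabolicExtension_of_nonneg
      (isSmoothReparam_parabolic.apply_mem_Ioo (right_mem_Ioo hy)).1.le]
    exact ext_tentConj_right hH (Ioo_subset_Icc_self hy)

lemma eventually_parabolicExtension (hH : ∀ y, (H y : ℝ) = parabolicPrimitive y) {z : ℝ}
    (hz : z ∈ Ioo (-1 / 2 : ℝ) 1) :
    ∀ᶠ w in 𝓝 z, parabolicExtension H (parabolicP w) = parabolicQ w :=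
  (isOpen_Ioo.eventually_mem hz).mono fun _ hw =>
    parabolicExtension_parabolicP hH (Ioo_subset_Icc_self hw)

/-- Near `0` the map is `Q ∘ P⁻¹`, with `P(0) = Q(0) = 0` and `P'(0) = Q'(0) = 1`. -/
lemma isSmoothParabolicFixedPoint_parabolic (hH : ∀ y, (H y : ℝ) = parabolicPrimitive y) :
    IsSmoothParabolicFixedPoint (tentConj H) ⟨0, by norm_num⟩ := by
  refine ⟨?_, ⟨1 / 3, by norm_num, ?_⟩, ?_⟩
  · have h := parabolicExtension_parabolicP hH (z := 0) (by norm_num)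
    rw [parabolicP_zero, parabolicExtension_of_nonneg le_rfl] at h
    have h2 := ext_apply (tentConj H) ⟨0, by norm_num⟩
    ext
    rw [← h2, h]
    simp [parabolicQ]
  · intro x hx
    have hx1 : x < 1 / 3 := by
      have := hx.2.2
      simpa using this
    have hx0 := hx.1.1
    obtain ⟨z, hz, rfl⟩ := exists_parabolicP_eq (x := x) ⟨by linarith, by linarith⟩
    have hz1 : -1 / 2 < z := by
      refine lt_of_le_of_ne hz.1 ?_
      rintro rfl
      norm_num [parabolicP] at hx0
    have hz2 : z < 1 := by
      refine lt_of_le_of_ne hz.2 ?_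
      rintro rfl
      norm_num [parabolicP] at hx1
    have hne : (2 * z + 1) / (z ^ 2 + z + 1) ^ 2 ≠ 0 :=
      (div_pos (by linarith) (pow_pos (denomP_pos z) 2)).ne'
    exact (ContDiffAt.of_parametrization one_le_infty contDiff_parabolicP.contDiffAt
      (hasDerivAt_parabolicP z) hne contDiff_parabolicQ.contDiffAt
      (eventually_parabolicExtension hH ⟨hz1, hz2⟩)).contDiffWithinAt.congr
      (fun w hw => (parabolicExtension_of_nonneg hw.1.1).symm)
      (parabolicExtension_of_nonneg hx0).symm
  · have h := HasDerivAt.of_parametrization (g := parabolicExtension H)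
      (contDiff_parabolicP.contDiffAt (x := 0)) (hasDerivAt_parabolicP 0) (by norm_num)
      contDiff_parabolicQ.contDiffAt (hasDerivAt_parabolicQ 0)
      (eventually_parabolicExtension hH (by norm_num))
    rw [parabolicP_zero] at h
    have h2 : HasDerivWithinAt (ext (tentConj H)) 1 (Icc 0 1) 0 := by
      refine ((h.congr_deriv (by norm_num)).hasDerivWithinAt).congr
        (fun w hw => (parabolicExtension_of_nonneg hw.1).symm)
        (parabolicExtension_of_nonneg le_rfl).symm
    rw [h2.derivWithin (uniqueDiffOn_Icc zero_lt_one 0 (by norm_num)), abs_one]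

/-- A crude bound whose logarithm is integrable. It combines a kernel of at least `ℓ / (1 + ℓ)³`
with `ℓ ≥ 1 - y` and `(1 + ℓ) y ≤ 2`. -/
lemma parabolicDensity_lower {y : ℝ} (hy : y ∈ Ioo (0 : ℝ) 1) :
    (1 - y) * y ^ 2 / 8 ≤ parabolicDensity y := by
  obtain ⟨hL1, hL2⟩ := log_two_bounds
  have hL : 0 < Real.log 2 := by linarith
  have hy0 := hy.1
  have h0 := lgInv_pos hy
  have h1 : 1 - y ≤ lgInv y := by
    rw [lgInv, le_div_iff₀ hL]
    nlinarith [Real.log_le_sub_one_of_pos hy0, hy.2]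
  have h2 : (1 + lgInv y) * y ≤ 2 := by
    have h3 := Real.one_sub_inv_le_log_of_pos hy0
    have h4 : lgInv y ≤ 2 * (y⁻¹ - 1) := by
      rw [lgInv, div_le_iff₀ hL]
      have : 1 < y⁻¹ := (one_lt_inv₀ hy0).2 hy.2
      nlinarith
    have h5 : lgInv y * y ≤ 2 * (y⁻¹ - 1) * y := mul_le_mul_of_nonneg_right h4 hy0.le
    rw [mul_assoc, sub_mul, inv_mul_cancel₀ hy0.ne'] at h5
    nlinarith [hy.2]
  set l := lgInv y with hl
  have h3 : l / (1 + l) ^ 3 ≤ parabolicKernel l := by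
    have hD := denom_pos l
    rw [parabolicKernel, div_le_div_iff₀ (by positivity) (by positivity)]
    have h6 : (1 + l + l ^ 2) ^ 2 ≤ ((1 + l) ^ 2) ^ 2 := pow_le_pow_left₀ hD.le (by nlinarith) 2
    have h7 : l * (1 + l + l ^ 2) ^ 2 ≤ l * ((1 + l) ^ 2) ^ 2 :=
      mul_le_mul_of_nonneg_left h6 h0.le
    have h8 : 0 ≤ l * (1 + l) ^ 3 := by positivity
    nlinarith
  have h4 : ((1 + l) * y) ^ 3 ≤ 2 ^ 3 := pow_le_pow_left₀ (by positivity) h2 3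
  have h1y : 0 < 1 - y := by linarith [hy.2]
  have h5 : (1 - y) * y ^ 3 / 8 ≤ l / (1 + l) ^ 3 := by
    rw [div_le_div_iff₀ (by norm_num) (by positivity)]
    calc (1 - y) * y ^ 3 * (1 + l) ^ 3 = (1 - y) * ((1 + l) * y) ^ 3 := by ring
      _ ≤ l * 2 ^ 3 := mul_le_mul h1 h4 (by positivity) h0.le
      _ = _ := by norm_num
  have hK := parabolicKernel_pos h0
  calc (1 - y) * y ^ 2 / 8 = (1 - y) * y ^ 3 / 8 / y := by field_simp
    _ ≤ parabolicKernel l / y := div_le_div_of_nonneg_right (h5.trans h3) hy0.le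
    _ ≤ _ := div_le_div_of_nonneg_left hK.le (mul_pos hy0 hL) (by nlinarith)

lemma integrableOn_log_parabolicDensity :
    IntegrableOn (fun y => Real.log (parabolicDensity y)) (Icc 0 1) := by
  have hi : IntervalIntegrable Real.log volume 0 1 := intervalIntegral.intervalIntegrable_log'
  have hi2 : IntervalIntegrable (fun y => Real.log (1 - y)) volume 0 1 := by
    have := hi.comp_sub_left 1
    simpa using this.symm
  rw [intervalIntegrable_iff_integrableOn_Ioo_of_le zero_le_one] at hi hi2
  rw [integrableOn_Icc_iff_integrableOn_Ioo]
  have hbd : IntegrableOn (fun y => Real.log 8 + -2 * Real.log y - Real.log (1 - y)) (Ioo 0 1) :=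
    ((integrableOn_const (by simp)).add (hi.const_mul (-2))).sub hi2
  refine Integrable.mono' hbd ?_ ?_
  · refine (Measurable.log ?_).aestronglyMeasurable
    unfold parabolicDensity parabolicKernel lgInv
    fun_prop
  · refine (ae_restrict_iff' measurableSet_Ioo).2 (.of_forall fun y hy => ?_)
    have hy0 := hy.1
    have hy1 : 0 < 1 - y := by linarith [hy.2]
    have hρ := parabolicDensity_pos hy
    have h1 : Real.log (parabolicDensity y) ≤ Real.log 2 - Real.log y := by
      rw [← Real.log_div two_ne_zero hy0.ne']
      exact Real.log_le_log hρ (parabolicDensity_le_two_div hy)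
    have h2 : Real.log (1 - y) + 2 * Real.log y - Real.log 8 ≤ Real.log (parabolicDensity y) := by
      have h := Real.log_le_log (by positivity) (parabolicDensity_lower hy)
      rw [Real.log_div (by positivity) (by norm_num), Real.log_mul (by positivity) (by positivity),
        Real.log_pow] at h
      exact_mod_cast h
    have h3 : Real.log y < 0 := Real.log_neg hy0 hy.2
    have h4 : Real.log (1 - y) < 0 := Real.log_neg hy1 (by linarith)
    have h5 : Real.log 2 ≤ Real.log 8 := Real.log_le_log two_pos (by norm_num)
    rw [Real.norm_eq_abs, abs_le]
    constructor <;> linarith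

theorem exists_parabolic_log_two :
    ∃ (f : Icc (0 : ℝ) 1 → Icc (0 : ℝ) 1) (h : Icc (0 : ℝ) 1 ≃ₜ Icc (0 : ℝ) 1),
      TCSmooth f h ∧
        (∃ p : Icc (0 : ℝ) 1, ((p : ℝ) = 0 ∨ (p : ℝ) = 1) ∧ IsSmoothParabolicFixedPoint f p) ∧
        HasLyapunovExponent f (muOf h) ((Real.log 2 : ℝ) : EReal) := by
  have c := isSmoothReparam_parabolic
  obtain ⟨H, hH⟩ := c.exists_homeomorph
  have hcusp : IsCuspMapOrRestriction (tentConj H) :=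
    ⟨-1 / 3, 1, parabolicExtension H, by norm_num, le_rfl, isCuspMap_parabolicExtension hH,
      fun x => (parabolicExtension_of_nonneg x.2.1).trans (ext_apply _ x)⟩
  exact ⟨tentConj H, H.symm, tcSmooth_of_reparam c hH hcusp,
    ⟨⟨0, by norm_num⟩, Or.inl rfl, isSmoothParabolicFixedPoint_parabolic hH⟩,
    hasLyapunovExponent_log_two (ρ := parabolicDensity) (fun y hy => parabolicDensity_pos hy)
      integrableOn_log_parabolicDensity fun y hy hy' => c.abs_derivWithin_ext hH hy hy'⟩

end ParabolicExample

/-! ### The smoothstep polynomial -/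

section Smoothstep

/-- The smoothstep polynomial. -/
def smoothstep (t : ℝ) : ℝ := 3 * t ^ 2 - 2 * t ^ 3

lemma hasDerivAt_smoothstep (t : ℝ) : HasDerivAt smoothstep (6 * (t * (1 - t))) t := by
  have h := ((hasDerivAt_pow 2 t).const_mul 3).sub ((hasDerivAt_pow 3 t).const_mul 2)
  refine h.congr_deriv ?_
  norm_num
  ring

lemma contDiff_smoothstep {n : ℕ∞ω} : ContDiff ℝ n smoothstep := by
  unfold smoothstep
  fun_prop

lemma smoothstep_quadratic {a b : ℝ} (ha : 0 ≤ a) (hab : a < b) (hb : b ≤ 1) :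
    (b - a) ^ 2 ≤ smoothstep b - smoothstep a := by
  have e : smoothstep b - smoothstep a - (b - a) ^ 2 =
      (b - a) * (2 * (b * (1 - b) + a * (1 - b) + a * (1 - a))) := by
    unfold smoothstep
    ring
  have h1 : 0 ≤ b * (1 - b) := mul_nonneg (by linarith) (by linarith)
  have h2 : 0 ≤ a * (1 - b) := mul_nonneg ha (by linarith)
  have h3 : 0 ≤ a * (1 - a) := mul_nonneg ha (by linarith)
  have h4 : 0 ≤ (b - a) * (2 * (b * (1 - b) + a * (1 - b) + a * (1 - a))) :=
    mul_nonneg (by linarith) (by linarith)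
  linarith

lemma smoothstep_injOn : InjOn smoothstep (Icc 0 1) := by
  have h : StrictMonoOn smoothstep (Icc 0 1) := fun a ha b hb hab => by
    have h1 := smoothstep_quadratic ha.1 hab hb.2
    have h2 : 0 < (b - a) ^ 2 := pow_pos (sub_pos.2 hab) 2
    linarith
  exact h.injOn

lemma smoothstep_mem {t : ℝ} (ht : t ∈ Icc (0 : ℝ) 1) : smoothstep t ∈ Icc (0 : ℝ) 1 := by
  unfold smoothstep
  refine ⟨?_, ?_⟩
  · nlinarith [sq_nonneg t, ht.1, ht.2, mul_nonneg (sq_nonneg t) (sub_nonneg.2 ht.2)]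
  · nlinarith [sq_nonneg (1 - t), mul_nonneg (sq_nonneg (1 - t)) ht.1]

lemma smoothstep_zero : smoothstep 0 = 0 := by norm_num [smoothstep]

lemma smoothstep_one : smoothstep 1 = 1 := by norm_num [smoothstep]

lemma smoothstep_one_sub (t : ℝ) : smoothstep (1 - t) = 1 - smoothstep t := by
  unfold smoothstep
  ring

lemma abs_smoothstep_sub_le {a b : ℝ} (ha : a ∈ Icc (0 : ℝ) 1) (hb : b ∈ Icc (0 : ℝ) 1) :
    |smoothstep a - smoothstep b| ≤ 3 / 2 * |a - b| := by
  have e : smoothstep a - smoothstep b =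
      (3 * (a + b) - 2 * (a ^ 2 + a * b + b ^ 2)) * (a - b) := by
    unfold smoothstep
    ring
  rw [e, abs_mul]
  refine mul_le_mul_of_nonneg_right (abs_le.2 ⟨?_, ?_⟩) (abs_nonneg _)
  · nlinarith [ha.1, ha.2, hb.1, hb.2, mul_nonneg ha.1 (sub_nonneg.2 ha.2),
      mul_nonneg hb.1 (sub_nonneg.2 hb.2), mul_nonneg ha.1 (sub_nonneg.2 hb.2)]
  · nlinarith [sq_nonneg (a + b - 1), sq_nonneg a, sq_nonneg b, sq_nonneg (a - b)]

end Smoothstep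

/-! ### The conjugacy with prescribed inverse branches, by contraction -/

section SmoothstepConjugacy

/-- Continuous self-maps of `[0, 1]` fixing both boundary points. -/
abbrev BoundaryFixing : Type :=
  {k : C(Icc (0 : ℝ) 1, Icc (0 : ℝ) 1) // k 0 = 0 ∧ k 1 = 1}

/-- The pull-back of `k` by the tent map, pushed forward by the contracting inverse branches
`t ↦ smoothstep t / 2` and `t ↦ 1 - smoothstep t / 2`. -/
def foldValue (k : Icc (0 : ℝ) 1 → Icc (0 : ℝ) 1) (y : Icc (0 : ℝ) 1) : ℝ :=
  if (y : ℝ) ≤ 1 / 2 then smoothstep (k (tent y)) / 2 else 1 - smoothstep (k (tent y)) / 2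

lemma foldValue_mem (k : Icc (0 : ℝ) 1 → Icc (0 : ℝ) 1) (y : Icc (0 : ℝ) 1) :
    foldValue k y ∈ Icc (0 : ℝ) 1 := by
  have h := smoothstep_mem (k (tent y)).2
  unfold foldValue
  split_ifs <;> constructor <;> linarith [h.1, h.2]

lemma tent_half : tent ⟨1 / 2, by norm_num, by norm_num⟩ = 1 := by
  ext
  rw [tent_of_le le_rfl]
  norm_num

lemma tent_zero : tent 0 = 0 := by
  ext
  rw [tent_of_le (by norm_num)]
  simp

lemma tent_one : tent 1 = 0 := by
  ext
  rw [tent_of_ge (by norm_num)]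
  norm_num

lemma continuous_foldValue (k : BoundaryFixing) : Continuous (foldValue k.1) := by
  have hs : Continuous fun y : Icc (0 : ℝ) 1 => smoothstep (k.1 (tent y)) / 2 :=
    ((contDiff_smoothstep (n := 0)).continuous.comp
      (continuous_subtype_val.comp (k.1.continuous.comp continuous_tent))).div_const _
  refine Continuous.if_le hs (continuous_const.sub hs) continuous_subtype_val continuous_const ?_
  intro y hy
  have h : tent y = 1 := by
    rw [← tent_half]
    exact congrArg tent (Subtype.ext hy)
  rw [h, k.2.2]
  norm_num [smoothstep_one]

/-- The operator whose fixed point is the inverse of the conjugacy. -/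
def foldOperator (k : BoundaryFixing) : BoundaryFixing :=
  ⟨⟨fun y => ⟨foldValue k.1 y, foldValue_mem _ y⟩,
    (continuous_foldValue k).subtype_mk _⟩, by
    constructor
    · ext
      simp [foldValue, tent_zero, k.2.1, smoothstep_zero]
    · ext
      have : ¬ (1 : ℝ) ≤ 2⁻¹ := by norm_num
      simp [foldValue, tent_one, k.2.1, smoothstep_zero, this]⟩

/-- The smoothstep polynomial is `3 / 2`-Lipschitz on `[0, 1]`, and the inverse branches halve it.
-/
lemma contractingWith_foldOperator : ContractingWith (3 / 4) foldOperator := by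
  refine ⟨by rw [← NNReal.coe_lt_coe]; norm_num, LipschitzWith.of_dist_le_mul fun k l => ?_⟩
  rw [Subtype.dist_eq, Subtype.dist_eq]
  refine (ContinuousMap.dist_le (by positivity)).2 fun y => ?_
  have h1 := abs_smoothstep_sub_le (k.1 (tent y)).2 (l.1 (tent y)).2
  have h2 : |((k.1 (tent y) : ℝ) - l.1 (tent y))| ≤ dist k.1 l.1 :=
    ContinuousMap.dist_apply_le_dist (f := k.1) (g := l.1) (tent y)
  have h3 : |foldValue k.1 y - foldValue l.1 y| =
      |smoothstep (k.1 (tent y)) - smoothstep (l.1 (tent y))| / 2 := by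
    unfold foldValue
    rw [← abs_two, ← abs_div, abs_two]
    split_ifs
    · congr 1
      ring
    · rw [abs_sub_comm]
      congr 1
      ring
  change |foldValue k.1 y - foldValue l.1 y| ≤ _
  rw [h3]
  push_cast
  linarith

lemma exists_foldOperator_fixed : ∃ k : BoundaryFixing, ∀ y, (k.1 y : ℝ) = foldValue k.1 y := by
  have hcl : IsClosed {k : C(Icc (0 : ℝ) 1, Icc (0 : ℝ) 1) | k 0 = 0 ∧ k 1 = 1} :=
    (isClosed_eq (continuous_eval_const 0) continuous_const).inter
      (isClosed_eq (continuous_eval_const 1) continuous_const)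
  have : CompleteSpace BoundaryFixing := hcl.completeSpace_coe
  have : Nonempty BoundaryFixing := ⟨⟨ContinuousMap.id _, rfl, rfl⟩⟩
  refine ⟨contractingWith_foldOperator.fixedPoint foldOperator, fun y => ?_⟩
  have h := contractingWith_foldOperator.fixedPoint_isFixedPt
  conv_lhs => rw [← h.eq]
  rfl

variable {k : BoundaryFixing}

/-- The contraction principle yields only a continuous fixed point `k`. It is injective because `k
y` determines the branch of `y` and then `k (tent y)`, hence the whole itinerary. The branch could
be ambiguous only if `k y = 1 / 2` with `y > 1 / 2`; this would need `k = 1` at `tent y < 1`, which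
is excluded by `hone`. -/
lemma fold_injective (hk : ∀ y, (k.1 y : ℝ) = foldValue k.1 y) : Function.Injective k.1 := by
  have hle : ∀ y : Icc (0 : ℝ) 1, (y : ℝ) ≤ 1 / 2 →
      (k.1 y : ℝ) = smoothstep (k.1 (tent y)) / 2 := fun y hy => by
    rw [hk, foldValue, if_pos hy]
  have hgt : ∀ y : Icc (0 : ℝ) 1, 1 / 2 < (y : ℝ) →
      (k.1 y : ℝ) = 1 - smoothstep (k.1 (tent y)) / 2 := fun y hy => by
    rw [hk, foldValue, if_neg hy.not_ge]
  have hmem := fun y => smoothstep_mem (k.1 y).2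
  have hs0 : ∀ y, smoothstep (k.1 y) = 0 → (k.1 y : ℝ) = 0 := fun y h =>
    smoothstep_injOn (k.1 y).2 (by norm_num) (h.trans smoothstep_zero.symm)
  have hs1 : ∀ y, smoothstep (k.1 y) = 1 → (k.1 y : ℝ) = 1 := fun y h =>
    smoothstep_injOn (k.1 y).2 (by norm_num) (h.trans smoothstep_one.symm)
  -- A zero of `k` lies in the left branch and its image `2 y` is again a zero, so it can be doubled
  -- forever.
  have hz : ∀ (n : ℕ) (y : Icc (0 : ℝ) 1), (k.1 y : ℝ) = 0 → (2 : ℝ) ^ n * y ≤ 1 := by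
    intro n
    induction n with
    | zero => exact fun y _ => by simpa using y.2.2
    | succ n ih =>
      intro y hy
      rcases le_or_gt (y : ℝ) (1 / 2) with h | h
      · have h1 := hle y h
        have h2 := ih (tent y) (hs0 _ (by linarith))
        rw [tent_of_le h] at h2
        rw [pow_succ]
        linarith
      · have h1 := hgt y h
        linarith [(hmem (tent y)).2]
  have hzero : ∀ y : Icc (0 : ℝ) 1, (k.1 y : ℝ) = 0 → (y : ℝ) = 0 := by
    intro y hy
    by_contra hne
    have hy0 : 0 < (y : ℝ) := lt_of_le_of_ne y.2.1 (Ne.symm hne)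
    obtain ⟨n, hn⟩ := pow_unbounded_of_one_lt (y : ℝ)⁻¹ one_lt_two
    have h1 := hz n y hy
    rw [inv_lt_iff_one_lt_mul₀ hy0] at hn
    linarith
  have hone : ∀ y : Icc (0 : ℝ) 1, (k.1 y : ℝ) = 1 → (y : ℝ) = 1 := by
    intro y hy
    rcases le_or_gt (y : ℝ) (1 / 2) with h | h
    · linarith [hle y h, (hmem (tent y)).2]
    · have h1 := hzero _ (hs0 _ (by linarith [hgt y h] : smoothstep (k.1 (tent y)) = 0))
      rw [tent_of_ge h.le] at h1
      linarith
  have hcode : ∀ y : Icc (0 : ℝ) 1, (y : ℝ) ≤ 1 / 2 ↔ (k.1 y : ℝ) ≤ 1 / 2 := by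
    refine fun y => ⟨fun h => by linarith [hle y h, (hmem (tent y)).2], fun h => ?_⟩
    by_contra! hlt
    have h1 := hgt y hlt
    have h2 := hone _ (hs1 (tent y) (by linarith [(hmem (tent y)).2]))
    rw [tent_of_ge hlt.le] at h2
    linarith
  intro a b hab
  have hstep : ∀ n : ℕ, k.1 (tent^[n] a) = k.1 (tent^[n] b) := by
    intro n
    induction n with
    | zero => exact hab
    | succ n ih =>
      rw [Function.iterate_succ_apply', Function.iterate_succ_apply']
      set x := tent^[n] a
      set y := tent^[n] b
      refine Subtype.ext (smoothstep_injOn (k.1 _).2 (k.1 _).2 ?_)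
      have ih' : (k.1 x : ℝ) = k.1 y := congrArg _ ih
      rcases le_or_gt (x : ℝ) (1 / 2) with h | h
      · have h' : (y : ℝ) ≤ 1 / 2 := (hcode y).2 (ih' ▸ (hcode x).1 h)
        linarith [hle x h, hle y h']
      · have h' : 1 / 2 < (y : ℝ) := by
          by_contra! hle'
          exact h.not_ge ((hcode x).2 (ih'.symm ▸ (hcode y).1 hle'))
        linarith [hgt x h, hgt y h']
  refine injective_fullItinerary_tent (funext fun n => ?_)
  change tentCode (tent^[n] a) = tentCode (tent^[n] b)
  have hn := congrArg (Subtype.val) (hstep n)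
  unfold tentCode
  congr 1
  rw [eq_iff_iff, hcode, hcode (tent^[n] b), hn]

/-- A homeomorphism conjugating the tent map to the map with branches inverse to
`t ↦ smoothstep t / 2` and `t ↦ 1 - smoothstep t / 2`. -/
lemma exists_smoothstep_conjugacy : ∃ (H : Icc (0 : ℝ) 1 ≃ₜ Icc (0 : ℝ) 1) (φ : ℝ → ℝ),
    StrictMonoOn φ (Icc 0 1) ∧ φ 0 = 0 ∧ φ 1 = 1 ∧ (∀ y, (H y : ℝ) = φ y) ∧
    (∀ y ∈ Icc (0 : ℝ) (1 / 2), φ y = smoothstep (φ (2 * y)) / 2) ∧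
    ∀ y ∈ Icc (1 / 2 : ℝ) 1, φ y = 1 - smoothstep (φ (2 - 2 * y)) / 2 := by
  obtain ⟨k, hk⟩ := exists_foldOperator_fixed
  have h0 : ext k.1 0 = 0 := by
    have := ext_apply k.1 0
    rwa [k.2.1] at this
  have h1 : ext k.1 1 = 1 := by
    have := ext_apply k.1 1
    rwa [k.2.2] at this
  have hc := continuousOn_ext k.1.continuous
  have hinj : InjOn (ext k.1) (Icc 0 1) := by
    intro x hx y hy hxy
    have hx' := ext_apply k.1 ⟨x, hx⟩
    have hy' := ext_apply k.1 ⟨y, hy⟩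
    have h := fold_injective hk (Subtype.ext (hx'.symm.trans (hxy.trans hy')))
    exact congrArg Subtype.val h
  have hm : StrictMonoOn (ext k.1) (Icc 0 1) :=
    hc.strictMonoOn_of_injOn_Icc zero_le_one (by rw [h0, h1]; exact zero_le_one) hinj
  obtain ⟨H, hH⟩ := exists_homeomorph h0 h1 hc hm
  refine ⟨H, ext k.1, hm, h0, h1, hH, fun y hy => ?_, fun y hy => ?_⟩
  · have h := ext_apply k.1 ⟨y, hy.1, by linarith [hy.2]⟩
    have h2 := ext_apply k.1 (tent ⟨y, hy.1, by linarith [hy.2]⟩)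
    rw [tent_of_le hy.2] at h2
    rw [hk, foldValue, if_pos hy.2, ← h2] at h
    exact h
  · have h := ext_apply k.1 ⟨y, by linarith [hy.1], hy.2⟩
    have h2 := ext_apply k.1 (tent ⟨y, by linarith [hy.1], hy.2⟩)
    rw [tent_of_ge hy.1] at h2
    -- At `y = 1 / 2` the definition uses the left formula; both give `1 / 2`.
    rcases hy.1.eq_or_lt with rfl | hlt
    · rw [show (2 : ℝ) - 2 * (1 / 2) = 1 by norm_num] at h2 ⊢
      rw [hk, foldValue, if_pos le_rfl, ← h2] at h
      rw [h, h1, smoothstep_one]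
      norm_num
    · rw [hk, foldValue, if_neg hlt.not_ge, ← h2] at h
      exact h

end SmoothstepConjugacy

/-! ### The infinite exponent -/

section InfiniteExponent

variable {H : Icc (0 : ℝ) 1 ≃ₜ Icc (0 : ℝ) 1} {φ : ℝ → ℝ}

lemma exists_preimage_homeomorph (hH : ∀ y, (H y : ℝ) = φ y) {t : ℝ} (ht : t ∈ Icc (0 : ℝ) 1) :
    ∃ u ∈ Icc (0 : ℝ) 1, φ u = t :=
  ⟨H.symm ⟨t, ht⟩, (H.symm ⟨t, ht⟩).2, by rw [← hH, H.apply_symm_apply]⟩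

lemma ext_smoothstep_left (hH : ∀ y, (H y : ℝ) = φ y)
    (hl : ∀ y ∈ Icc (0 : ℝ) (1 / 2), φ y = smoothstep (φ (2 * y)) / 2) {t : ℝ}
    (ht : t ∈ Icc (0 : ℝ) 1) : ext (tentConj H) (smoothstep t / 2) = t := by
  obtain ⟨u, hu, rfl⟩ := exists_preimage_homeomorph hH ht
  have hy : u / 2 ∈ Icc (0 : ℝ) (1 / 2) := ⟨by linarith [hu.1], by linarith [hu.2]⟩
  have h1 := hl _ hy
  have h2 := ext_tentConj_left hH hy
  rw [mul_div_cancel₀ u two_ne_zero] at h1 h2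
  rw [← h1, h2]

/-- The inverse branch `1 - s(u) / 2` is decreasing; with `u = 1 - t` and `s(1 - t) = 1 - s(t)` it
becomes an increasing parametrization. -/
lemma ext_smoothstep_right (hH : ∀ y, (H y : ℝ) = φ y)
    (hr : ∀ y ∈ Icc (1 / 2 : ℝ) 1, φ y = 1 - smoothstep (φ (2 - 2 * y)) / 2) {t : ℝ}
    (ht : t ∈ Icc (0 : ℝ) 1) : ext (tentConj H) (1 / 2 + smoothstep t / 2) = 1 - t := by
  obtain ⟨u, hu, hut⟩ := exists_preimage_homeomorph hH (t := 1 - t)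
    ⟨by linarith [ht.2], by linarith [ht.1]⟩
  have hy : 1 - u / 2 ∈ Icc (1 / 2 : ℝ) 1 := ⟨by linarith [hu.2], by linarith [hu.1]⟩
  have h1 := hr _ hy
  have h2 := ext_tentConj_right hH hy
  rw [show 2 - 2 * (1 - u / 2) = u by ring, hut] at h1 h2
  rw [smoothstep_one_sub] at h1
  rw [← h2, h1]
  congr 1
  ring

lemma three_mul_pos {t : ℝ} (ht : t ∈ Ioo (0 : ℝ) 1) : 0 < 3 * (t * (1 - t)) :=
  mul_pos three_pos (mul_pos ht.1 (by linarith [ht.2]))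

lemma hasDerivAt_half_smoothstep (t : ℝ) :
    HasDerivAt (fun t => smoothstep t / 2) (3 * (t * (1 - t))) t :=
  ((hasDerivAt_smoothstep t).div_const 2).congr_deriv (by ring)

/-- With `m = 3 t (1 - t)` the quantity is `m / (1 + m)`, whose derivative is bounded by `3`. -/
lemma holder_inv_smoothstep : ∀ z ∈ Ioo (0 : ℝ) 1, ∀ w ∈ Ioo (0 : ℝ) 1,
    |(1 + (3 * (z * (1 - z)))⁻¹)⁻¹ - (1 + (3 * (w * (1 - w)))⁻¹)⁻¹| ≤
      (3 / √(1 / 2) + 1) * |smoothstep z / 2 - smoothstep w / 2| ^ (1 / 2 : ℝ) := by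
  refine holder_half_of_quadratic (W := fun t => (1 + (3 * (t * (1 - t)))⁻¹)⁻¹)
    (W' := fun t => 3 * (1 - 2 * t) / (1 + 3 * (t * (1 - t))) ^ 2)
    (p := fun t => smoothstep t / 2) (by norm_num) (by norm_num)
    (fun t ht => ?_) (fun t ht => ?_) fun z hz w hw hzw => ?_
  · have h0 := three_mul_pos ht
    have hd : HasDerivAt (fun t : ℝ => 3 * (t * (1 - t))) (3 * (1 - 2 * t)) t :=
      (((hasDerivAt_id t).mul ((hasDerivAt_id t).const_sub 1)).const_mul 3).congr_deriv
        (by simp; ring)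
    refine ((hd.div (hd.const_add 1) (by positivity)).congr_deriv ?_).congr_of_eventuallyEq ?_
    · congr 1
      ring
    · filter_upwards [isOpen_Ioo.mem_nhds ht] with x hx
      have hx0 := three_mul_pos hx
      rw [Pi.div_apply]
      generalize 3 * (x * (1 - x)) = m at hx0 ⊢
      field_simp
      ring
  · have h0 := three_mul_pos ht
    rw [abs_div, abs_of_pos (by positivity : 0 < (1 + 3 * (t * (1 - t))) ^ 2)]
    refine (div_le_self (abs_nonneg _) (one_le_pow₀ (by linarith))).trans ?_
    rw [abs_le]
    constructor <;> linarith [ht.1, ht.2]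
  · have := smoothstep_quadratic hz.1.le hzw hw.2.le
    linarith

lemma tendsto_inv_three_mul_left :
    Tendsto (fun t : ℝ => (3 * (t * (1 - t)))⁻¹) (𝓝[>] 0) atTop := by
  refine tendsto_inv_nhdsGT_zero.comp (tendsto_nhdsWithin_iff.2 ⟨?_, ?_⟩)
  · have : ContinuousAt (fun t : ℝ => 3 * (t * (1 - t))) 0 := by fun_prop
    simpa using this.tendsto.mono_left (nhdsWithin_le_nhds (s := Ioi 0))
  · filter_upwards [Ioo_mem_nhdsGT (zero_lt_one' ℝ)] with t ht using three_mul_pos ht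

lemma tendsto_inv_three_mul_right :
    Tendsto (fun t : ℝ => (3 * (t * (1 - t)))⁻¹) (𝓝[<] 1) atTop := by
  refine tendsto_inv_nhdsGT_zero.comp (tendsto_nhdsWithin_iff.2 ⟨?_, ?_⟩)
  · have : ContinuousAt (fun t : ℝ => 3 * (t * (1 - t))) 1 := by fun_prop
    simpa using this.tendsto.mono_left (nhdsWithin_le_nhds (s := Iio 1))
  · filter_upwards [Ioo_mem_nhdsLT (zero_lt_one' ℝ)] with t ht using three_mul_pos ht

lemma isCuspMap_smoothstep (hH : ∀ y, (H y : ℝ) = φ y)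
    (hl : ∀ y ∈ Icc (0 : ℝ) (1 / 2), φ y = smoothstep (φ (2 * y)) / 2)
    (hr : ∀ y ∈ Icc (1 / 2 : ℝ) 1, φ y = 1 - smoothstep (φ (2 - 2 * y)) / 2) :
    IsCuspMap 0 1 (ext (tentConj H)) := by
  have hcd : ∀ z, ContDiffAt ℝ 1 (fun t => smoothstep t / 2) z := fun z =>
    (contDiff_smoothstep.div_const 2).contDiffAt
  have hc : Continuous smoothstep := (contDiff_smoothstep (n := 0)).continuous
  have habs : ∀ z ∈ Ioo (0 : ℝ) 1, |(3 * (z * (1 - z)))⁻¹| = (3 * (z * (1 - z)))⁻¹ := fun z hz =>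
    abs_of_pos (inv_pos.2 (three_mul_pos hz))
  refine isCuspMap_of_branches (c := 1 / 2) (ε := 1 / 2) (by norm_num)
    (continuousOn_ext (continuous_tentConj H)) (mapsTo_ext _) ?_ ?_
  · refine IsCuspBranch.of_parametrization (p := fun t => smoothstep t / 2) (q := id)
      (p' := fun t => 3 * (t * (1 - t))) (q' := fun _ => 1) (α := 0) (β := 1) zero_lt_one
      (hc.div_const 2).continuousOn (by norm_num [smoothstep_zero])
      (by norm_num [smoothstep_one]) (fun z _ => hcd z) (fun z _ => contDiffAt_id)
      (fun z _ => hasDerivAt_half_smoothstep z) (fun z _ => hasDerivAt_id z)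
      (fun z hz => three_mul_pos hz)
      (fun z hz => ext_smoothstep_left hH hl (Ioo_subset_Icc_self hz))
      (Or.inl fun _ _ => one_pos) (Or.inr (Or.inl ?_)) (Or.inr (Or.inl ?_))
      (by positivity : 0 < 3 / √(1 / 2 : ℝ) + 1) fun z hz w hw => ?_
    · simpa only [one_div] using tendsto_inv_three_mul_left
    · simpa only [one_div] using tendsto_inv_three_mul_right
    · rw [one_div, one_div, habs z hz, habs w hw]
      exact holder_inv_smoothstep z hz w hw
  · refine IsCuspBranch.of_parametrization (p := fun t => 1 / 2 + smoothstep t / 2)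
      (q := fun t => 1 - t)
      (p' := fun t => 3 * (t * (1 - t))) (q' := fun _ => -1) (α := 0) (β := 1) zero_lt_one
      (continuous_const.add (hc.div_const 2)).continuousOn (by norm_num [smoothstep_zero])
      (by norm_num [smoothstep_one]) (fun z _ => contDiffAt_const.add (hcd z))
      (fun z _ => by fun_prop)
      (fun z _ => (hasDerivAt_half_smoothstep z).const_add _)
      (fun z _ => (hasDerivAt_id z).const_sub 1)
      (fun z hz => three_mul_pos hz)
      (fun z hz => ext_smoothstep_right hH hr (Ioo_subset_Icc_self hz))
      (Or.inr fun _ _ => by norm_num) (Or.inr (Or.inr ?_)) (Or.inr (Or.inr ?_))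
      (by positivity : 0 < 3 / √(1 / 2 : ℝ) + 1) fun z hz w hw => ?_
    · simpa only [neg_div, one_div, Function.comp_def] using
        tendsto_neg_atTop_atBot.comp tendsto_inv_three_mul_left
    · simpa only [neg_div, one_div, Function.comp_def] using
        tendsto_neg_atTop_atBot.comp tendsto_inv_three_mul_right
    · rw [neg_div, neg_div, one_div, one_div, abs_neg, abs_neg, habs z hz, habs w hw,
        add_sub_add_left_eq_sub]
      exact holder_inv_smoothstep z hz w hw

/-- The derivative comes from the explicit inverse branches, so no derivative of the conjugacy `φ`
enters. -/
lemma abs_derivWithin_smoothstep (hm : StrictMonoOn φ (Icc 0 1)) (h0 : φ 0 = 0) (h1 : φ 1 = 1)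
    (hH : ∀ y, (H y : ℝ) = φ y)
    (hl : ∀ y ∈ Icc (0 : ℝ) (1 / 2), φ y = smoothstep (φ (2 * y)) / 2)
    (hr : ∀ y ∈ Icc (1 / 2 : ℝ) 1, φ y = 1 - smoothstep (φ (2 - 2 * y)) / 2)
    {y : Icc (0 : ℝ) 1} (hy : (y : ℝ) ∈ Ioo (0 : ℝ) 1) (hy' : (y : ℝ) ≠ 1 / 2) :
    φ (tent y) ∈ Ioo (0 : ℝ) 1 ∧ |derivWithin (ext (tentConj H)) (Icc 0 1) (H y)| =
      (3 * (φ (tent y) * (1 - φ (tent y))))⁻¹ := by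
  have hmem : ∀ {u : ℝ}, u ∈ Ioo (0 : ℝ) 1 → φ u ∈ Ioo (0 : ℝ) 1 := fun {u} hu =>
    ⟨h0 ▸ hm (left_mem_Icc.2 zero_le_one) (Ioo_subset_Icc_self hu) hu.1,
      h1 ▸ hm (Ioo_subset_Icc_self hu) (right_mem_Icc.2 zero_le_one) hu.2⟩
  have hcd : ∀ z, ContDiffAt ℝ 1 (fun t => smoothstep t / 2) z := fun z =>
    (contDiff_smoothstep.div_const 2).contDiffAt
  rw [hH, derivWithin_of_mem_nhds (Icc_mem_nhds (hmem hy).1 (hmem hy).2)]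
  rcases lt_or_gt_of_ne hy' with h | h
  · have ht := hmem (two_mul_mem_Ioo ⟨hy.1, h⟩)
    rw [tent_of_le h.le, hl y ⟨hy.1.le, h.le⟩]
    refine ⟨ht, ?_⟩
    have hd := HasDerivAt.of_parametrization (g := ext (tentConj H)) (q := id) (hcd _)
      (hasDerivAt_half_smoothstep _) (three_mul_pos ht).ne' contDiffAt_id (hasDerivAt_id _)
      ((isOpen_Ioo.eventually_mem ht).mono fun w hw =>
        ext_smoothstep_left hH hl (Ioo_subset_Icc_self hw))
    rw [hd.deriv, one_div, abs_of_pos (inv_pos.2 (three_mul_pos ht))]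
  · have ht := hmem (two_sub_mem_Ioo ⟨h, hy.2⟩)
    rw [tent_of_ge h.le, hr y ⟨h.le, hy.2.le⟩]
    refine ⟨ht, ?_⟩
    set t := φ (2 - 2 * y)
    have ht' : 1 - t ∈ Ioo (0 : ℝ) 1 := ⟨by linarith [ht.2], by linarith [ht.1]⟩
    have hd := HasDerivAt.of_parametrization (g := ext (tentConj H)) (q := fun t => 1 - t)
      (contDiffAt_const.add (hcd (1 - t)))
      ((hasDerivAt_half_smoothstep (1 - t)).const_add (1 / 2)) (three_mul_pos ht').ne'
      (by fun_prop) ((hasDerivAt_id _).const_sub 1)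
      ((isOpen_Ioo.eventually_mem ht').mono fun w hw =>
        ext_smoothstep_right hH hr (Ioo_subset_Icc_self hw))
    have e : 1 - smoothstep t / 2 = 1 / 2 + smoothstep (1 - t) / 2 := by
      rw [smoothstep_one_sub]
      ring
    rw [e, hd.deriv, neg_div, abs_neg, one_div, abs_of_pos (inv_pos.2 (three_mul_pos ht'))]
    congr 2
    ring

/-- The inverse branch is quadratic at `0`, whence `3 φ(y) ≤ (3 φ(2 y))²`: the quantity `-log (3 φ)`
at least doubles each time `y` is halved. It starts from `φ(1 / 4) = 1 / 4`. -/
lemma le_neg_log_conjugacy (hm : StrictMonoOn φ (Icc 0 1)) (h0 : φ 0 = 0) (h1 : φ 1 = 1)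
    (hl : ∀ y ∈ Icc (0 : ℝ) (1 / 2), φ y = smoothstep (φ (2 * y)) / 2) :
    ∀ (n : ℕ), ∀ y, 0 < y → 2 ^ n * y ≤ 1 / 4 → 2 ^ n * Real.log (4 / 3) ≤ -Real.log (3 * φ y) := by
  have hpos : ∀ y ∈ Icc (0 : ℝ) 1, 0 < y → 0 < φ y := fun y hy h =>
    h0 ▸ hm (left_mem_Icc.2 zero_le_one) hy h
  have hhalf : φ (1 / 2) = 1 / 2 := by
    rw [hl _ (by norm_num), show (2 : ℝ) * (1 / 2) = 1 by norm_num, h1, smoothstep_one]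
  have hquarter : φ (1 / 4) = 1 / 4 := by
    rw [hl _ (by norm_num), show (2 : ℝ) * (1 / 4) = 1 / 2 by norm_num, hhalf]
    norm_num [smoothstep]
  intro n
  induction n with
  | zero =>
    intro y hy hy4
    rw [pow_zero, one_mul] at hy4 ⊢
    have h2 := hm.monotoneOn ⟨hy.le, by linarith⟩ (by norm_num) hy4
    have h3 := hpos y ⟨hy.le, by linarith⟩ hy
    rw [hquarter] at h2
    rw [← Real.log_inv]
    refine Real.log_le_log (by norm_num) ?_
    rw [le_inv_comm₀ (by norm_num) (by positivity)]
    norm_num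
    linarith
  | succ n ih =>
    intro y hy hyn
    have h2 : 2 ^ n * (2 * y) ≤ 1 / 4 := by rw [pow_succ] at hyn; linarith
    have h3 := ih (2 * y) (by linarith) h2
    have hone : (1 : ℝ) ≤ 2 ^ n := one_le_pow₀ one_le_two
    have hy4 : 2 * y ≤ 1 / 4 := by nlinarith
    have h4 := hpos y ⟨hy.le, by linarith⟩ hy
    have h5 := hpos (2 * y) ⟨by linarith, by linarith⟩ (by linarith)
    have h6 : 3 * φ y ≤ (3 * φ (2 * y)) ^ 2 := by
      rw [hl y ⟨hy.le, by linarith⟩]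
      unfold smoothstep
      nlinarith [pow_pos h5 2, pow_pos h5 3]
    have h7 := Real.log_le_log (by positivity) h6
    rw [Real.log_pow] at h7
    rw [pow_succ]
    push_cast at h7
    linarith

/-- A map for which the Lyapunov exponent is infinite. -/
theorem exists_lyapunov_top :
    ∃ (f : Icc (0 : ℝ) 1 → Icc (0 : ℝ) 1) (h : Icc (0 : ℝ) 1 ≃ₜ Icc (0 : ℝ) 1),
      TC f h ∧ HasLyapunovExponent f (muOf h) ⊤ := by
  obtain ⟨H, φ, hm, h0, h1, hH, hl, hr⟩ := exists_smoothstep_conjugacy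
  refine ⟨tentConj H, H.symm, ⟨⟨0, 1, ext (tentConj H), le_rfl, le_rfl,
    isCuspMap_smoothstep hH hl hr, ext_apply _⟩, semiconj_tentConj H⟩, ?_⟩
  have hR : ∀ᵐ y ∂(leb 0 1), |derivWithin (ext (tentConj H)) (Icc 0 1) (H y)| =
      (3 * (φ (tent y) * (1 - φ (tent y))))⁻¹ ∧ 0 < (3 * (φ (tent y) * (1 - φ (tent y))))⁻¹ := by
    filter_upwards [ae_leb_mem_Ioo] with y hy
    have h := abs_derivWithin_smoothstep hm h0 h1 hH hl hr hy.1 hy.2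
    exact ⟨h.2, inv_pos.2 (three_mul_pos h.1)⟩
  -- The map expands everywhere: `3 t (1 - t) ≤ 3 / 4`.
  have hneg : lyapunovNeg (tentConj H) (muOf H.symm) = 0 := by
    rw [lyapunovNeg_eq hR, ← lintegral_zero (μ := leb 0 1)]
    refine lintegral_congr_ae ?_
    filter_upwards [ae_leb_mem_Ioo] with y hy
    have h := three_mul_pos (abs_derivWithin_smoothstep hm h0 h1 hH hl hr hy.1 hy.2).1
    refine ENNReal.ofReal_of_nonpos ?_
    rw [Real.log_inv, neg_neg]
    refine Real.log_nonpos h.le ?_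
    nlinarith [sq_nonneg (φ (tent y) - 1 / 2)]
  have hpos : lyapunovPos (tentConj H) (muOf H.symm) = ⊤ := by
    have hmeas : Measurable fun y : Icc (0 : ℝ) 1 =>
        ENNReal.ofReal (Real.log (3 * (φ y * (1 - φ y)))⁻¹) := by
      have hφ : Measurable fun y : Icc (0 : ℝ) 1 => φ y := by
        simp only [← hH]
        exact (continuous_subtype_val.comp H.continuous).measurable
      exact ((measurable_const.mul (hφ.mul (measurable_const.sub hφ))).inv.log).ennreal_ofReal
    -- The integrand depends on `tent y` only, so invariance of Lebesgue measure removes the tent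
    -- map.
    rw [lyapunovPos_eq hR, measurePreserving_tent.lintegral_comp hmeas]
    have hlog : 0 < Real.log (4 / 3) := Real.log_pos (by norm_num)
    refine lintegral_leb_eq_top
      (u := fun y => ENNReal.ofReal (Real.log (3 * (φ y * (1 - φ y)))⁻¹)) (a := 0) (b := 1 / 4)
      (c := 0) (K := Real.log (4 / 3) / 8) le_rfl (by norm_num) (by norm_num) (by norm_num)
      (by positivity) fun y hy => ENNReal.ofReal_le_ofReal ?_
    -- Take `n` with `2 ^ n ≤ 1 / (4 y) < 2 ^ (n + 1)`. Then `2 ^ n ≥ 1 / (8 y)`, which gives the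
    -- nonintegrable lower bound `log (4 / 3) / (8 y)`.
    obtain ⟨n, hn1, hn2⟩ := exists_nat_pow_near (x := (4 * y)⁻¹) (y := (2 : ℝ))
      ((one_le_inv₀ (by linarith [hy.1])).2 (by linarith [hy.2])) one_lt_two
    have hy0 := hy.1
    have h2 : 2 ^ n * y ≤ 1 / 4 := by
      rw [le_inv_comm₀ (by positivity) (by positivity)] at hn1
      have := mul_le_mul_of_nonneg_left hn1 (by positivity : (0 : ℝ) ≤ 2 ^ n)
      rw [mul_inv_cancel₀ (by positivity)] at this
      linarith
    have h3 := le_neg_log_conjugacy hm h0 h1 hl n y hy0 h2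
    have h4 : y⁻¹ / 8 ≤ 2 ^ n := by
      rw [mul_inv, pow_succ] at hn2
      linarith
    have hyI : y ∈ Icc (0 : ℝ) 1 := ⟨hy0.le, by linarith [hy.2]⟩
    have h5 : 0 < φ y := h0 ▸ hm (left_mem_Icc.2 zero_le_one) hyI hy0
    have h6 : φ y < 1 := h1 ▸ hm hyI (right_mem_Icc.2 zero_le_one) (by linarith [hy.2])
    have h7 : Real.log (3 * (φ y * (1 - φ y))) ≤ Real.log (3 * φ y) :=
      Real.log_le_log (three_mul_pos ⟨h5, h6⟩) (by nlinarith)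
    rw [Real.log_inv, sub_zero, abs_of_pos hy0]
    have h8 := mul_le_mul_of_nonneg_right h4 hlog.le
    linarith
  refine ⟨Or.inr (by rw [hneg]; exact ENNReal.zero_ne_top), ?_⟩
  rw [hpos, hneg]
  simp

end InfiniteExponent

end CuspMaps

end

theorem proposition43 :
    -- every map in the class `TC`: the measure `μ_f` is ergodic and is the measure of maximal
    -- entropy
    (∀ (a b : ℝ) (f : Set.Icc a b → Set.Icc a b) (h : Set.Icc a b ≃ₜ Set.Icc (0 : ℝ) 1),
      CuspMaps.TC f h →
        Ergodic f (CuspMaps.muOf h) ∧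
        CuspMaps.IsTheMeasureOfMaximalEntropy f (CuspMaps.muOf h)) ∧
    -- every map in the class `TC^∞`: the measure `μ_f` is absolutely continuous
    (∀ (a b : ℝ) (f : Set.Icc a b → Set.Icc a b) (h : Set.Icc a b ≃ₜ Set.Icc (0 : ℝ) 1),
      CuspMaps.TCSmooth f h →
        (CuspMaps.muOf h).AbsolutelyContinuous (CuspMaps.leb a b)) ∧
    -- poles at the boundary, Lyapunov exponent `log 2`
    (∃ (f : Set.Icc (0 : ℝ) 1 → Set.Icc (0 : ℝ) 1)
        (h : Set.Icc (0 : ℝ) 1 ≃ₜ Set.Icc (0 : ℝ) 1),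
      CuspMaps.TCSmooth f h ∧ CuspMaps.HasPolesAtBoundary f ∧
        CuspMaps.HasLyapunovExponent f (CuspMaps.muOf h) ((Real.log 2 : ℝ) : EReal)) ∧
    -- the Lyapunov exponent does not exist
    (∃ (f : Set.Icc (0 : ℝ) 1 → Set.Icc (0 : ℝ) 1)
        (h : Set.Icc (0 : ℝ) 1 ≃ₜ Set.Icc (0 : ℝ) 1),
      CuspMaps.TCSmooth f h ∧
        ¬ ∃ χ : EReal, CuspMaps.HasLyapunovExponent f (CuspMaps.muOf h) χ) ∧
    -- a smooth parabolic fixed point at the boundary, Lyapunov exponent `log 2`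
    (∃ (f : Set.Icc (0 : ℝ) 1 → Set.Icc (0 : ℝ) 1)
        (h : Set.Icc (0 : ℝ) 1 ≃ₜ Set.Icc (0 : ℝ) 1),
      CuspMaps.TCSmooth f h ∧
        (∃ p : Set.Icc (0 : ℝ) 1, ((p : ℝ) = 0 ∨ (p : ℝ) = 1) ∧
          CuspMaps.IsSmoothParabolicFixedPoint f p) ∧
        CuspMaps.HasLyapunovExponent f (CuspMaps.muOf h) ((Real.log 2 : ℝ) : EReal)) ∧
    -- infinite positive Lyapunov exponent
    (∃ (f : Set.Icc (0 : ℝ) 1 → Set.Icc (0 : ℝ) 1)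
        (h : Set.Icc (0 : ℝ) 1 ≃ₜ Set.Icc (0 : ℝ) 1),
      CuspMaps.TC f h ∧
        CuspMaps.HasLyapunovExponent f (CuspMaps.muOf h) ⊤) :=
  ⟨fun _ _ _ _ hTC => CuspMaps.ergodic_and_maximal_entropy hTC.conj,
    fun _ _ _ _ hTC => CuspMaps.absolutelyContinuous_muOf hTC.smooth,
    CuspMaps.exists_poles_log_two, CuspMaps.exists_no_lyapunov,
    CuspMaps.exists_parabolic_log_two, CuspMaps.exists_lyapunov_top⟩
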